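/- Let $(Q,\mathfrak m,\mathsf k)$ be a commutative Noetherian local ring with $\operatorname{char}\mathsf k=0$, and let $(f,g)$ be an exact pair of zero divisors in $Q$, that is, $f,g\neq 0$, $\operatorname{ann}_Q(f)=(g)$ and $\operatorname{ann}_Q(g)=(f)$. Set $R=Q/(f)$ and $S=Q/(f,g)$, and let $A=Q\langle y,t\mid \partial y=f,\ \partial t=gy\rangle$ ($y$ an exterior variable of degree $1$, $t$ a divided powers variable of degree $2$) be the Tate resolution of $R$ over $Q$; it has $Q$-basis $(y_i)_{i\ge 0}$ with $y_{2i}=t^{(i)}$, $y_{2i+1}=t^{(i)}y$. Let $M$ be any $R$-module. (1) There is a dg resolution of $M$: a dg $A$-module $U$, concentrated in nonnegative degrees, whose underlying graded $A$-module is free with a homogeneous basis $(e_\delta)$, together with an augmentation $\varepsilon\colon U\to M$ that makes it a free resolution of $M$ over $Q$. (2) Let $U$ be any such dg resolution. Let $V_n$ be the free $Q$-module on the $e_\delta$ of degree $n$, so that $U_n=\bigoplus_{i=0}^{n}y_iV_{n-i}$, let $\pi_n\colon U_n\to V_n$ be the projection, and put $\partial^V_n=\pi_{n-1}\partial|_{V_n}\colon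 V_n\to V_{n-1}$. Then there are maps $\widetilde\tau\colon V_n\to V_{n-2}$ with $(\partial^V)^2=f\widetilde\tau$. Fix any such $\widetilde\tau$, let $\tau=\widetilde\tau\otimes_QS\colon V_n\otimes_QS\to V_{n-2}\otimes_QS$ be the Eisenbud operator, which is a chain map of degree $-2$, and let $W$ be its mapping cone: $$W_n=(V_{n-1}\otimes_QS)\oplus(V_n\otimes_QS),\qquad \partial^W(x,a)=(-\partial^V x-\tau a,\ \partial^V a).$$ Then $U'=(V\otimes_QR,\ \partial^V\otimes_Q R)$, with the augmentation induced by $\varepsilon$, is a free resolution of $M$ over $R$. Moreover, for every $R$-module $N$ with $gN=0$, there are two long exact sequences of $Q$-modules (in which $\mathrm{Tor}_n=0$ and $\mathrm H_n=0$ for $n<0$) $$\cdots\to \mathrm{Tor}^R_{n-1}(M,N)\to \mathrm H_n(W\otimes_SN)\xrightarrow{\psi_n}\mathrm{Tor}^R_n(M,N)\xrightarrow{\delta_n}\mathrm{Tor}^R_{n-2}(M,N)\to\cdots$$ $$\cdots\to \mathrm H_{n+1}(W\otimes_SN)\xrightarrow{\mu_{n+1}}\mathrm{Tor}^Q_{n-2}(M,N)\to\mathrm{Tor}^Q_n(M,N)\xrightarrow{\phi_n}\mathrm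 H_n(W\otimes_SN)\to\cdots$$ Here $\delta_n$ is the map induced by $\tau\otimes_SN$ under the identifications $\mathrm{Tor}^R_n(M,N)=\mathrm H_n(U'\otimes_RN)=\mathrm H_n((V\otimes_QS)\otimes_SN)$, and, for every $n\ge 0$, $\psi_n\phi_n\colon\mathrm{Tor}^Q_n(M,N)\to\mathrm{Tor}^R_n(M,N)$ is the natural change-of-rings map induced by $Q\to R$. -/

import Mathlib

open CategoryTheory MonoidalCategory TensorProduct

universe u

noncomputable section

namespace ExactZeroDivisor

/-- `(f, g)` is an exact pair of zero divisors: `f` and `g` are nonzero, `ann f = (g)` and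
`ann g = (f)`. -/
structure IsExactPair {Q : Type*} [CommRing Q] (f g : Q) : Prop where
  left_ne_zero : f ≠ 0
  right_ne_zero : g ≠ 0
  ann_left : ∀ x : Q, x * f = 0 ↔ x ∈ Ideal.span {g}
  ann_right : ∀ x : Q, x * g = 0 ↔ x ∈ Ideal.span {f}

/-- (Strictly graded commutative) dg algebra structures, with homological grading by `ℕ`, on an
associative unital `Q`-algebra `A`. -/
structure DGAlgebra (Q A : Type*) [CommRing Q] [Ring A] [Algebra Q A] where
  deg : ℕ → Submodule Q A
  isInternal : DirectSum.IsInternal deg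
  one_mem : (1 : A) ∈ deg 0
  mul_mem : ∀ {i j : ℕ} {a b : A}, a ∈ deg i → b ∈ deg j → a * b ∈ deg (i + j)
  mul_comm : ∀ {i j : ℕ} {a b : A}, a ∈ deg i → b ∈ deg j → a * b = (-1) ^ (i * j) * (b * a)
  mul_self : ∀ {i : ℕ} {a : A}, Odd i → a ∈ deg i → a * a = 0
  d : A →ₗ[Q] A
  d_zero : ∀ {a : A}, a ∈ deg 0 → d a = 0
  d_mem : ∀ {n : ℕ} {a : A}, a ∈ deg (n + 1) → d a ∈ deg n
  d_d : ∀ a : A, d (d a) = 0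
  leibniz : ∀ {i : ℕ} {a : A} (b : A), a ∈ deg i → d (a * b) = d a * b + (-1) ^ i * (a * d b)

/-- (Nonnegatively graded) dg module structures over a dg algebra `D`, on an `A`-module `U`. -/
structure DGModule {Q A : Type*} [CommRing Q] [Ring A] [Algebra Q A] (D : DGAlgebra Q A)
    (U : Type*) [AddCommGroup U] [Module Q U] [Module A U] [IsScalarTower Q A U] where
  deg : ℕ → Submodule Q U
  isInternal : DirectSum.IsInternal deg
  smul_mem : ∀ {i j : ℕ} {a : A} {u : U}, a ∈ D.deg i → u ∈ deg j → a • u ∈ deg (i + j)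
  d : U →ₗ[Q] U
  d_zero : ∀ {u : U}, u ∈ deg 0 → d u = 0
  d_mem : ∀ {n : ℕ} {u : U}, u ∈ deg (n + 1) → d u ∈ deg n
  d_d : ∀ u : U, d (d u) = 0
  leibniz : ∀ {i : ℕ} {a : A} (u : U), a ∈ D.deg i →
    d (a • u) = D.d a • u + (-1 : ℤ) ^ i • (a • d u)

/-! ### The Tate resolution `Q⟨y, t ∣ ∂y = f, ∂t = g y⟩` of `Q ⧸ (f)` -/

/-- The graded algebra underlying `Q⟨y, t⟩`, with `y` an exterior variable of degree `1` and `t` a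
divided powers variable of degree `2`: the free `Q`-module on `y₀, y₁, y₂, …`, where
`y_{2i} = t^{(i)}` and `y_{2i+1} = t^{(i)} y`. -/
def TateAlg (Q : Type*) [CommRing Q] : Type _ := ℕ →₀ Q

namespace TateAlg

variable {Q : Type*} [CommRing Q]

instance : AddCommGroup (TateAlg Q) := inferInstanceAs (AddCommGroup (ℕ →₀ Q))
instance : Module Q (TateAlg Q) := inferInstanceAs (Module Q (ℕ →₀ Q))

/-- The basis element `y_i`. -/
def y (i : ℕ) : TateAlg Q := (Finsupp.single i (1 : Q) : ℕ →₀ Q)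

/-- The `Q`-basis `(y_i)`. -/
def basis : Module.Basis ℕ Q (TateAlg Q) := Module.Basis.ofRepr (LinearEquiv.refl Q (ℕ →₀ Q))

/-- The coefficient of `y_i`. -/
def coeff (i : ℕ) : TateAlg Q →ₗ[Q] Q := (Finsupp.lapply i : (ℕ →₀ Q) →ₗ[Q] Q)

lemma basis_apply (i : ℕ) : (basis i : TateAlg Q) = y i := rfl

lemma coeff_y (i j : ℕ) : coeff i (y j : TateAlg Q) = if j = i then 1 else 0 :=
  Finsupp.single_apply

/-- The structure constants: `y_i y_j = c i j y_{i + j}`. -/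
def c (i j : ℕ) : ℕ := if Odd i ∧ Odd j then 0 else (i / 2 + j / 2).choose (i / 2)

lemma c_comm (i j : ℕ) : c i j = c j i := by
  unfold c
  by_cases h : Odd i ∧ Odd j
  · rw [if_pos h, if_pos h.symm]
  · rw [if_neg h, if_neg (fun h' => h h'.symm), Nat.choose_symm_add, Nat.add_comm]

lemma c_zero_left (j : ℕ) : c 0 j = 1 := by simp [c]

lemma c_assoc (i j k : ℕ) : c i j * c (i + j) k = c j k * c i (j + k) := by
  have key : ∀ a b d : ℕ, (a + b).choose a * (a + b + d).choose (a + b)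
      = (b + d).choose b * (a + (b + d)).choose a := by
    intro a b d
    have h := Nat.choose_mul (n := a + b + d) (show a ≤ a + b by omega)
    rw [show a + b + d - a = b + d by omega, show a + b - a = b by omega] at h
    rw [Nat.mul_comm, h, Nat.mul_comm, Nat.add_assoc]
  unfold c
  by_cases h : (Odd i ∧ Odd j) ∨ (Odd i ∧ Odd k) ∨ (Odd j ∧ Odd k)
  · simp only [Nat.odd_iff] at *
    split_ifs <;> first | simp; done | omega
  · simp only [Nat.odd_iff] at *
    rw [if_neg (by omega), if_neg (by omega), if_neg (by omega), if_neg (by omega),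
      show (i + j) / 2 = i / 2 + j / 2 by omega, show (j + k) / 2 = j / 2 + k / 2 by omega]
    exact key _ _ _

/-- The multiplication of `Q⟨y, t⟩`. -/
def mulₗ : TateAlg Q →ₗ[Q] TateAlg Q →ₗ[Q] TateAlg Q :=
  basis.constr Q fun i => basis.constr Q fun j => (c i j : Q) • y (i + j)

instance : Mul (TateAlg Q) := ⟨fun a b => mulₗ a b⟩
instance : One (TateAlg Q) := ⟨y 0⟩

lemma mul_def (a b : TateAlg Q) : a * b = mulₗ a b := rfl

lemma one_def : (1 : TateAlg Q) = y 0 := rfl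

lemma y_mul_y (i j : ℕ) : (y i * y j : TateAlg Q) = (c i j : Q) • y (i + j) := by
  rw [mul_def, mulₗ, ← basis_apply, ← basis_apply, Module.Basis.constr_basis,
    Module.Basis.constr_basis]

lemma induction {p : TateAlg Q → Prop} (a : TateAlg Q) (hy : ∀ i, p (y i))
    (add : ∀ a b, p a → p b → p (a + b)) (smul : ∀ (q : Q) a, p a → p (q • a)) : p a := by
  have h := (basis (Q := Q)).span_eq ▸ Submodule.mem_top (x := a)
  induction h using Submodule.span_induction with
  | mem x hx => obtain ⟨i, rfl⟩ := hx; exact hy i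
  | zero => simpa using smul 0 _ (hy 0)
  | add x x' _ _ h h' => exact add _ _ h h'
  | smul q x _ h => exact smul _ _ h

lemma smul_mul' (q : Q) (a b : TateAlg Q) : q • a * b = q • (a * b) := by
  simp [mul_def]

lemma mul_smul' (q : Q) (a b : TateAlg Q) : a * q • b = q • (a * b) := by
  simp [mul_def]

lemma add_mul' (a b c : TateAlg Q) : (a + b) * c = a * c + b * c := by
  simp [mul_def]

lemma mul_add' (a b c : TateAlg Q) : a * (b + c) = a * b + a * c := by
  simp [mul_def]

lemma mul_comm' (a b : TateAlg Q) : a * b = b * a := by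
  induction a using induction with
  | hy i =>
    induction b using induction with
    | hy j => rw [y_mul_y, y_mul_y, c_comm, Nat.add_comm]
    | add b b' h h' => rw [mul_add', add_mul', h, h']
    | smul q b h => rw [mul_smul', smul_mul', h]
  | add a a' h h' => rw [mul_add', add_mul', h, h']
  | smul q a h => rw [mul_smul', smul_mul', h]

lemma mul_assoc' (a b d : TateAlg Q) : a * b * d = a * (b * d) := by
  induction a using induction with
  | hy i =>
    induction b using induction with
    | hy j =>
      induction d using induction with
      | hy k =>
        rw [y_mul_y, y_mul_y, smul_mul', mul_smul', y_mul_y, y_mul_y, smul_smul, smul_smul,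
          ← Nat.cast_mul, ← Nat.cast_mul, c_assoc, Nat.add_assoc]
      | add b b' h h' => simp only [mul_add', h, h']
      | smul q b h => simp only [mul_smul', h]
    | add b b' h h' => simp only [mul_add', add_mul', h, h']
    | smul q b h => simp only [mul_smul', smul_mul', h]
  | add a a' h h' => simp only [add_mul', h, h']
  | smul q a h => simp only [smul_mul', h]

lemma one_mul' (a : TateAlg Q) : 1 * a = a := by
  induction a using induction with
  | hy i => rw [one_def, y_mul_y, c_zero_left]; simp
  | add a a' h h' => rw [mul_add', h, h']
  | smul q a h => rw [mul_smul', h]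

instance : CommRing (TateAlg Q) where
  __ := (inferInstance : AddCommGroup (TateAlg Q))
  left_distrib := mul_add'
  right_distrib := add_mul'
  zero_mul a := by simp [mul_def]
  mul_zero a := by simp [mul_def]
  mul_assoc := mul_assoc'
  one_mul := one_mul'
  mul_one a := by rw [mul_comm', one_mul']
  mul_comm := mul_comm'

instance : Algebra Q (TateAlg Q) := Algebra.ofModule smul_mul' mul_smul'

/-- The component of degree `n`: the span of `y_n`. -/
def deg (n : ℕ) : Submodule Q (TateAlg Q) := Submodule.span Q {y n}

lemma mem_deg {n : ℕ} {a : TateAlg Q} : a ∈ deg n ↔ ∃ q : Q, q • y n = a :=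
  Submodule.mem_span_singleton

lemma isInternal_deg : DirectSum.IsInternal (deg (Q := Q)) := by
  rw [DirectSum.isInternal_submodule_iff_iSupIndep_and_iSup_eq_top]
  refine ⟨?_, ?_⟩
  · exact (basis (Q := Q)).linearIndependent.iSupIndep_span_singleton
  · have := (basis (Q := Q)).span_eq
    rw [← this, Submodule.span_range_eq_iSup]
    rfl

/-- The differential: `∂ y_{2n+1} = f y_{2n}`, `∂ y_{2n+2} = g y_{2n+1}`, `∂ y_0 = 0`. -/
def d (f g : Q) : TateAlg Q →ₗ[Q] TateAlg Q :=
  basis.constr Q fun i => match i with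
    | 0 => 0
    | n + 1 => (if Even n then f else g) • y n

lemma d_y_zero (f g : Q) : d f g (y 0) = 0 := by
  rw [d, ← basis_apply, Module.Basis.constr_basis]

lemma d_y_succ (f g : Q) (n : ℕ) : d f g (y (n + 1)) = (if Even n then f else g) • y n := by
  rw [d, ← basis_apply, Module.Basis.constr_basis]

lemma d_d {f g : Q} (h : f * g = 0) (a : TateAlg Q) : d f g (d f g a) = 0 := by
  induction a using induction with
  | hy i =>
    match i with
    | 0 => rw [d_y_zero, map_zero]
    | 1 => rw [d_y_succ, map_smul, d_y_zero, smul_zero]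
    | n + 2 =>
      rw [d_y_succ, map_smul, d_y_succ, smul_smul]
      rcases Nat.even_or_odd n with hn | hn
      · rw [if_neg (by simpa [Nat.even_add_one] using hn), if_pos hn, mul_comm, h, zero_smul]
      · rw [if_pos (by simpa [Nat.even_add_one] using hn), if_neg (by simpa using hn), h, zero_smul]
  | add a b ha hb => rw [map_add, map_add, ha, hb, add_zero]
  | smul q a ha => rw [map_smul, map_smul, ha, smul_zero]

lemma leibniz_y (f g : Q) (i j : ℕ) :
    d f g (y i * y j) = d f g (y i) * y j + (-1) ^ i * (y i * d f g (y j)) := by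
  match i, j with
  | 0, j => rw [d_y_zero, ← one_def]; simp
  | i + 1, 0 => rw [d_y_zero, ← one_def]; simp
  | i + 1, j + 1 =>
    rw [y_mul_y, show i + 1 + (j + 1) = (i + j + 1) + 1 by omega, map_smul, d_y_succ, d_y_succ,
      d_y_succ, smul_mul_assoc, mul_smul_comm, y_mul_y, y_mul_y,
      show i + (j + 1) = i + j + 1 by omega, show i + 1 + j = i + j + 1 by omega]
    have cc : ∀ i j : ℕ, c i j = if Odd i ∧ Odd j then 0 else (i / 2 + j / 2).choose (i / 2) :=
      fun _ _ => rfl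
    rcases Nat.even_or_odd' i with ⟨a, rfl | rfl⟩ <;> rcases Nat.even_or_odd' j with ⟨b, rfl | rfl⟩
    · have h1 : c (2 * a + 1) (2 * b + 1) = 0 := by rw [cc, if_pos (by simp)]
      have h2 : c (2 * a) (2 * b + 1) = c (2 * a + 1) (2 * b) := by
        rw [cc, cc, if_neg (by simp), if_neg (by simp), show (2 * a + 1) / 2 = 2 * a / 2 by omega,
          show (2 * b + 1) / 2 = 2 * b / 2 by omega]
      rw [h1, h2, Odd.neg_one_pow (by simp)]
      simp
    · have h1 : c (2 * a + 1) (2 * b + 1) = 0 := by rw [cc, if_pos (by simp)]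
      have h2 : c (2 * a + 1) (2 * b + 1 + 1) = c (2 * a) (2 * b + 1 + 1) := by
        rw [cc, cc, if_neg (by simp [Nat.odd_iff]; omega), if_neg (by simp),
          show (2 * a + 1) / 2 = 2 * a / 2 by omega]
      rw [h1, h2, if_pos (by rw [Nat.even_iff]; omega), if_pos (by simp)]
      simp [smul_smul, mul_comm]
    · have h1 : c (2 * a + 1) (2 * b + 1) = 0 := by rw [cc, if_pos (by simp)]
      have h2 : c (2 * a + 1 + 1) (2 * b + 1) = c (2 * a + 1 + 1) (2 * b) := by
        rw [cc, cc, if_neg (by simp [Nat.odd_iff]; omega), if_neg (by simp),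
          show (2 * b + 1) / 2 = 2 * b / 2 by omega]
      rw [h1, h2, if_pos (by rw [Nat.even_iff]; omega), if_pos (show Even (2 * b) by simp),
        Even.neg_one_pow (by rw [Nat.even_iff]; omega)]
      simp [smul_smul, mul_comm]
    · have h1 : c (2 * a + 1 + 1) (2 * b + 1 + 1)
          = c (2 * a + 1) (2 * b + 1 + 1) + c (2 * a + 1 + 1) (2 * b + 1) := by
        rw [cc, cc, cc, if_neg (by simp [Nat.odd_iff]; omega), if_neg (by simp [Nat.odd_iff]; omega),
          if_neg (by simp [Nat.odd_iff]; omega), show (2 * a + 1 + 1) / 2 = a + 1 by omega,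
          show (2 * a + 1) / 2 = a by omega, show (2 * b + 1 + 1) / 2 = b + 1 by omega,
          show (2 * b + 1) / 2 = b by omega, ← Nat.add_assoc, Nat.choose_succ_succ,
          show a + 1 + b = a + b + 1 by omega, Nat.add_assoc a b 1]
      rw [h1, if_neg (by rw [Nat.even_iff]; omega), if_neg (by simp), if_neg (by simp),
        Even.neg_one_pow (by rw [Nat.even_iff]; omega)]
      simp [smul_smul, mul_comm, mul_add, add_smul]

/-- `Q⟨y, t ∣ ∂y = f, ∂t = g y⟩` as a dg algebra over `Q`. -/
def dg {f g : Q} (h : f * g = 0) : DGAlgebra Q (TateAlg Q) where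
  deg := deg
  isInternal := isInternal_deg
  one_mem := Submodule.mem_span_singleton_self _
  mul_mem := by
    intro i j a b ha hb
    obtain ⟨p, rfl⟩ := mem_deg.1 ha
    obtain ⟨q, rfl⟩ := mem_deg.1 hb
    rw [smul_mul_assoc, mul_smul_comm, y_mul_y, smul_smul, smul_smul]
    exact mem_deg.2 ⟨_, rfl⟩
  mul_comm := by
    intro i j a b ha hb
    obtain ⟨p, rfl⟩ := mem_deg.1 ha
    obtain ⟨q, rfl⟩ := mem_deg.1 hb
    rcases Nat.even_or_odd (i * j) with hij | hij
    · rw [hij.neg_one_pow, one_mul, mul_comm]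
    · have : c i j = 0 := by rw [Nat.odd_mul] at hij; exact if_pos hij
      have h0 : (y i * y j : TateAlg Q) = 0 := by rw [y_mul_y, this]; simp
      rw [smul_mul_smul_comm, smul_mul_smul_comm, mul_comm (y j), h0]; simp
  mul_self := by
    intro i a hi ha
    obtain ⟨p, rfl⟩ := mem_deg.1 ha
    have : c i i = 0 := if_pos ⟨hi, hi⟩
    rw [smul_mul_smul_comm, y_mul_y, this]; simp
  d := d f g
  d_zero := by
    intro a ha
    obtain ⟨p, rfl⟩ := mem_deg.1 ha
    rw [map_smul, d_y_zero, smul_zero]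
  d_mem := by
    intro n a ha
    obtain ⟨p, rfl⟩ := mem_deg.1 ha
    rw [map_smul, d_y_succ, smul_smul]
    exact mem_deg.2 ⟨_, rfl⟩
  d_d := d_d h
  leibniz := by
    intro i a b ha
    obtain ⟨p, rfl⟩ := mem_deg.1 ha
    induction b using induction with
    | hy j =>
      rw [smul_mul_assoc, map_smul, leibniz_y, map_smul, smul_add, smul_mul_assoc, smul_mul_assoc,
        mul_smul_comm]
    | add b b' h h' => rw [mul_add, map_add, h, h', map_add, mul_add, mul_add, mul_add]; abel
    | smul q b h => rw [mul_smul_comm, map_smul, h, map_smul _ q b]; simp only [mul_smul_comm, smul_add]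

end TateAlg

lemma IsExactPair.mul_eq_zero {Q : Type*} [CommRing Q] {f g : Q} (h : IsExactPair f g) :
    f * g = 0 := by
  rw [mul_comm]
  exact (h.ann_left g).2 (Ideal.mem_span_singleton_self g)

/-- The ring `R = Q ⧸ (f)`. -/
abbrev RingR {Q : Type*} [CommRing Q] (f : Q) : Type _ := Q ⧸ Ideal.span {f}

/-- The ring `S = Q ⧸ (f, g)`. -/
abbrev RingS {Q : Type*} [CommRing Q] (f g : Q) : Type _ := Q ⧸ Ideal.span {f, g}

/-- A dg resolution of `M` over the Tate resolution `A` of `Q ⧸ (f)`: a semi-free dg `A`-module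
`U`, with a chosen homogeneous basis `(e_δ)` over `A`, and an augmentation `ε : U → M` that
makes `⋯ → U₂ → U₁ → U₀ → M → 0` exact. As `A` is free over `Q`, this is a free resolution
of `M` over `Q`. -/
structure DGResolution {Q : Type u} [CommRing Q] {f g : Q} (hfg : IsExactPair f g)
    (M : Type u) [AddCommGroup M] [Module Q M] where
  U : Type u
  [addCommGroup : AddCommGroup U]
  [moduleQ : Module Q U]
  [moduleA : Module (TateAlg Q) U]
  [isScalarTower : IsScalarTower Q (TateAlg Q) U]
  dg : DGModule (TateAlg.dg hfg.mul_eq_zero) U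
  Δ : Type u
  e : Module.Basis Δ (TateAlg Q) U
  deg : Δ → ℕ
  e_mem : ∀ δ, e δ ∈ dg.deg (deg δ)
  ε : U →ₗ[Q] M
  ε_pos : ∀ {n : ℕ} {u : U}, u ∈ dg.deg (n + 1) → ε u = 0
  ε_d : ∀ u : U, ε (dg.d u) = 0
  ε_surjective : Function.Surjective ε
  exact_zero : ∀ {u : U}, u ∈ dg.deg 0 → ε u = 0 → ∃ w ∈ dg.deg 1, dg.d w = u
  exact_succ : ∀ {n : ℕ} {u : U}, u ∈ dg.deg (n + 1) → dg.d u = 0 →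
    ∃ w ∈ dg.deg (n + 2), dg.d w = u

namespace DGResolution

attribute [instance] addCommGroup moduleQ moduleA isScalarTower

variable {Q : Type u} [CommRing Q] {f g : Q} {hfg : IsExactPair f g}
  {M : Type u} [AddCommGroup M] [Module Q M] (D : DGResolution hfg M)

/-- `V_i`, the free `Q`-module on the basis elements `e_δ` of degree `i`. -/
abbrev V (i : ℤ) : Type u := {δ : D.Δ // (D.deg δ : ℤ) = i} →₀ Q

/-- The inclusion `V_i ⊆ U`. -/
def incl (i : ℤ) : D.V i →ₗ[Q] D.U := Finsupp.linearCombination Q fun δ => D.e δ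

/-- The projection `π_i : U → V_i`: the coefficient of `y_0 e_δ` for all `δ` of degree `i`. -/
def proj (i : ℤ) : D.U →ₗ[Q] D.V i :=
  Finsupp.lsubtypeDomain {δ : D.Δ | (D.deg δ : ℤ) = i} ∘ₗ
    Finsupp.mapRange.linearMap (TateAlg.coeff 0) ∘ₗ (D.e.repr.toLinearMap.restrictScalars Q)

/-- The map `∂^V = π ∂ : V_i → V_j` (only used for `i = j + 1`). -/
def dV (i j : ℤ) : D.V i →ₗ[Q] D.V j := D.proj j ∘ₗ D.dg.d ∘ₗ D.incl i

/-- The lifts `τ̃ : V_i → V_{i-2}` with `(∂^V)² = f τ̃`, which give the Eisenbud operator. -/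
structure EisenbudLift where
  τ : ∀ i j : ℤ, D.V i →ₗ[Q] D.V j
  dV_dV : ∀ i j k : ℤ, j + 1 = i → k + 1 = j → D.dV j k ∘ₗ D.dV i j = f • τ i k

variable {D} (T : D.EisenbudLift)

lemma baseChange_R_eq_zero {i j : ℤ} (φ : D.V i →ₗ[Q] D.V j) :
    (f • φ).baseChange (RingR f) = 0 := by
  rw [LinearMap.baseChange_smul]
  refine LinearMap.ext fun x => ?_
  rw [LinearMap.smul_apply, ← algebraMap_smul (RingR f) f, Ideal.Quotient.algebraMap_eq,
    Ideal.Quotient.eq_zero_iff_mem.2 (Ideal.mem_span_singleton_self f), zero_smul]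
  rfl

lemma baseChange_S_eq_zero {i j : ℤ} (φ : D.V i →ₗ[Q] D.V j) {q : Q}
    (hq : q ∈ Ideal.span {f, g}) : (q • φ).baseChange (RingS f g) = 0 := by
  rw [LinearMap.baseChange_smul]
  refine LinearMap.ext fun x => ?_
  rw [LinearMap.smul_apply, ← algebraMap_smul (RingS f g) q, Ideal.Quotient.algebraMap_eq,
    Ideal.Quotient.eq_zero_iff_mem.2 hq, zero_smul]
  rfl

/-- A map killed by `f` has image in `g V`, so it vanishes after base change to `S`. -/
lemma baseChange_S_eq_zero_of_smul {i j : ℤ} (φ : D.V i →ₗ[Q] D.V j) (h : f • φ = 0) :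
    φ.baseChange (RingS f g) = 0 := by
  have key : ∀ w : D.V j, f • w = 0 → (1 : RingS f g) ⊗ₜ[Q] w = 0 := by
    intro w hw
    rw [← Finsupp.sum_single w, Finsupp.sum, TensorProduct.tmul_sum]
    refine Finset.sum_eq_zero fun δ _ => ?_
    have hδ : w δ * f = 0 := by
      rw [mul_comm]; exact DFunLike.congr_fun hw δ
    have hmem := (hfg.ann_left _).1 hδ
    rw [show Finsupp.single δ (w δ) = w δ • Finsupp.single δ (1 : Q) by simp,
      ← TensorProduct.smul_tmul, Algebra.smul_def, Ideal.Quotient.algebraMap_eq,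
      Ideal.Quotient.eq_zero_iff_mem.2 (Ideal.span_mono (by simp) hmem), zero_mul,
      TensorProduct.zero_tmul]
  refine LinearMap.ext fun x => ?_
  induction x with
  | zero => simp
  | add x y hx hy => rw [map_add, hx, hy]; simp
  | tmul s v =>
    have := key (φ v) (by rw [← LinearMap.smul_apply, h]; rfl)
    rw [LinearMap.baseChange_tmul, ← mul_one s, ← smul_eq_mul, ← TensorProduct.smul_tmul', this]
    simp

namespace EisenbudLift

/-- `∂^V ⊗ S`. -/
abbrev dS (_ : D.EisenbudLift) (i j : ℤ) :
    RingS f g ⊗[Q] D.V i →ₗ[RingS f g] RingS f g ⊗[Q] D.V j :=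
  (D.dV i j).baseChange (RingS f g)

/-- The Eisenbud operator `τ = τ̃ ⊗ S : V_i ⊗ S → V_j ⊗ S` (only used for `i = j + 2`). -/
abbrev τS (i j : ℤ) : RingS f g ⊗[Q] D.V i →ₗ[RingS f g] RingS f g ⊗[Q] D.V j :=
  (T.τ i j).baseChange (RingS f g)

lemma dS_dS (i j k : ℤ) (hij : j + 1 = i) (hjk : k + 1 = j) :
    T.dS j k ∘ₗ T.dS i j = 0 := by
  rw [← LinearMap.baseChange_comp, T.dV_dV i j k hij hjk]
  exact baseChange_S_eq_zero _ (Ideal.subset_span (by simp))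

/-- `τ` is a chain map of degree `-2`. -/
lemma dS_τS (i j k l : ℤ) (hij : j + 2 = i) (hjl : l + 1 = j) (hik : k + 1 = i) :
    T.dS j l ∘ₗ T.τS i j = T.τS k l ∘ₗ T.dS i k := by
  rw [← LinearMap.baseChange_comp, ← LinearMap.baseChange_comp, ← sub_eq_zero,
    ← LinearMap.baseChange_sub]
  apply baseChange_S_eq_zero_of_smul (hfg := hfg)
  have h1 := LinearMap.congr_fun (T.dV_dV i k j (by omega) (by omega))
  have h2 := LinearMap.congr_fun (T.dV_dV k j l (by omega) (by omega))
  simp only [LinearMap.comp_apply, LinearMap.smul_apply] at h1 h2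
  refine LinearMap.ext fun v => ?_
  rw [LinearMap.smul_apply, LinearMap.sub_apply, smul_sub, LinearMap.comp_apply,
    LinearMap.comp_apply, ← map_smul, ← h1, ← h2, sub_self]
  rfl

/-- The complex `U' = V ⊗ R` of free `R`-modules. -/
def complexR : ChainComplex (ModuleCat.{u} (RingR f)) ℕ where
  X n := ModuleCat.of (RingR f) (RingR f ⊗[Q] D.V n)
  d i j := ModuleCat.ofHom (if j + 1 = i then (D.dV i j).baseChange (RingR f) else 0)
  shape i j hij := by
    rw [if_neg (by simpa using hij)]; rfl
  d_comp_d' i j k hij hjk := by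
    simp only [ComplexShape.down_Rel] at hij hjk
    rw [if_pos hij, if_pos hjk, ← ModuleCat.ofHom_comp, ← LinearMap.baseChange_comp,
      T.dV_dV i j k (by omega) (by omega), baseChange_R_eq_zero]
    rfl

/-- The complex `V ⊗ S` of free `S`-modules. -/
def complexS : ChainComplex (ModuleCat.{u} (RingS f g)) ℕ where
  X n := ModuleCat.of (RingS f g) (RingS f g ⊗[Q] D.V n)
  d i j := ModuleCat.ofHom (if j + 1 = i then T.dS i j else 0)
  shape i j hij := by
    rw [if_neg (by simpa using hij)]; rfl
  d_comp_d' i j k hij hjk := by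
    simp only [ComplexShape.down_Rel] at hij hjk
    rw [if_pos hij, if_pos hjk, ← ModuleCat.ofHom_comp, T.dS_dS i j k (by omega) (by omega)]
    rfl

/-- The differential `(x, a) ↦ (-∂x - τ a, ∂a)` of the mapping cone, from
`(V_{i-1} ⊗ S) ⊕ (V_i ⊗ S)` to `(V_{j-1} ⊗ S) ⊕ (V_j ⊗ S)` (only used for `i = j + 1`). -/
def dW (i j : ℤ) :
    (RingS f g ⊗[Q] D.V (i - 1)) × (RingS f g ⊗[Q] D.V i) →ₗ[RingS f g]
      (RingS f g ⊗[Q] D.V (j - 1)) × (RingS f g ⊗[Q] D.V j) :=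
  LinearMap.prod
    (-(T.dS (i - 1) (j - 1) ∘ₗ LinearMap.fst _ _ _) - T.τS i (j - 1) ∘ₗ LinearMap.snd _ _ _)
    (T.dS i j ∘ₗ LinearMap.snd _ _ _)

/-- The mapping cone `W` of the Eisenbud operator `τ`. -/
def W : ChainComplex (ModuleCat.{u} (RingS f g)) ℕ where
  X n := ModuleCat.of (RingS f g)
    ((RingS f g ⊗[Q] D.V ((n : ℤ) - 1)) × (RingS f g ⊗[Q] D.V n))
  d i j := ModuleCat.ofHom (if j + 1 = i then T.dW i j else 0)
  shape i j hij := by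
    rw [if_neg (by simpa using hij)]; rfl
  d_comp_d' i j k hij hjk := by
    simp only [ComplexShape.down_Rel] at hij hjk
    rw [if_pos hij, if_pos hjk, ← ModuleCat.ofHom_comp]
    have h : T.dW j k ∘ₗ T.dW i j = 0 := by
      have h1 := LinearMap.congr_fun (T.dS_dS (i - 1) (j - 1) (k - 1) (by omega) (by omega))
      have h2 := LinearMap.congr_fun (T.dS_dS i j k (by omega) (by omega))
      have h3 := LinearMap.congr_fun
        (T.dS_τS i (j - 1) j (k - 1) (by omega) (by omega) (by omega))
      simp only [LinearMap.comp_apply, LinearMap.zero_apply] at h1 h2 h3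
      refine LinearMap.ext fun ⟨x, a⟩ => Prod.ext ?_ ?_
      · simp [dW, h1, h3]
      · simp [dW, h2]
    rw [h]
    rfl

end EisenbudLift

namespace EisenbudLift

/-- `ε` factors through the projection onto `V_0`. -/
lemma ε_eq (D : DGResolution hfg M) (u : D.U) : D.ε (D.incl 0 (D.proj 0 u)) = D.ε u := by
  have key : ∀ (a : TateAlg Q) (δ : D.Δ),
      D.ε (D.incl 0 (D.proj 0 (a • D.e δ))) = D.ε (a • D.e δ) := by
    intro a δ
    induction a using TateAlg.induction with
    | hy i =>
      have hy : D.proj 0 ((TateAlg.y i : TateAlg Q) • D.e δ) = Finsupp.subtypeDomain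
          (fun δ : D.Δ => (D.deg δ : ℤ) = 0) (Finsupp.single δ (TateAlg.coeff 0 (TateAlg.y i : TateAlg Q))) := by
        simp only [proj, LinearMap.comp_apply, LinearMap.restrictScalars_apply,
          LinearEquiv.coe_coe, map_smul, Module.Basis.repr_self, Finsupp.smul_single, smul_eq_mul,
          mul_one, Finsupp.mapRange.linearMap_apply, Finsupp.mapRange_single]
        rfl
      have hmem : (TateAlg.y i : TateAlg Q) • D.e δ ∈ D.dg.deg (i + D.deg δ) :=
        D.dg.smul_mem (Submodule.mem_span_singleton_self _) (D.e_mem δ)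
      by_cases h0 : i = 0 ∧ D.deg δ = 0
      · obtain ⟨rfl, hδ⟩ := h0
        have : Finsupp.subtypeDomain (fun δ : D.Δ => (D.deg δ : ℤ) = 0)
            (Finsupp.single δ (1 : Q)) = Finsupp.single ⟨δ, by simp [hδ]⟩ 1 := by
          classical
          ext ⟨δ', h'⟩
          simp [Finsupp.single_apply]
        rw [hy, TateAlg.coeff_y, if_pos rfl, this, incl, Finsupp.linearCombination_single,
          one_smul, ← TateAlg.one_def, one_smul]
      · have hz : Finsupp.subtypeDomain (fun δ : D.Δ => (D.deg δ : ℤ) = 0)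
            (Finsupp.single δ (TateAlg.coeff 0 (TateAlg.y i : TateAlg Q))) = 0 := by
          classical
          ext ⟨δ', h'⟩
          rw [TateAlg.coeff_y]
          by_cases hi : i = 0
          · have : δ ≠ δ' := by
              rintro rfl; exact h0 ⟨hi, by exact_mod_cast h'⟩
            simp [this]
          · simp [hi]
        obtain ⟨n, hn⟩ : ∃ n, i + D.deg δ = n + 1 := ⟨i + D.deg δ - 1, by omega⟩
        rw [hy, hz, map_zero, map_zero, D.ε_pos (hn ▸ hmem)]
    | add a b ha hb => rw [add_smul, map_add, map_add, map_add, ha, hb, map_add]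
    | smul q a ha => rw [smul_assoc, (D.proj 0).map_smul, (D.incl 0).map_smul, D.ε.map_smul, ha, D.ε.map_smul]
  rw [← D.e.linearCombination_repr u]
  induction D.e.repr u using Finsupp.induction_linear with
  | zero => simp
  | add x x' h h' => rw [map_add, map_add, map_add, map_add, h, h', map_add]
  | single δ a => rw [Finsupp.linearCombination_single]; exact key a δ

variable [Module (RingR f) M] [IsScalarTower Q (RingR f) M]

/-- The augmentation `U'_0 = V_0 ⊗ R → M` induced by `ε`. -/
def augR₀ (_ : D.EisenbudLift) : RingR f ⊗[Q] D.V 0 →ₗ[RingR f] M :=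
  (D.ε ∘ₗ D.incl 0).liftBaseChange (RingR f)

lemma augR₀_comp : T.augR₀ ∘ₗ (D.dV 1 0).baseChange (RingR f) = 0 := by
  refine LinearMap.ext fun x => ?_
  induction x with
  | zero => simp
  | add x y hx hy => rw [map_add, hx, hy]; simp
  | tmul r v =>
    rw [LinearMap.comp_apply, LinearMap.baseChange_tmul, augR₀, LinearMap.liftBaseChange_tmul,
      LinearMap.comp_apply, dV, LinearMap.comp_apply, LinearMap.comp_apply, ε_eq, D.ε_d, smul_zero]
    rfl

/-- The augmentation `U' → M`, as a chain map. -/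
def augR : T.complexR ⟶ (ChainComplex.single₀ (ModuleCat.{u} (RingR f))).obj
    (ModuleCat.of (RingR f) M) :=
  (ChainComplex.toSingle₀Equiv _ _).symm ⟨ModuleCat.ofHom T.augR₀, by
    have : T.complexR.d 1 0 = ModuleCat.ofHom ((D.dV 1 0).baseChange (RingR f)) :=
      congrArg ModuleCat.ofHom (if_pos (by norm_num))
    rw [this]
    exact congrArg ModuleCat.ofHom T.augR₀_comp⟩

/-- `U'` as a projective resolution of `M` over `R`, once its augmentation is known to be a
quasi-isomorphism. -/
def resolutionR (hq : QuasiIso T.augR) : ProjectiveResolution (ModuleCat.of (RingR f) M) where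
  complex := T.complexR
  projective n := by
    have : Module.Free (RingR f) (RingR f ⊗[Q] D.V n) := inferInstance
    exact (IsProjective.iff_projective (R := RingR f) (RingR f ⊗[Q] D.V n)).1 inferInstance
  π := T.augR

end EisenbudLift

end DGResolution

/-! ### Tensor products with `N`, and Tor -/

/-- The functor `- ⊗_A N`. -/
abbrev tensorWith (A : Type u) [CommRing A] (N : Type u) [AddCommGroup N] [Module A N] :
    ModuleCat.{u} A ⥤ ModuleCat.{u} A :=
  (tensoringRight (ModuleCat.{u} A)).obj (ModuleCat.of A N)

/-- The complex `C ⊗_A N`. -/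
abbrev tensorComplex {A : Type u} [CommRing A] (C : ChainComplex (ModuleCat.{u} A) ℕ)
    (N : Type u) [AddCommGroup N] [Module A N] : ChainComplex (ModuleCat.{u} A) ℕ :=
  ((tensorWith A N).mapHomologicalComplex (ComplexShape.down ℕ)).obj C

/-- `Tor_n^A(M, N)`, derived in the first variable. -/
abbrev tor (A : Type u) [CommRing A] (M N : Type u) [AddCommGroup M] [Module A M]
    [AddCommGroup N] [Module A N] (n : ℕ) : ModuleCat.{u} A :=
  ((Tor' (ModuleCat.{u} A) n).obj (ModuleCat.of A M)).obj (ModuleCat.of A N)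

/-- Restriction of scalars from a `Q`-algebra to `Q`. -/
abbrev res (Q A : Type u) [CommRing Q] [CommRing A] [Algebra Q A] :
    ModuleCat.{u} A ⥤ ModuleCat.{u} Q :=
  ModuleCat.restrictScalars (algebraMap Q A)

/-- The identification `Tor_n^A(M, N) = H_n(P ⊗_A N)` for a projective resolution `P` of `M`. -/
def torIso {A : Type u} [CommRing A] {M : Type u} [AddCommGroup M] [Module A M]
    (P : ProjectiveResolution (ModuleCat.of A M)) (N : Type u) [AddCommGroup N] [Module A N]
    (n : ℕ) : tor A M N n ≅ (tensorComplex P.complex N).homology n :=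
  P.isoLeftDerivedObj (tensorWith A N) n

/-- Restriction of scalars commutes with homology. -/
def resHomologyIso (Q : Type u) {A : Type u} [CommRing Q] [CommRing A] [Algebra Q A]
    (C : ChainComplex (ModuleCat.{u} A) ℕ) (n : ℕ) :
    (((res Q A).mapHomologicalComplex (ComplexShape.down ℕ)).obj C).homology n ≅
      (res Q A).obj (C.homology n) :=
  (C.sc n).mapHomologyIso (res Q A)

section ChangeOfRings

variable {Q A : Type u} [CommRing Q] [CommRing A] [Algebra Q A]

/-- For a `Q`-linear map `h` from a `Q`-module `X` to an `A`-module `Y`, the map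
`X ⊗_Q N → Y ⊗_A N`, `x ⊗ n ↦ h x ⊗ n`. -/
def tensorHom {X : ModuleCat.{u} Q} {Y : ModuleCat.{u} A} (h : X ⟶ (res Q A).obj Y)
    (N : Type u) [AddCommGroup N] [Module Q N] [Module A N] [IsScalarTower Q A N] :
    (tensorWith Q N).obj X ⟶ (res Q A).obj ((tensorWith A N).obj Y) :=
  ModuleCat.ofHom (X := (X ⊗[Q] N : Type u))
    (Y := (res Q A).obj (ModuleCat.of A (Y ⊗[A] N)))
    (TensorProduct.lift (LinearMap.mk₂ Q
      (fun x n => (show Y from h.hom x) ⊗ₜ[A] n)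
      (fun x x' n => by rw [map_add]; exact TensorProduct.add_tmul _ _ _)
      (fun q x n => by rw [map_smul]; rfl)
      (fun x n n' => TensorProduct.tmul_add _ _ _)
      (fun q x n => by rw [← algebraMap_smul A q n]; exact TensorProduct.tmul_smul _ _ _)))

/-- The chain map `P ⊗_Q N → P' ⊗_A N`, `x ⊗ n ↦ h x ⊗ n`, induced by a `Q`-linear chain map
`h : P → P'`. -/
def tensorChainMap {P : ChainComplex (ModuleCat.{u} Q) ℕ} {P' : ChainComplex (ModuleCat.{u} A) ℕ}
    (h : P ⟶ ((res Q A).mapHomologicalComplex (ComplexShape.down ℕ)).obj P')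
    (N : Type u) [AddCommGroup N] [Module Q N] [Module A N] [IsScalarTower Q A N] :
    tensorComplex P N ⟶
      ((res Q A).mapHomologicalComplex (ComplexShape.down ℕ)).obj (tensorComplex P' N) where
  f n := tensorHom (h.f n) N
  comm' i j _ := by
    refine ModuleCat.hom_ext (TensorProduct.ext' fun x n => ?_)
    have := congrArg (fun φ => ModuleCat.Hom.hom φ x) (h.comm i j)
    exact congrArg (fun z : P'.X j => z ⊗ₜ[A] n) this

/-- `θ : Tor_n^Q(M, N) → Tor_n^A(M, N)` is the natural map induced by `Q → A`: for all projective
resolutions `P → M` over `Q` and `P' → M` over `A`, and every `Q`-linear chain map `h : P → P'`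
lifting `id_M`, it is the map induced on homology by `P ⊗_Q N → P' ⊗_A N`,
`x ⊗ n ↦ h x ⊗ n`. -/
def IsChangeOfRings (M N : Type u) [AddCommGroup M] [Module Q M] [Module A M]
    [IsScalarTower Q A M] [AddCommGroup N] [Module Q N] [Module A N] [IsScalarTower Q A N]
    (n : ℕ) (θ : tor Q M N n ⟶ (res Q A).obj (tor A M N n)) : Prop :=
  ∀ (P : ProjectiveResolution (ModuleCat.of Q M)) (P' : ProjectiveResolution (ModuleCat.of A M))
    (h : P.complex ⟶ ((res Q A).mapHomologicalComplex (ComplexShape.down ℕ)).obj P'.complex),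
    (∀ x : P.complex.X 0, ((P'.π.f 0).hom (show P'.complex.X 0 from (h.f 0).hom x) : M) =
      ((P.π.f 0).hom x : M)) →
    θ = (torIso P N n).hom ≫ HomologicalComplex.homologyMap (tensorChainMap h N) n ≫
      (resHomologyIso Q (tensorComplex P'.complex N) n).hom ≫ (res Q A).map (torIso P' N n).inv

end ChangeOfRings

namespace DGResolution.EisenbudLift

variable {Q : Type u} [CommRing Q] {f g : Q} {hfg : IsExactPair f g}
  {M : Type u} [AddCommGroup M] [Module Q M] {D : DGResolution hfg M} (T : D.EisenbudLift)

/-- `τ : V_i ⊗ S → V_j ⊗ S` as a morphism, set to be zero unless `i = j + 2`. -/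
def τHom (i j : ℕ) : T.complexS.X i ⟶ T.complexS.X j :=
  ModuleCat.ofHom (if j + 2 = i then T.τS i j else 0)

lemma τHom_eq_zero (i j : ℕ) (h : j + 2 ≠ i) : T.τHom i j = 0 := by
  rw [τHom, if_neg h]
  rfl

lemma τHom_d (i j k l : ℕ) (hij : j + 2 = i) (hjl : l + 1 = j) (hik : k + 1 = i) :
    T.τHom i j ≫ T.complexS.d j l = T.complexS.d i k ≫ T.τHom k l := by
  have h1 : T.complexS.d j l = ModuleCat.ofHom (T.dS j l) := congrArg _ (if_pos hjl)
  have h2 : T.complexS.d i k = ModuleCat.ofHom (T.dS i k) := congrArg _ (if_pos hik)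
  rw [τHom, τHom, if_pos hij, if_pos (by omega), h1, h2]
  exact congrArg ModuleCat.ofHom (T.dS_τS i j k l (by omega) (by omega) (by omega))

variable [Module (RingR f) M] [IsScalarTower Q (RingR f) M]
  (N : Type u) [AddCommGroup N] [Module Q N] [Module (RingR f) N] [IsScalarTower Q (RingR f) N]
  [Module (RingS f g) N] [IsScalarTower Q (RingS f g) N]

/-- The canonical `Q`-linear isomorphism `(V ⊗_Q A) ⊗_A N ≅ V ⊗_Q N`. -/
def cancelIso (A : Type u) [CommRing A] [Algebra Q A] (V N : Type u) [AddCommGroup V] [Module Q V]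
    [AddCommGroup N] [Module Q N] [Module A N] [IsScalarTower Q A N] :
    (res Q A).obj ((tensorWith A N).obj (ModuleCat.of A (A ⊗[Q] V))) ≅
      ModuleCat.of Q (N ⊗[Q] V) :=
  let e : (A ⊗[Q] V) ⊗[A] N ≃ₗ[A] N ⊗[Q] V :=
    (TensorProduct.comm A (A ⊗[Q] V) N).trans
      (TensorProduct.AlgebraTensorModule.cancelBaseChange Q A A N V)
  have he (q : Q) (x : (A ⊗[Q] V) ⊗[A] N) : e (algebraMap Q A q • x) = q • e x :=
    (e.map_smul _ _).trans (algebraMap_smul A q (e x))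
  { hom := ModuleCat.ofHom (X := (res Q A).obj (ModuleCat.of A ((A ⊗[Q] V) ⊗[A] N)))
      (Y := N ⊗[Q] V) { e.toAddEquiv with map_smul' := he }
    inv := ModuleCat.ofHom (Y := (res Q A).obj (ModuleCat.of A ((A ⊗[Q] V) ⊗[A] N)))
      (X := N ⊗[Q] V) { e.symm.toAddEquiv with
        map_smul' := fun q x => e.injective <| by
          refine Eq.trans ?_ (he q (e.symm x)).symm
          exact (e.apply_symm_apply _).trans (congrArg (q • ·) (e.apply_symm_apply x).symm) }
    hom_inv_id := ModuleCat.hom_ext (LinearMap.ext fun x => e.symm_apply_apply x)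
    inv_hom_id := ModuleCat.hom_ext (LinearMap.ext fun x => e.apply_symm_apply x) }

/-- `cancelIso` is natural in `V`. -/
lemma cancelIso_naturality (A : Type u) [CommRing A] [Algebra Q A] {V V' : Type u}
    [AddCommGroup V] [Module Q V] [AddCommGroup V'] [Module Q V'] (φ : V →ₗ[Q] V') (N : Type u)
    [AddCommGroup N] [Module Q N] [Module A N] [IsScalarTower Q A N] :
    (res Q A).map ((tensorWith A N).map (ModuleCat.ofHom (φ.baseChange A))) ≫
      (cancelIso A V' N).hom = (cancelIso A V N).hom ≫ ModuleCat.ofHom (φ.lTensor N) := by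
  refine ModuleCat.hom_ext (LinearMap.ext fun (x : (A ⊗[Q] V) ⊗[A] N) => ?_)
  induction x with
  | zero => exact (map_zero _).trans (map_zero _).symm
  | add x y hx hy => exact (map_add _ x y).trans ((congrArg₂ (· + ·) hx hy).trans (map_add _ x y).symm)
  | tmul z n =>
    induction z with
    | zero => rw [TensorProduct.zero_tmul]; exact (map_zero _).trans (map_zero _).symm
    | add x y hx hy =>
      rw [TensorProduct.add_tmul]
      exact (map_add _ _ _).trans ((congrArg₂ (· + ·) hx hy).trans (map_add _ _ _).symm)
    | tmul a v => rfl

lemma comm_aux {C : Type*} [Category* C] {X X' Y Y' Z Z' : C} {a : X ⟶ X'} {b : Y ⟶ Y'}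
    {m : Z ⟶ Z'} {c : X ≅ Z} {c' : X' ≅ Z'} {e : Y ≅ Z} {e' : Y' ≅ Z'}
    (h : a ≫ c'.hom = c.hom ≫ m) (h' : b ≫ e'.hom = e.hom ≫ m) :
    (c ≪≫ e.symm).hom ≫ b = a ≫ (c' ≪≫ e'.symm).hom := by
  rw [← cancel_mono e'.hom]
  simp [h, h']

/-- The isomorphism of complexes `U' ⊗_R N ≅ (V ⊗_Q S) ⊗_S N`. -/
def complexIso :
    ((res Q (RingR f)).mapHomologicalComplex (ComplexShape.down ℕ)).obj
        (tensorComplex T.complexR N) ≅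
      ((res Q (RingS f g)).mapHomologicalComplex (ComplexShape.down ℕ)).obj
        (tensorComplex T.complexS N) :=
  HomologicalComplex.Hom.isoOfComponents
    (fun n => cancelIso (RingR f) (D.V n) N ≪≫ (cancelIso (RingS f g) (D.V n) N).symm)
    (fun i j hij => by
      have hij' : j + 1 = i := hij
      have hR : T.complexR.d i j = ModuleCat.ofHom ((D.dV i j).baseChange (RingR f)) :=
        congrArg ModuleCat.ofHom (if_pos hij')
      have hS : T.complexS.d i j = ModuleCat.ofHom ((D.dV i j).baseChange (RingS f g)) :=
        congrArg ModuleCat.ofHom (if_pos hij')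
      have nR := cancelIso_naturality (RingR f) (D.dV i j) N
      have nS := cancelIso_naturality (RingS f g) (D.dV i j) N
      rw [← hR] at nR
      rw [← hS] at nS
      exact comm_aux nR nS)

/-- The morphism of short complexes given by `τ ⊗_S N`, from the three terms of
`(V ⊗_Q S) ⊗_S N` around degree `n + 2` to those around degree `n`. -/
def tauShortComplex (n : ℕ) :
    (tensorComplex T.complexS N).sc (n + 2) ⟶ (tensorComplex T.complexS N).sc n where
  τ₁ := (tensorWith (RingS f g) N).map (T.τHom _ _)
  τ₂ := (tensorWith (RingS f g) N).map (T.τHom _ _)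
  τ₃ := (tensorWith (RingS f g) N).map (T.τHom _ _)
  comm₁₂ := by
    change (tensorWith (RingS f g) N).map _ ≫ (tensorWith (RingS f g) N).map (T.complexS.d _ _) =
      (tensorWith (RingS f g) N).map (T.complexS.d _ _) ≫ (tensorWith (RingS f g) N).map _
    rw [← Functor.map_comp, ← Functor.map_comp, T.τHom_d]
    all_goals simp
  comm₂₃ := by
    change (tensorWith (RingS f g) N).map _ ≫ (tensorWith (RingS f g) N).map (T.complexS.d _ _) =
      (tensorWith (RingS f g) N).map (T.complexS.d _ _) ≫ (tensorWith (RingS f g) N).map _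
    rw [← Functor.map_comp, ← Functor.map_comp]
    congr 1
    rcases n with _ | n
    · rw [T.complexS.shape _ _ (by simp), T.τHom_eq_zero ((ComplexShape.down ℕ).next (0 + 2)) _
        (by simp)]
      exact Limits.comp_zero.trans Limits.comp_zero.symm
    · apply T.τHom_d
      all_goals simp

/-- The map `H_{n+2}((V ⊗_Q S) ⊗_S N) → H_n((V ⊗_Q S) ⊗_S N)` induced by `τ`. -/
def tauHomology (n : ℕ) :
    (tensorComplex T.complexS N).homology (n + 2) ⟶ (tensorComplex T.complexS N).homology n :=
  ShortComplex.homologyMap (T.tauShortComplex N n)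

/-- The identification `Tor_n^R(M, N) = H_n(U' ⊗_R N) = H_n((V ⊗_Q S) ⊗_S N)`. -/
def torRIso (hq : QuasiIso T.augR) (n : ℕ) :
    (res Q (RingR f)).obj (tor (RingR f) M N n) ≅
      (res Q (RingS f g)).obj ((tensorComplex T.complexS N).homology n) :=
  (res Q (RingR f)).mapIso (torIso (T.resolutionR hq) N n) ≪≫
    (resHomologyIso Q (tensorComplex T.complexR N) n).symm ≪≫
    HomologicalComplex.homologyMapIso (T.complexIso N) n ≪≫
    resHomologyIso Q (tensorComplex T.complexS N) n

/-- The map `δ_{n+2} : Tor_{n+2}^R(M, N) → Tor_n^R(M, N)` induced by the Eisenbud operator `τ`. -/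
def δ (hq : QuasiIso T.augR) (n : ℕ) :
    (res Q (RingR f)).obj (tor (RingR f) M N (n + 2)) ⟶
      (res Q (RingR f)).obj (tor (RingR f) M N n) :=
  (T.torRIso N hq (n + 2)).hom ≫ (res Q (RingS f g)).map (T.tauHomology N n) ≫
    (T.torRIso N hq n).inv

end DGResolution.EisenbudLift

lemma isTorsionBySet {Q : Type u} [CommRing Q] (f g : Q) (N : Type u) [AddCommGroup N] [Module Q N]
    [Module (RingR f) N] [IsScalarTower Q (RingR f) N] (hN : ∀ x : N, g • x = 0) :
    Module.IsTorsionBySet Q N (Ideal.span {f, g}) := by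
  refine (Module.isTorsionBySet_iff_is_torsion_by_span _).1 ?_
  rintro x ⟨a, rfl | rfl⟩
  · change a • x = 0
    rw [← algebraMap_smul (RingR a) a x, Ideal.Quotient.algebraMap_eq,
      Ideal.Quotient.eq_zero_iff_mem.2 (Ideal.mem_span_singleton_self a), zero_smul]
  · exact hN x

/-- The `S`-module structure of an `R`-module `N` with `g N = 0`. -/
abbrev moduleS {Q : Type u} [CommRing Q] (f g : Q) (N : Type u) [AddCommGroup N] [Module Q N]
    [Module (RingR f) N] [IsScalarTower Q (RingR f) N] (hN : ∀ x : N, g • x = 0) :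
    Module (RingS f g) N :=
  (isTorsionBySet f g N hN).module

end ExactZeroDivisor

end

open CategoryTheory ExactZeroDivisor

/-! Residue characteristic zero makes every positive integer a unit of $Q$. Hence multiplication by
$t = y_2$ on $A$ is split injective with complement $Qy_0 \oplus Qy_1$, and $U = V \oplus yV \oplus
tU$ (`decomposition`). Everything is read off from the differential in this decomposition.

For $v \in V$, write $\partial v = \partial^V v - y\,\tau v$ modulo $t$. The coefficient of $y_0$ in
$\partial\partial v = 0$ gives $(\partial^V)^2 = f\tau$, so a lift of the Eisenbud operator exists.
Two lifts differ by a map killed by $f$, whose image lies in $gV$, so they agree over $S$ (`τS_eq`),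
and an arbitrary lift may be replaced by this one.

The kernel of $U \to V \otimes R$ is $fV$ together with all $y_iV$, $i > 0$. It is acyclic: since
$(f, g)$ is an exact pair, the lowest coefficient of a cycle can be removed by subtracting a
boundary (`exists_d_eq_of_coord_zero`). Hence $V \otimes R$ inherits from $U$ the property of being
a resolution of $M$.

Since $\partial(tu) = g\,yu + t\,\partial u$, multiplication by $t$ becomes a chain map after
tensoring with $N$, because $gN = 0$. Modulo $t$ one has $\partial(yx + a) = fx - y\,\partial^V x +
\partial^V a - y\,\tau a$, and $f$ kills $N$, so the cokernel of $t$ on $U \otimes N$ is exactly $W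
\otimes N$. The degreewise split sequences $0 \to (U \otimes N)[2] \to U \otimes N \to W \otimes N
\to 0$ and $0 \to (V \otimes N)[1] \to W \otimes N \to V \otimes N \to 0$ (`splittingU`,
`splittingW`) produce the two long exact sequences; the connecting map of the second is $\tau$
(`θH_extensionW`). The composite $U \to W \to V \otimes S$ takes the coefficient of $y_0$, as does
$U \to V \otimes R$, a lift of the identity of $M$; this identifies $\psi_n\phi_n$.

Existence of $U$ is obtained by adjoining, in one inductive type, a basis element for every element
of $M$ and every formal combination of earlier generators (`KillingTree`). -/

open CategoryTheory MonoidalCategory TensorProduct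

noncomputable section

namespace ExactZeroDivisor

/-! ### Homology of complexes of modules through explicit cycles -/

section HomologyClasses

variable {A : Type u} [CommRing A]

/-- The homology class of a cycle, as a linear map. -/
def shortComplexClass (S : ShortComplex (ModuleCat.{u} A)) :
    LinearMap.ker S.g.hom →ₗ[A] S.homology :=
  (S.moduleCatCyclesIso.inv ≫ S.homologyπ).hom

lemma shortComplexClass_surjective (S : ShortComplex (ModuleCat.{u} A)) :
    Function.Surjective (shortComplexClass S) :=
  (ModuleCat.epi_iff_surjective (S.moduleCatCyclesIso.inv ≫ S.homologyπ)).1 inferInstance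

/-- The abstract homology is compared with the concrete quotient of the kernel by the range, where
vanishing means being a boundary. -/
lemma shortComplexClass_eq_zero_iff (S : ShortComplex (ModuleCat.{u} A))
    (z : LinearMap.ker S.g.hom) :
    shortComplexClass S z = 0 ↔ ∃ w : S.X₁, S.f.hom w = z := by
  have h : shortComplexClass S z = S.moduleCatHomologyIso.inv.hom
      ((LinearMap.range S.moduleCatToCycles).mkQ z) := by
    have := S.moduleCatCyclesIso_inv_π
    exact congrArg (fun φ => ModuleCat.Hom.hom φ z) this
  have hinj : Function.Injective S.moduleCatHomologyIso.inv.hom :=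
    (ModuleCat.mono_iff_injective S.moduleCatHomologyIso.inv).1 inferInstance
  rw [h]
  refine (map_eq_zero_iff _ hinj).trans
    ((Submodule.Quotient.mk_eq_zero (LinearMap.range S.moduleCatToCycles)).trans ?_)
  constructor
  · rintro ⟨w, hw⟩
    exact ⟨w, congrArg Subtype.val hw⟩
  · rintro ⟨w, hw⟩
    exact ⟨w, Subtype.ext hw⟩

lemma homologyMap_shortComplexClass {S S' : ShortComplex (ModuleCat.{u} A)} (φ : S ⟶ S')
    (z : LinearMap.ker S.g.hom) (h : φ.τ₂.hom z ∈ LinearMap.ker S'.g.hom) :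
    (ShortComplex.homologyMap φ).hom (shortComplexClass S z) =
      shortComplexClass S' ⟨φ.τ₂.hom z, h⟩ := by
  have h1 : (ShortComplex.homologyMap φ).hom (shortComplexClass S z) =
      S'.homologyπ.hom ((ShortComplex.cyclesMap φ).hom (S.moduleCatCyclesIso.inv.hom z)) := by
    have := ShortComplex.homologyπ_naturality φ
    exact congrArg (fun ψ => ModuleCat.Hom.hom ψ (S.moduleCatCyclesIso.inv.hom z)) this
  rw [h1]
  have h2 : (ShortComplex.cyclesMap φ).hom (S.moduleCatCyclesIso.inv.hom z) =
      S'.moduleCatCyclesIso.inv.hom ⟨φ.τ₂.hom z, h⟩ := by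
    have hinj : Function.Injective S'.iCycles.hom :=
      (ModuleCat.mono_iff_injective S'.iCycles).1 inferInstance
    apply hinj
    have a := congrArg (fun ψ => ModuleCat.Hom.hom ψ (S.moduleCatCyclesIso.inv.hom z))
      (ShortComplex.cyclesMap_i φ)
    have b := congrArg (fun ψ => ModuleCat.Hom.hom ψ z) S.moduleCatCyclesIso_inv_iCycles
    have c := congrArg (fun ψ => ModuleCat.Hom.hom ψ
      (⟨φ.τ₂.hom z, h⟩ : LinearMap.ker S'.g.hom)) S'.moduleCatCyclesIso_inv_iCycles
    refine a.trans (Eq.trans ?_ c.symm)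
    exact congrArg φ.τ₂.hom b
  rw [h2]
  rfl

/-- The cycles of degree `n` in a chain complex of modules. -/
def cycles (C : ChainComplex (ModuleCat.{u} A) ℕ) (n : ℕ) : Submodule A (C.X n) :=
  LinearMap.ker (C.sc n).g.hom

lemma mem_cycles {C : ChainComplex (ModuleCat.{u} A) ℕ} {n : ℕ} {z : C.X n} :
    z ∈ cycles C n ↔ ∀ j, (C.d n j).hom z = 0 := by
  constructor
  · intro h j
    by_cases hj : (ComplexShape.down ℕ).Rel n j
    · obtain rfl := (ComplexShape.down ℕ).next_eq' hj
      exact h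
    · rw [C.shape _ _ hj]; rfl
  · intro h
    exact h _

lemma mem_cycles_zero {C : ChainComplex (ModuleCat.{u} A) ℕ} (z : C.X 0) : z ∈ cycles C 0 :=
  mem_cycles.2 fun j => by rw [C.shape _ _ (by simp)]; rfl

lemma mem_cycles_of {C : ChainComplex (ModuleCat.{u} A) ℕ} {m n : ℕ} (hmn : n + 1 = m)
    {z : C.X m} (h : (C.d m n).hom z = 0) : z ∈ cycles C m :=
  mem_cycles.2 fun j => by
    by_cases hj : j + 1 = m
    · obtain rfl : j = n := by omega
      exact h
    · rw [C.shape _ _ hj]; rfl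

lemma d_mem_cycles (C : ChainComplex (ModuleCat.{u} A) ℕ) (m n : ℕ) (w : C.X m) :
    (C.d m n).hom w ∈ cycles C n :=
  mem_cycles.2 fun j => congrArg (fun φ => ModuleCat.Hom.hom φ w) (C.d_comp_d m n j)

/-- The homology class of a cycle in a chain complex of modules. -/
def homologyClass (C : ChainComplex (ModuleCat.{u} A) ℕ) (n : ℕ) :
    cycles C n →ₗ[A] C.homology n :=
  shortComplexClass (C.sc n)

lemma homologyClass_surjective (C : ChainComplex (ModuleCat.{u} A) ℕ) (n : ℕ) :
    Function.Surjective (homologyClass C n) :=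
  shortComplexClass_surjective _

lemma homologyClass_eq_zero_iff (C : ChainComplex (ModuleCat.{u} A) ℕ) {m n : ℕ}
    (hmn : n + 1 = m) (z : cycles C n) :
    homologyClass C n z = 0 ↔ ∃ w : C.X m, (C.d m n).hom w = z := by
  obtain rfl := (ComplexShape.down ℕ).prev_eq' (show (ComplexShape.down ℕ).Rel m n from hmn)
  exact shortComplexClass_eq_zero_iff (C.sc n) z

lemma homologyClass_eq_iff (C : ChainComplex (ModuleCat.{u} A) ℕ) {m n : ℕ}
    (hmn : n + 1 = m) (z z' : cycles C n) :
    homologyClass C n z = homologyClass C n z' ↔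
      ∃ w : C.X m, (C.d m n).hom w = (z : C.X n) - z' := by
  rw [← sub_eq_zero, ← map_sub, homologyClass_eq_zero_iff C hmn]
  rfl

lemma map_mem_cycles {C C' : ChainComplex (ModuleCat.{u} A) ℕ} (φ : C ⟶ C') (n : ℕ)
    {z : C.X n} (hz : z ∈ cycles C n) : (φ.f n).hom z ∈ cycles C' n :=
  mem_cycles.2 fun j => by
    have h := congrArg (fun ψ => ModuleCat.Hom.hom ψ z) (φ.comm n j)
    refine (show _ = _ from h).trans ?_
    exact (congrArg (φ.f j).hom (mem_cycles.1 hz j)).trans (map_zero _)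

lemma homologyMap_homologyClass {C C' : ChainComplex (ModuleCat.{u} A) ℕ} (φ : C ⟶ C') (n : ℕ)
    (z : cycles C n) :
    (HomologicalComplex.homologyMap φ n).hom (homologyClass C n z) =
      homologyClass C' n ⟨(φ.f n).hom z, map_mem_cycles φ n z.2⟩ :=
  homologyMap_shortComplexClass ((HomologicalComplex.shortComplexFunctor _ _ n).map φ) z _

/-! ### Maps on homology that shift the degree -/

section InducedMap

variable {C C' : ChainComplex (ModuleCat.{u} A) ℕ} {m n : ℕ} (φ : C.X m →ₗ[A] C'.X n)
  (hc : ∀ z ∈ cycles C m, φ z ∈ cycles C' n)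
  (hb : ∀ w : C.X (m + 1), ∃ w' : C'.X (n + 1),
    (C'.d (n + 1) n).hom w' = φ ((C.d (m + 1) m).hom w))

/-- Boundaries go to boundaries, so the map descends to classes. The degrees `m` and `n` are
independent because the maps used below shift degree and are not chain maps. -/
lemma ker_homologyClass_le (hb : ∀ w : C.X (m + 1), ∃ w' : C'.X (n + 1),
      (C'.d (n + 1) n).hom w' = φ ((C.d (m + 1) m).hom w)) :
    LinearMap.ker (homologyClass C m) ≤ LinearMap.ker (homologyClass C' n ∘ₗ φ.restrict hc) := by
  intro z hz
  obtain ⟨w, hw⟩ := (homologyClass_eq_zero_iff C rfl z).1 hz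
  obtain ⟨w', hw'⟩ := hb w
  refine (homologyClass_eq_zero_iff C' rfl _).2 ⟨w', hw'.trans ?_⟩
  rw [hw]
  rfl

/-- The map induced on homology by a linear map that preserves cycles and boundaries. -/
def inducedMap : C.homology m ⟶ C'.homology n :=
  ModuleCat.ofHom <|
    (LinearMap.ker (homologyClass C m)).liftQ (homologyClass C' n ∘ₗ φ.restrict hc)
      (ker_homologyClass_le φ hc hb) ∘ₗ
    ((homologyClass C m).quotKerEquivOfSurjective (homologyClass_surjective C m)).symm.toLinearMap

lemma inducedMap_homologyClass (z : cycles C m) :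
    (inducedMap φ hc hb).hom (homologyClass C m z) = homologyClass C' n ⟨φ z, hc z z.2⟩ := by
  have h : ((homologyClass C m).quotKerEquivOfSurjective
      (homologyClass_surjective C m)).symm (homologyClass C m z) = Submodule.Quotient.mk z := by
    rw [LinearEquiv.symm_apply_eq]
    rfl
  exact congrArg (fun q => (LinearMap.ker (homologyClass C m)).liftQ
    (homologyClass C' n ∘ₗ φ.restrict hc) (ker_homologyClass_le φ hc hb) q) h

end InducedMap

end HomologyClasses

/-! ### Long exact sequences of shifted extensions -/

/-- A degreewise split short exact sequence `0 → X[k] → Y → Z → 0` of complexes, where the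
differential of `X[k]` is that of `X` up to a sign, together with the chain map
`θ : Z → X[k + 1]` which describes the differential of `Y`. -/
structure ShiftedExtension {A : Type u} [CommRing A] (k : ℕ)
    (X Y Z : ChainComplex (ModuleCat.{u} A) ℕ) where
  i : ∀ n, X.X n →ₗ[A] Y.X (n + k)
  p : Y ⟶ Z
  s : ∀ n, Z.X n →ₗ[A] Y.X n
  θ : ∀ n, Z.X (n + 1 + k) →ₗ[A] X.X n
  σ : ℤˣ
  i_injective : ∀ n, Function.Injective (i n)
  exact : ∀ n (y : Y.X (n + k)), (p.f (n + k)).hom y = 0 ↔ ∃ x, i n x = y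
  p_injective : ∀ n < k, Function.Injective (p.f n).hom
  p_s : ∀ n z, (p.f n).hom (s n z) = z
  i_d : ∀ n x, i n ((X.d (n + 1) n).hom x) =
    (σ : ℤ) • (Y.d (n + 1 + k) (n + k)).hom (i (n + 1) x)
  d_s : ∀ n z, (Y.d (n + 1 + k) (n + k)).hom (s (n + 1 + k) z) =
    s (n + k) ((Z.d (n + 1 + k) (n + k)).hom z) + i n (θ n z)

namespace ShiftedExtension

variable {A : Type u} [CommRing A] {k : ℕ} {X Y Z : ChainComplex (ModuleCat.{u} A) ℕ}
  (E : ShiftedExtension k X Y Z)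

lemma p_d (m n : ℕ) (y : Y.X m) :
    (E.p.f n).hom ((Y.d m n).hom y) = (Z.d m n).hom ((E.p.f m).hom y) :=
  (congrArg (fun ψ => ModuleCat.Hom.hom ψ y) (E.p.comm m n)).symm

lemma p_i (n : ℕ) (x : X.X n) : (E.p.f (n + k)).hom (E.i n x) = 0 :=
  (E.exact n _).2 ⟨x, rfl⟩

lemma σ_mul : (E.σ : ℤ) * E.σ = 1 := Int.units_coe_mul_self E.σ

lemma d_i (n : ℕ) (x : X.X (n + 1)) :
    (Y.d (n + 1 + k) (n + k)).hom (E.i (n + 1) x) =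
      E.i n ((E.σ : ℤ) • (X.d (n + 1) n).hom x) := by
  rw [map_zsmul, E.i_d, smul_smul, E.σ_mul, one_smul]

/-- The case `n = 0` is the edge of the shift: there $\partial(ix)$ falls in a degree below `k`,
where `p` is injective, and `p` kills it. -/
lemma i_mem_cycles {n : ℕ} {x : X.X n} (hx : x ∈ cycles X n) : E.i n x ∈ cycles Y (n + k) := by
  rcases n with _ | n
  · refine mem_cycles.2 fun j => ?_
    by_cases hj : j + 1 = 0 + k
    · apply E.p_injective j (by omega)
      rw [E.p_d, E.p_i, map_zero, map_zero]
    · rw [Y.shape _ _ hj]; rfl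
  · refine mem_cycles_of (n := n + k) (by omega) ?_
    rw [E.d_i, mem_cycles.1 hx, smul_zero, map_zero]

lemma i_mem_cycles_iff {n : ℕ} {x : X.X n} : E.i n x ∈ cycles Y (n + k) ↔ x ∈ cycles X n := by
  refine ⟨fun h => ?_, E.i_mem_cycles⟩
  rcases n with _ | n
  · exact mem_cycles_zero x
  · refine mem_cycles_of rfl ?_
    apply E.i_injective
    rw [E.i_d, mem_cycles.1 h, smul_zero, map_zero]

/-- For `n ≤ k` the differential lands below degree `k`, where `p` is injective and so detects that
it vanishes; no correction of `s z` is needed. -/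
lemma s_mem_cycles {n : ℕ} (hn : n ≤ k) {z : Z.X n} (hz : z ∈ cycles Z n) :
    E.s n z ∈ cycles Y n :=
  mem_cycles.2 fun j => by
    by_cases hj : j + 1 = n
    · apply E.p_injective j (by omega)
      rw [E.p_d, E.p_s, mem_cycles.1 hz, map_zero]
    · rw [Y.shape _ _ hj]; rfl

lemma i_θ {n : ℕ} {z : Z.X (n + 1 + k)} (hz : z ∈ cycles Z (n + 1 + k)) :
    E.i n (E.θ n z) = (Y.d (n + 1 + k) (n + k)).hom (E.s _ z) := by
  rw [E.d_s, mem_cycles.1 hz, map_zero, zero_add]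

lemma θ_mem_cycles {n : ℕ} {z : Z.X (n + 1 + k)} (hz : z ∈ cycles Z (n + 1 + k)) :
    E.θ n z ∈ cycles X n := by
  rw [← E.i_mem_cycles_iff, E.i_θ hz]
  exact d_mem_cycles Y _ _ _

/-- Expanding $\partial\partial(s w) = 0$ shows that `θ` commutes with the differentials up to the
sign $-\sigma$; hence it preserves boundaries. -/
lemma θ_d (n : ℕ) (w : Z.X (n + 1 + k + 1)) : ∃ x : X.X (n + 1),
    (X.d (n + 1) n).hom x = E.θ n ((Z.d (n + 1 + k + 1) (n + 1 + k)).hom w) := by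
  -- The degrees `n + 1 + k + 1` and `n + 1 + 1 + k` are equal but not definitionally so, hence the
  -- general `m`.
  have hw : ∀ m (hm : m = n + 1 + 1 + k) (w : Z.X m), ∃ x : X.X (n + 1),
      (X.d (n + 1) n).hom x = E.θ n ((Z.d m (n + 1 + k)).hom w) := by
    rintro _ rfl w
    refine ⟨-((E.σ : ℤ) • E.θ (n + 1) w), ?_⟩
    apply E.i_injective
    rw [E.i_θ (d_mem_cycles Z _ _ _), map_neg, map_zsmul, map_neg, map_zsmul, E.i_d, smul_smul,
      E.σ_mul, one_smul, neg_eq_iff_add_eq_zero, ← map_add, add_comm (E.i (n + 1) _), ← E.d_s]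
    exact mem_cycles.1 (d_mem_cycles Y _ _ _) _
  exact hw _ (by omega) w

/-- The map `H_n(X) → H_{n + k}(Y)` induced by `i`. -/
def iH (n : ℕ) : X.homology n ⟶ Y.homology (n + k) :=
  inducedMap (E.i n) (fun _ => E.i_mem_cycles) fun w => by
    have hw : ∀ m, n + 1 + k = m → ∃ w' : Y.X m,
        (Y.d m (n + k)).hom w' = E.i n ((X.d (n + 1) n).hom w) := by
      rintro _ rfl
      exact ⟨(E.σ : ℤ) • E.i (n + 1) w, by rw [map_zsmul, E.i_d]⟩
    exact hw _ (by omega)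

/-- The connecting map `H_{n + k + 1}(Z) → H_n(X)` induced by `θ`. -/
def θH (n : ℕ) : Z.homology (n + 1 + k) ⟶ X.homology n :=
  inducedMap (E.θ n) (fun _ => E.θ_mem_cycles) (E.θ_d n)

/-- The map `H_n(Y) → H_n(Z)` induced by `p`. -/
def pH (n : ℕ) : Y.homology n ⟶ Z.homology n := HomologicalComplex.homologyMap E.p n

lemma iH_homologyClass (n : ℕ) (x : cycles X n) : (E.iH n).hom (homologyClass X n x) =
    homologyClass Y (n + k) ⟨E.i n x, E.i_mem_cycles x.2⟩ :=
  inducedMap_homologyClass _ _ _ _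

lemma θH_homologyClass (n : ℕ) (z : cycles Z (n + 1 + k)) :
    (E.θH n).hom (homologyClass Z _ z) = homologyClass X n ⟨E.θ n z, E.θ_mem_cycles z.2⟩ :=
  inducedMap_homologyClass _ _ _ _

lemma pH_homologyClass (n : ℕ) (y : cycles Y n) : (E.pH n).hom (homologyClass Y n y) =
    homologyClass Z n ⟨(E.p.f n).hom y, map_mem_cycles E.p n y.2⟩ :=
  homologyMap_homologyClass _ _ _

/-- If $p(y) = \partial z$, then $y - \partial(s z)$ is a cycle homologous to $y$ in the kernel of
`p`, hence in the image of `i`. -/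
lemma exact_iH_pH (n : ℕ) : Function.Exact (E.iH n) (E.pH (n + k)) := by
  intro c
  obtain ⟨y, rfl⟩ := homologyClass_surjective _ _ c
  constructor
  · intro h
    obtain ⟨z, hz⟩ := (homologyClass_eq_zero_iff Z (show n + k + 1 = n + 1 + k by omega) _).1
      ((E.pH_homologyClass _ y).symm.trans h)
    obtain ⟨x, hx⟩ := (E.exact n ((y : Y.X _) - (Y.d (n + 1 + k) (n + k)).hom (E.s _ z))).1 (by
      rw [map_sub, E.p_d, E.p_s, hz, sub_self])
    have hxc : x ∈ cycles X n := by
      rw [← E.i_mem_cycles_iff, hx]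
      exact sub_mem y.2 (d_mem_cycles Y _ _ _)
    refine ⟨homologyClass X n ⟨x, hxc⟩, (E.iH_homologyClass _ _).trans ?_⟩
    refine (homologyClass_eq_iff Y (show n + k + 1 = n + 1 + k by omega) _ _).2 ⟨-E.s _ z, ?_⟩
    change _ = E.i n x - (y : Y.X _)
    rw [hx, map_neg]
    abel
  · rintro ⟨c', h⟩
    obtain ⟨x, rfl⟩ := homologyClass_surjective _ _ c'
    refine (congrArg (E.pH _).hom (h.symm.trans (E.iH_homologyClass _ _))).trans ?_
    refine (E.pH_homologyClass _ _).trans ((homologyClass_eq_zero_iff Z rfl _).2 ⟨0, ?_⟩)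
    rw [map_zero]
    exact (E.p_i _ _).symm

/-- If $\theta z = \partial x$, then $s z - \sigma\, i x$ is a cycle lifting $z$. Conversely, for a
cycle $y$, the element $x$ with $i x = y - s(p y)$ satisfies $\partial(-\sigma x) = \theta(p y)$. -/
lemma exact_pH_θH (n : ℕ) : Function.Exact (E.pH (n + 1 + k)) (E.θH n) := by
  intro c
  obtain ⟨z, rfl⟩ := homologyClass_surjective _ _ c
  constructor
  · intro h
    obtain ⟨x, hx⟩ := (homologyClass_eq_zero_iff X rfl _).1 ((E.θH_homologyClass _ z).symm.trans h)
    have hx' : (X.d (n + 1) n).hom x = E.θ n z := hx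
    have hy : E.s _ (z : Z.X _) - (E.σ : ℤ) • E.i (n + 1) x ∈ cycles Y (n + 1 + k) := by
      refine mem_cycles_of (n := n + k) (by omega) ?_
      rw [map_sub, map_zsmul, E.d_i, ← E.i_θ z.2, ← hx', map_zsmul, smul_smul, E.σ_mul, one_smul,
        sub_self]
    refine ⟨homologyClass Y _ ⟨_, hy⟩, (E.pH_homologyClass _ _).trans ?_⟩
    congr 1
    refine Subtype.ext ?_
    change (E.p.f (n + 1 + k)).hom (E.s _ (z : Z.X _) - (E.σ : ℤ) • E.i (n + 1) x) = z
    rw [map_sub, map_zsmul, E.p_i, smul_zero, sub_zero, E.p_s]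
  · rintro ⟨c', h⟩
    obtain ⟨y, rfl⟩ := homologyClass_surjective _ _ c'
    rw [← h]
    refine (congrArg (E.θH _).hom (E.pH_homologyClass _ y)).trans ?_
    refine (E.θH_homologyClass _ _).trans ((homologyClass_eq_zero_iff X rfl _).2 ?_)
    obtain ⟨x, hx⟩ := (E.exact (n + 1) ((y : Y.X _) - E.s _ ((E.p.f _).hom (y : Y.X _)))).1 (by
      rw [map_sub, E.p_s, sub_self])
    refine ⟨-((E.σ : ℤ) • x), ?_⟩
    apply E.i_injective
    refine Eq.trans ?_ (E.i_θ (map_mem_cycles E.p _ y.2)).symm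
    rw [map_neg, map_zsmul, map_neg, map_zsmul, E.i_d, smul_smul, E.σ_mul, one_smul, hx, map_sub,
      mem_cycles.1 y.2, zero_sub, neg_neg]

/-- If $i x = \partial y$, then $p y$ is a cycle, and comparing $y$ with $s(p y)$ shows that
$\theta(p y)$ is homologous to $x$. Conversely $i(\theta z)$ is the boundary of $s z$. -/
lemma exact_θH_iH (n : ℕ) : Function.Exact (E.θH n) (E.iH n) := by
  intro c
  obtain ⟨x, rfl⟩ := homologyClass_surjective _ _ c
  constructor
  · intro h
    obtain ⟨y, hy⟩ := (homologyClass_eq_zero_iff Y (show n + k + 1 = n + 1 + k by omega) _).1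
      ((E.iH_homologyClass _ x).symm.trans h)
    have hy' : (Y.d (n + 1 + k) (n + k)).hom y = E.i n x := hy
    have hz : (E.p.f (n + 1 + k)).hom y ∈ cycles Z (n + 1 + k) := by
      refine mem_cycles_of (n := n + k) (by omega) ?_
      rw [← E.p_d, hy', E.p_i]
    refine ⟨homologyClass Z _ ⟨_, hz⟩, (E.θH_homologyClass _ _).trans ?_⟩
    obtain ⟨x', hx'⟩ := (E.exact (n + 1) (y - E.s _ ((E.p.f _).hom y))).1 (by
      rw [map_sub, E.p_s, sub_self])
    refine (homologyClass_eq_iff X rfl _ _).2 ⟨-((E.σ : ℤ) • x'), ?_⟩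
    apply E.i_injective
    change _ = E.i n (E.θ n _ - (x : X.X n))
    rw [map_neg, map_zsmul, map_neg, map_zsmul, E.i_d, smul_smul, E.σ_mul, one_smul, hx', map_sub,
      map_sub, E.i_θ hz, hy']
    abel
  · rintro ⟨c', h⟩
    obtain ⟨z, rfl⟩ := homologyClass_surjective _ _ c'
    refine (congrArg (E.iH _).hom (h.symm.trans (E.θH_homologyClass _ _))).trans ?_
    refine (E.iH_homologyClass _ _).trans
      ((homologyClass_eq_zero_iff Y (show n + k + 1 = n + 1 + k by omega) _).2 ⟨E.s _ z, ?_⟩)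
    exact (E.i_θ z.2).symm

lemma surjective_pH {n : ℕ} (hn : n ≤ k) : Function.Surjective (E.pH n) := by
  intro c
  obtain ⟨z, rfl⟩ := homologyClass_surjective _ _ c
  refine ⟨homologyClass Y n ⟨E.s n z, E.s_mem_cycles hn z.2⟩, (E.pH_homologyClass _ _).trans ?_⟩
  congr 1
  exact Subtype.ext (E.p_s _ _)

/-- Below degree `k` the shifted complex has no terms, so `p` is a degreewise isomorphism there.
This gives the low-degree ends of both long exact sequences. -/
lemma bijective_pH {n : ℕ} (hn : n < k) : Function.Bijective (E.pH n) := by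
  refine ⟨?_, E.surjective_pH hn.le⟩
  refine (injective_iff_map_eq_zero (E.pH n).hom).2 fun c h => ?_
  obtain ⟨y, rfl⟩ := homologyClass_surjective _ _ c
  obtain ⟨z, hz⟩ := (homologyClass_eq_zero_iff Z rfl _).1 ((E.pH_homologyClass _ y).symm.trans h)
  refine (homologyClass_eq_zero_iff Y rfl _).2 ⟨E.s _ z, ?_⟩
  apply E.p_injective n hn
  rw [E.p_d, E.p_s, hz]

end ShiftedExtension

/-! ### Gradings given by bases -/

/-- The submodules spanned by the parts of a basis of given degree form a grading. -/
lemma isInternal_span_image {Q U ι : Type*} [CommRing Q] [AddCommGroup U] [Module Q U]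
    (b : Module.Basis ι Q U) (gr : ι → ℕ) :
    DirectSum.IsInternal fun n => Submodule.span Q (b '' {i | gr i = n}) := by
  rw [DirectSum.isInternal_submodule_iff_iSupIndep_and_iSup_eq_top]
  constructor
  · intro n
    have h : ⨆ (m) (_ : m ≠ n), Submodule.span Q (b '' {i | gr i = m}) =
        Submodule.span Q (b '' {i | gr i ≠ n}) := by
      rw [← Submodule.span_iUnion₂, ← Set.image_iUnion₂]
      congr 2
      ext i
      simp
    rw [h]
    refine b.linearIndependent.disjoint_span_image ?_
    rw [Set.disjoint_left]
    exact fun i hi hi' => hi' hi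
  · rw [← Submodule.span_iUnion, ← Set.image_iUnion, ← b.span_eq, ← Set.image_univ]
    congr 2
    ext i
    simp

/-- Modular law: $T_n$ is disjoint from the sum of the other $T_m$, while $S_n$ and that sum already
span everything. -/
lemma eq_of_isInternal_of_le {Q U : Type*} [CommRing Q] [AddCommGroup U] [Module Q U]
    {S T : ℕ → Submodule Q U} (hT : DirectSum.IsInternal T) (hS : ⨆ n, S n = ⊤)
    (h : ∀ n, S n ≤ T n) (n : ℕ) : T n = S n := by
  refine le_antisymm ?_ (h n)
  have hd := hT.submodule_iSupIndep n
  have htop : S n ⊔ (⨆ (m) (_ : m ≠ n), T m) = ⊤ := by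
    rw [eq_top_iff, ← hS]
    refine iSup_le fun m => ?_
    by_cases hm : m = n
    · subst hm; exact le_sup_left
    · exact le_sup_of_le_right ((h m).trans (le_iSup₂_of_le m hm le_rfl))
  calc T n = (S n ⊔ (⨆ (m) (_ : m ≠ n), T m)) ⊓ T n := by rw [htop, top_inf_eq]
    _ = S n ⊔ (⨆ (m) (_ : m ≠ n), T m) ⊓ T n := (sup_inf_assoc_of_le _ (h n))
    _ ≤ S n := by rw [inf_comm, hd.eq_bot, sup_bot_eq]

/-! ### Division by `t` in the Tate algebra -/

namespace TateAlg

variable {Q : Type*} [CommRing Q]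

lemma y_mem_deg (i : ℕ) : (y i : TateAlg Q) ∈ deg i := Submodule.mem_span_singleton_self _

lemma c_two_left (i : ℕ) : c 2 i = i / 2 + 1 := by
  rw [c, if_neg (by simp [Nat.odd_iff])]
  simp [add_comm]

/-- The `Q`-linear map with `y_{i+2} ↦ (i / 2 + 1)⁻¹ y_i`, a left inverse of multiplication by
`t = y_2` when the positive integers are invertible in `Q`. -/
def divT : TateAlg Q →ₗ[Q] TateAlg Q :=
  basis.constr Q fun i => match i with
    | 0 => 0
    | 1 => 0
    | n + 2 => Ring.inverse ((n / 2 + 1 : ℕ) : Q) • y n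

lemma divT_y_zero : divT (y 0 : TateAlg Q) = 0 := by
  rw [divT, ← basis_apply, Module.Basis.constr_basis]

lemma divT_y_one : divT (y 1 : TateAlg Q) = 0 := by
  rw [divT, ← basis_apply, Module.Basis.constr_basis]

lemma divT_y_add_two (n : ℕ) :
    divT (y (n + 2) : TateAlg Q) = Ring.inverse ((n / 2 + 1 : ℕ) : Q) • y n := by
  rw [divT, ← basis_apply, Module.Basis.constr_basis]

/-- Here $t \cdot y_i = (\lfloor i/2\rfloor + 1)\,y_{i+2}$, so invertibility of positive integers is
exactly what dividing by $t$ requires. `Ring.inverse` lets `divT` be defined without that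
assumption. -/
lemma divT_y_two_mul (h : ∀ n : ℕ, IsUnit ((n + 1 : ℕ) : Q)) (i : ℕ) :
    divT (y 2 * y i : TateAlg Q) = y i := by
  rw [y_mul_y, map_smul, add_comm 2 i, divT_y_add_two, smul_smul, c_two_left,
    Ring.mul_inverse_cancel _ (h _), one_smul]

lemma y_two_mul_divT (h : ∀ n : ℕ, IsUnit ((n + 1 : ℕ) : Q)) (i : ℕ) :
    (y 2 * divT (y (i + 2)) : TateAlg Q) = y (i + 2) := by
  rw [divT_y_add_two, mul_smul_comm, y_mul_y, smul_smul, c_two_left,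
    Ring.inverse_mul_cancel _ (h _), one_smul, add_comm]

end TateAlg

/-! ### Coordinates on a dg resolution and its differential modulo `t` -/

namespace DGResolution

variable {Q : Type u} [CommRing Q] {f g : Q} {hfg : IsExactPair f g}
  {M : Type u} [AddCommGroup M] [Module Q M] (D : DGResolution hfg M)

open TateAlg

/-- The `Q`-basis `y_i e_δ` of `U`. -/
def qBasis : Module.Basis (ℕ × D.Δ) Q D.U := TateAlg.basis.smulTower D.e

lemma qBasis_apply (p : ℕ × D.Δ) : D.qBasis p = (y p.1 : TateAlg Q) • D.e p.2 :=
  Module.Basis.smulTower_apply _ _ _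

instance : Module.Free Q D.U := Module.Free.of_basis D.qBasis

/-- The generators `y_i e_δ` of degree `n`. -/
def gens (n : ℕ) : Set D.U := {u | ∃ i δ, i + D.deg δ = n ∧ (y i : TateAlg Q) • D.e δ = u}

lemma smul_e_mem (i : ℕ) (δ : D.Δ) {n : ℕ} (h : i + D.deg δ = n) :
    (y i : TateAlg Q) • D.e δ ∈ D.dg.deg n :=
  h ▸ D.dg.smul_mem (y_mem_deg i) (D.e_mem δ)

/-- The spans of the $y_i e_\delta$ of given total degree already form a grading and lie inside the
given one, so the two coincide. Identities on $U_n$ may therefore be checked on these generators. -/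
lemma deg_eq_span (n : ℕ) : D.dg.deg n = Submodule.span Q (D.gens n) := by
  have hg : ∀ n, D.gens n = D.qBasis '' {p | p.1 + D.deg p.2 = n} := by
    intro n
    ext u
    constructor
    · rintro ⟨i, δ, h, rfl⟩
      exact ⟨(i, δ), h, D.qBasis_apply _⟩
    · rintro ⟨⟨i, δ⟩, h, rfl⟩
      exact ⟨i, δ, h, (D.qBasis_apply (i, δ)).symm⟩
  have hi := isInternal_span_image D.qBasis fun p => p.1 + D.deg p.2
  simp only [← hg] at hi
  refine eq_of_isInternal_of_le (S := fun n => Submodule.span Q (D.gens n)) D.dg.isInternal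
    hi.submodule_iSup_eq_top (fun n => ?_) n
  rw [Submodule.span_le]
  rintro _ ⟨i, δ, h, rfl⟩
  exact D.smul_e_mem i δ h

variable {D}

lemma eq_on_deg {W : Type*} [AddCommGroup W] [Module Q W] {φ ψ : D.U →ₗ[Q] W} {n : ℕ}
    (h : ∀ i δ, i + D.deg δ = n →
      φ ((y i : TateAlg Q) • D.e δ) = ψ ((y i : TateAlg Q) • D.e δ))
    {u : D.U} (hu : u ∈ D.dg.deg n) : φ u = ψ u := by
  rw [deg_eq_span] at hu
  refine LinearMap.eqOn_span ?_ hu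
  rintro _ ⟨i, δ, hi, rfl⟩
  exact h i δ hi

lemma ext_y_smul_e {W : Type*} [AddCommGroup W] [Module Q W] {φ ψ : D.U →ₗ[Q] W}
    (h : ∀ i δ, φ ((y i : TateAlg Q) • D.e δ) = ψ ((y i : TateAlg Q) • D.e δ)) : φ = ψ :=
  D.qBasis.ext fun p => by rw [qBasis_apply]; exact h _ _

lemma map_mem_of_deg {W : Type*} [AddCommGroup W] [Module Q W] {φ : D.U →ₗ[Q] W} {n : ℕ}
    {S : Submodule Q W} (h : ∀ i δ, i + D.deg δ = n → φ ((y i : TateAlg Q) • D.e δ) ∈ S)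
    {u : D.U} (hu : u ∈ D.dg.deg n) : φ u ∈ S := by
  rw [deg_eq_span] at hu
  have : Submodule.span Q (D.gens n) ≤ S.comap φ := by
    rw [Submodule.span_le]
    rintro _ ⟨i, δ, hi, rfl⟩
    exact h i δ hi
  exact this hu

variable (D)

/-- The coefficients of `y_i e_δ`, for `δ` of degree `j`. -/
def coord (i : ℕ) (j : ℤ) : D.U →ₗ[Q] D.V j :=
  Finsupp.lsubtypeDomain {δ : D.Δ | (D.deg δ : ℤ) = j} ∘ₗ
    Finsupp.mapRange.linearMap (TateAlg.coeff i) ∘ₗ (D.e.repr.toLinearMap.restrictScalars Q)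

lemma coord_y_smul_e (i : ℕ) (j : ℤ) (l : ℕ) (δ : D.Δ) (q : Q)  :
    D.coord i j (q • (y l : TateAlg Q) • D.e δ) =
      Finsupp.subtypeDomain (fun δ : D.Δ => (D.deg δ : ℤ) = j)
        (Finsupp.single δ (if l = i then q else 0)) := by
  rw [map_smul, coord]
  simp only [LinearMap.comp_apply, LinearMap.restrictScalars_apply, LinearEquiv.coe_coe, map_smul,
    Module.Basis.repr_self, Finsupp.smul_single, smul_eq_mul, mul_one,
    Finsupp.mapRange.linearMap_apply, Finsupp.mapRange_single, coeff_y]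
  rw [← map_smul, Finsupp.smul_single, smul_eq_mul, mul_ite, mul_one, mul_zero]
  rfl

lemma subtypeDomain_single_of_eq {δ : D.Δ} {j : ℤ} (h : (D.deg δ : ℤ) = j) (q : Q) :
    Finsupp.subtypeDomain (fun δ : D.Δ => (D.deg δ : ℤ) = j) (Finsupp.single δ q) =
      Finsupp.single ⟨δ, h⟩ q := by
  classical
  ext ⟨δ', h'⟩
  simp [Finsupp.single_apply]

lemma subtypeDomain_single_of_ne {δ : D.Δ} {j : ℤ} (h : (D.deg δ : ℤ) ≠ j) (q : Q) :
    Finsupp.subtypeDomain (fun δ : D.Δ => (D.deg δ : ℤ) = j) (Finsupp.single δ q) = 0 := by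
  classical
  ext ⟨δ', h'⟩
  have : δ ≠ δ' := by rintro rfl; exact h h'
  simp [this]

lemma coord_of_eq {i : ℕ} {j : ℤ} {δ : D.Δ} (h : (D.deg δ : ℤ) = j) :
    D.coord i j ((y i : TateAlg Q) • D.e δ) = Finsupp.single ⟨δ, h⟩ 1 := by
  rw [← one_smul Q ((y i : TateAlg Q) • D.e δ), coord_y_smul_e, if_pos rfl,
    subtypeDomain_single_of_eq]

lemma coord_of_ne {i l : ℕ} (j : ℤ) (δ : D.Δ) (h : l ≠ i) :
    D.coord i j ((y l : TateAlg Q) • D.e δ) = 0 := by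
  rw [← one_smul Q ((y l : TateAlg Q) • D.e δ), coord_y_smul_e, if_neg h]
  simp

lemma incl_single {j : ℤ} (δ : {δ : D.Δ // (D.deg δ : ℤ) = j}) (q : Q) :
    D.incl j (Finsupp.single δ q) = q • D.e δ := by
  rw [incl, Finsupp.linearCombination_single]

lemma y_smul_incl_mem {i n : ℕ} {j : ℤ} (h : i + j = n) (v : D.V j) :
    (y i : TateAlg Q) • D.incl j v ∈ D.dg.deg n := by
  induction v using Finsupp.induction_linear with
  | zero => simp
  | add v w hv hw => rw [map_add, smul_add]; exact add_mem hv hw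
  | single δ q =>
    rw [incl_single, smul_comm]
    refine Submodule.smul_mem _ _ (D.smul_e_mem _ _ ?_)
    have := δ.2
    omega

lemma y_zero_smul (u : D.U) : (y 0 : TateAlg Q) • u = u := by
  rw [← one_def, one_smul]

lemma incl_mem {n : ℕ} {j : ℤ} (h : j = n) (v : D.V j) : D.incl j v ∈ D.dg.deg n := by
  have := D.y_smul_incl_mem (i := 0) (n := n) (j := j) (by simpa using h) v
  rwa [y_zero_smul] at this

/-- Multiplication by `y_i` as a `Q`-linear map. -/
def ySmul (i : ℕ) : D.U →ₗ[Q] D.U := Algebra.lsmul Q Q D.U (y i : TateAlg Q)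

lemma ySmul_apply (i : ℕ) (u : D.U) : D.ySmul i u = (y i : TateAlg Q) • u := rfl

lemma y_smul_y_smul (i l : ℕ) (u : D.U) :
    (y i : TateAlg Q) • (y l : TateAlg Q) • u = (c i l : Q) • (y (i + l) : TateAlg Q) • u := by
  rw [smul_smul, y_mul_y, smul_assoc]

/-- A product $y_l y_m$ is a multiple of $y_{l+m}$, so multiplication by $y_l$ produces no
coefficients of index below $l$. -/
lemma coord_y_smul_of_lt {i l : ℕ} (j : ℤ) (h : i < l) (u : D.U) :
    D.coord i j ((y l : TateAlg Q) • u) = 0 := by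
  have : D.coord i j ∘ₗ D.ySmul l = 0 := ext_y_smul_e fun m δ => by
    rw [LinearMap.comp_apply, ySmul_apply, y_smul_y_smul, map_smul, coord_of_ne _ _ _ (by omega),
      smul_zero, LinearMap.zero_apply]
  exact LinearMap.congr_fun this u

/-- Only the $y_0$ part of `u` can contribute to $y_i$, and $y_i y_0 = y_i$ without a factor. -/
lemma coord_y_smul_self (i : ℕ) (j : ℤ) (u : D.U) :
    D.coord i j ((y i : TateAlg Q) • u) = D.coord 0 j u := by
  have : D.coord i j ∘ₗ D.ySmul i = D.coord 0 j := ext_y_smul_e fun m δ => by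
    rw [LinearMap.comp_apply, ySmul_apply, y_smul_y_smul, map_smul]
    by_cases hm : m = 0
    · subst hm
      rw [c_comm, c_zero_left, Nat.cast_one, one_smul, add_zero]
      by_cases hj : (D.deg δ : ℤ) = j
      · rw [coord_of_eq _ hj, coord_of_eq _ hj]
      · have h1 := D.coord_y_smul_e i j i δ 1
        have h2 := D.coord_y_smul_e 0 j 0 δ 1
        rw [subtypeDomain_single_of_ne _ hj, one_smul] at h1 h2
        rw [h1, h2]
    · rw [coord_of_ne _ _ _ (by omega), coord_of_ne _ _ _ hm, smul_zero]
  exact LinearMap.congr_fun this u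

lemma coord_zero_incl (j : ℤ) (v : D.V j) : D.coord 0 j (D.incl j v) = v := by
  induction v using Finsupp.induction_linear with
  | zero => simp
  | add v w hv hw => rw [map_add, map_add, hv, hw]
  | single δ q =>
    rw [incl_single, map_smul, ← y_zero_smul D (D.e _), coord_of_eq _ δ.2, Finsupp.smul_single,
      smul_eq_mul, mul_one]

lemma coord_succ_incl (i : ℕ) (j k : ℤ) (v : D.V j) : D.coord (i + 1) k (D.incl j v) = 0 := by
  induction v using Finsupp.induction_linear with
  | zero => simp
  | add v w hv hw => rw [map_add, map_add, hv, hw, add_zero]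
  | single δ q =>
    rw [incl_single, map_smul, ← y_zero_smul D (D.e _), coord_of_ne _ _ _ (by omega), smul_zero]

lemma coord_y_smul_incl (i : ℕ) (j : ℤ) (v : D.V j) :
    D.coord i j ((y i : TateAlg Q) • D.incl j v) = v := by
  rw [coord_y_smul_self, coord_zero_incl]

lemma incl_coord_y_smul_e {i l : ℕ} {n : ℕ} {j : ℤ} (hj : i + j = n) {δ : D.Δ}
    (h : l + D.deg δ = n) :
    (y i : TateAlg Q) • D.incl j (D.coord i j ((y l : TateAlg Q) • D.e δ)) =
      if l = i then (y l : TateAlg Q) • D.e δ else 0 := by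
  split_ifs with hl
  · subst hl
    rw [coord_of_eq _ (show (D.deg δ : ℤ) = j by omega), incl_single, one_smul]
  · rw [coord_of_ne _ _ _ hl, map_zero, smul_zero]

lemma eq_sum_y_smul_incl {n : ℕ} {u : D.U} (hu : u ∈ D.dg.deg n) :
    u = ∑ i ∈ Finset.range (n + 1), (y i : TateAlg Q) • D.incl (n - i) (D.coord i (n - i) u) := by
  have := eq_on_deg (D := D) (φ := LinearMap.id)
    (ψ := ∑ i ∈ Finset.range (n + 1), D.ySmul i ∘ₗ D.incl (n - i) ∘ₗ D.coord i (n - i))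
    (fun l δ h => by
      simp only [LinearMap.id_apply, LinearMap.sum_apply, LinearMap.comp_apply, ySmul_apply,
        D.incl_coord_y_smul_e (add_sub_cancel _ _) h]
      rw [Finset.sum_ite_eq, if_pos]
      simp; omega) hu
  simpa [ySmul_apply] using this

/-- The left inverse of multiplication by `t` on `U`. -/
def divT : D.U →ₗ[Q] D.U :=
  (D.e.repr.symm.toLinearMap.restrictScalars Q) ∘ₗ
    Finsupp.mapRange.linearMap TateAlg.divT ∘ₗ (D.e.repr.toLinearMap.restrictScalars Q)

lemma divT_smul_e (a : TateAlg Q) (δ : D.Δ) : D.divT (a • D.e δ) = TateAlg.divT a • D.e δ := by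
  simp [divT]

section Invertible

lemma divT_y_two_smul (h : ∀ n : ℕ, IsUnit ((n + 1 : ℕ) : Q)) (u : D.U) :
    D.divT ((y 2 : TateAlg Q) • u) = u := by
  have : D.divT ∘ₗ D.ySmul 2 = LinearMap.id := ext_y_smul_e fun m δ => by
    rw [LinearMap.comp_apply, ySmul_apply, smul_smul, divT_smul_e, TateAlg.divT_y_two_mul h]
    rfl
  exact LinearMap.congr_fun this u

lemma divT_mem {n : ℕ} {u : D.U} (hu : u ∈ D.dg.deg (n + 2)) : D.divT u ∈ D.dg.deg n := by
  refine map_mem_of_deg (fun i δ h => ?_) hu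
  rw [divT_smul_e]
  match i, h with
  | 0, h => rw [divT_y_zero, zero_smul]; exact zero_mem _
  | 1, h => rw [divT_y_one, zero_smul]; exact zero_mem _
  | i + 2, h =>
    rw [divT_y_add_two, smul_assoc]
    exact Submodule.smul_mem _ _ (D.smul_e_mem _ _ (by omega))

/-- This is $U = V \oplus yV \oplus tU$. It suffices to check the generators $y_l e_\delta$, where
exactly one of the three terms survives according as $l = 0$, $l = 1$ or $l \ge 2$. -/
lemma decomposition (h : ∀ n : ℕ, IsUnit ((n + 1 : ℕ) : Q)) {n : ℕ} {u : D.U}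
    (hu : u ∈ D.dg.deg n) :
    u = D.incl n (D.coord 0 n u) + (y 1 : TateAlg Q) • D.incl (n - 1) (D.coord 1 (n - 1) u) +
      (y 2 : TateAlg Q) • D.divT u := by
  refine eq_on_deg (D := D) (φ := LinearMap.id)
    (ψ := D.incl n ∘ₗ D.coord 0 n + D.ySmul 1 ∘ₗ D.incl (n - 1) ∘ₗ D.coord 1 (n - 1) +
      D.ySmul 2 ∘ₗ D.divT) (fun l δ hl => ?_) hu
  have h0 := D.incl_coord_y_smul_e (i := 0) (j := n) (by simp) hl
  have h1 := D.incl_coord_y_smul_e (i := 1) (j := n - 1) (by simp) hl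
  rw [y_zero_smul] at h0
  simp only [LinearMap.id_apply, LinearMap.add_apply, LinearMap.comp_apply, ySmul_apply, h0, h1,
    divT_smul_e]
  match l with
  | 0 => simp [divT_y_zero]
  | 1 => simp [divT_y_one]
  | l + 2 => rw [if_neg (by omega), if_neg (by omega), smul_smul, y_two_mul_divT h, zero_add,
      zero_add]

end Invertible

lemma d_y_smul (i : ℕ) (u : D.U) : D.dg.d ((y i : TateAlg Q) • u) =
    TateAlg.d f g (y i) • u + (-1 : ℤ) ^ i • (y i : TateAlg Q) • D.dg.d u :=
  D.dg.leibniz u (y_mem_deg i)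

lemma d_y_one_smul (u : D.U) : D.dg.d ((y 1 : TateAlg Q) • u) =
    f • u - (y 1 : TateAlg Q) • D.dg.d u := by
  rw [d_y_smul, show (1 : ℕ) = 0 + 1 from rfl, d_y_succ, if_pos (by simp), smul_assoc, y_zero_smul]
  simp [sub_eq_add_neg]

lemma d_y_two_smul (u : D.U) : D.dg.d ((y 2 : TateAlg Q) • u) =
    g • (y 1 : TateAlg Q) • u + (y 2 : TateAlg Q) • D.dg.d u := by
  rw [d_y_smul, show (2 : ℕ) = 1 + 1 from rfl, d_y_succ, if_neg (by simp), smul_assoc]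
  simp

/-- Minus the coefficient of `y_1` in the differential: a lift of the Eisenbud operator. -/
def tau (i j : ℤ) : D.V i →ₗ[Q] D.V j := -(D.coord 1 j ∘ₗ D.dg.d ∘ₗ D.incl i)

lemma tau_apply (i j : ℤ) (v : D.V i) : D.tau i j v = -D.coord 1 j (D.dg.d (D.incl i v)) := rfl

/-- Definitional, since `proj` is `coord 0`. -/
lemma dV_apply (i j : ℤ) (v : D.V i) : D.dV i j v = D.coord 0 j (D.dg.d (D.incl i v)) := rfl

/-- The integer index lets $V$ vanish in negative degrees, which settles the edge cases at the
bottom of the complexes. -/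
lemma V_subsingleton {i : ℤ} (hi : i < 0) : Subsingleton (D.V i) := by
  have : IsEmpty {δ : D.Δ // (D.deg δ : ℤ) = i} := ⟨fun δ => by have := δ.2; omega⟩
  infer_instance

/-- The coefficients of `y_0` and `y_1` in the differential of an element of `U_n`. -/
lemma coord_zero_d (h : ∀ n : ℕ, IsUnit ((n + 1 : ℕ) : Q)) {n : ℕ} {u : D.U}
    (hu : u ∈ D.dg.deg n) (j : ℤ) (hj : j = n - 1) :
    D.coord 0 j (D.dg.d u) = D.dV n j (D.coord 0 n u) + f • D.coord 1 j u := by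
  subst hj
  conv_lhs => rw [D.decomposition h hu]
  rw [map_add, map_add, map_add, map_add, d_y_one_smul, d_y_two_smul, map_sub, map_add,
    map_smul _ f, map_smul _ g, coord_y_smul_of_lt _ _ (show 0 < 1 by omega),
    coord_y_smul_of_lt _ _ (show 0 < 1 by omega), coord_y_smul_of_lt _ _ (show 0 < 2 by omega),
    coord_zero_incl, dV_apply]
  simp

/-- Apply the differential to the three terms of `decomposition`. The last summand comes from
$\partial t = g y$; it is the obstruction that disappears over `S`. -/
lemma coord_one_d (h : ∀ n : ℕ, IsUnit ((n + 1 : ℕ) : Q)) {n : ℕ} {u : D.U}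
    (hu : u ∈ D.dg.deg n) (j k : ℤ) (hj : j = n - 1) :
    D.coord 1 k (D.dg.d u) = -D.tau n k (D.coord 0 n u) - D.dV j k (D.coord 1 j u) +
      g • D.coord 0 k (D.divT u) := by
  subst hj
  conv_lhs => rw [D.decomposition h hu]
  rw [map_add, map_add, map_add, map_add, d_y_one_smul, d_y_two_smul, map_sub, map_add,
    map_smul _ f, map_smul _ g, coord_y_smul_of_lt _ _ (show 1 < 2 by omega),
    coord_y_smul_self, coord_y_smul_self, coord_succ_incl D 0, dV_apply, tau_apply]
  simp [sub_eq_add_neg]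

/-- The coefficient of $y_0$ in $\partial\partial v = 0$: besides $(\partial^V)^2 v$, only $\partial
y = f$ contributes, through the $y_1$ coefficient of $\partial v$. -/
lemma dV_dV (h : ∀ n : ℕ, IsUnit ((n + 1 : ℕ) : Q)) (i j k : ℤ) (hij : j + 1 = i)
    (hjk : k + 1 = j) : D.dV j k ∘ₗ D.dV i j = f • D.tau i k := by
  by_cases hi : i < 1
  · have := D.V_subsingleton (show j < 0 by omega)
    have := D.V_subsingleton (show k < 0 by omega)
    exact LinearMap.ext fun _ => Subsingleton.elim _ _
  obtain ⟨n, rfl⟩ : ∃ n : ℕ, (n : ℤ) = j := ⟨j.toNat, by omega⟩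
  refine LinearMap.ext fun v => ?_
  have hv : D.dg.d (D.incl i v) ∈ D.dg.deg n := D.dg.d_mem (D.incl_mem (by omega) v)
  have h0 := D.coord_zero_d h hv k (by omega)
  rw [D.dg.d_d, map_zero] at h0
  rw [LinearMap.comp_apply, LinearMap.smul_apply, tau_apply, smul_neg,
    ← sub_eq_zero, sub_neg_eq_add]
  exact h0.symm

/-- The lift of the Eisenbud operator given by the coefficient of `y_1`. -/
def eisenbudLift (h : ∀ n : ℕ, IsUnit ((n + 1 : ℕ) : Q)) : D.EisenbudLift where
  τ := D.tau
  dV_dV := D.dV_dV h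

end DGResolution

/-! ### The dg resolution as a projective resolution over `Q` -/

/-- An exact augmented complex of modules is a resolution. -/
lemma quasiIso_of_exact {A : Type u} [CommRing A] {C : ChainComplex (ModuleCat.{u} A) ℕ}
    {M : ModuleCat.{u} A} (π : C ⟶ (ChainComplex.single₀ (ModuleCat.{u} A)).obj M)
    (hsurj : Function.Surjective (π.f 0).hom)
    (h0 : ∀ x : C.X 0, (π.f 0).hom x = 0 → ∃ w : C.X 1, (C.d 1 0).hom w = x)
    (hs : ∀ n (x : C.X (n + 1)), (C.d (n + 1) n).hom x = 0 →
      ∃ w : C.X (n + 2), (C.d (n + 2) (n + 1)).hom w = x) : QuasiIso π :=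
  ⟨fun n => by
    cases n with
    | zero =>
      rw [ChainComplex.quasiIsoAt₀_iff, ShortComplex.quasiIso_iff_of_zeros']
      · constructor
        · rw [ShortComplex.moduleCat_exact_iff]
          exact h0
        · exact (ModuleCat.epi_iff_surjective _).2 hsurj
      · exact C.shape 0 0 (by simp)
      all_goals rfl
    | succ n =>
      rw [quasiIsoAt_iff_exactAt']
      · rw [HomologicalComplex.exactAt_iff' _ (n + 2) (n + 1) n (by simp) (by simp),
          ShortComplex.moduleCat_exact_iff]
        exact hs n
      · apply ChainComplex.exactAt_succ_single_obj⟩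

namespace DGResolution

variable {Q : Type u} [CommRing Q] {f g : Q} {hfg : IsExactPair f g}
  {M : Type u} [AddCommGroup M] [Module Q M] (D : DGResolution hfg M)

open TateAlg

/-- A graded piece is a direct summand of the free module $U$. -/
instance (n : ℕ) : Module.Projective Q (D.dg.deg n) := by
  classical
  let e := LinearEquiv.ofBijective (DirectSum.coeLinearMap D.dg.deg) D.dg.isInternal
  refine Module.Projective.of_split (D.dg.deg n).subtype
    (DirectSum.component Q ℕ (fun n => D.dg.deg n) n ∘ₗ e.symm.toLinearMap) ?_
  refine LinearMap.ext fun u => ?_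
  have : e.symm (u : D.U) = DirectSum.lof Q ℕ (fun n => D.dg.deg n) n u := by
    rw [LinearEquiv.symm_apply_eq]
    exact (DirectSum.coeLinearMap_lof _ _ _).symm
  simp only [LinearMap.comp_apply, Submodule.subtype_apply, LinearEquiv.coe_coe, this]
  exact DirectSum.component.lof_self Q _ _

/-- The differential `U_i → U_j`, set to be zero unless `i = j + 1`. -/
def dDeg (i j : ℕ) : D.dg.deg i →ₗ[Q] D.dg.deg j :=
  if h : j + 1 = i then D.dg.d.restrict fun _ hu => D.dg.d_mem (h ▸ hu) else 0

lemma coe_dDeg {i j : ℕ} (h : j + 1 = i) (u : D.dg.deg i) : (D.dDeg i j u : D.U) = D.dg.d u := by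
  rw [dDeg, dif_pos h]
  rfl

/-- The complex of `Q`-modules underlying `U`. -/
def complexQ : ChainComplex (ModuleCat.{u} Q) ℕ where
  X n := ModuleCat.of Q (D.dg.deg n)
  d i j := ModuleCat.ofHom (D.dDeg i j)
  shape i j hij := by
    rw [dDeg, dif_neg (by simpa using hij)]; rfl
  d_comp_d' i j k hij hjk := by
    simp only [ComplexShape.down_Rel] at hij hjk
    refine ModuleCat.hom_ext (LinearMap.ext fun u => Subtype.ext ?_)
    refine (D.coe_dDeg hjk (D.dDeg i j u)).trans ?_
    rw [D.coe_dDeg hij, D.dg.d_d]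
    rfl

/-- The augmentation `U → M` as a chain map. -/
def augQ : D.complexQ ⟶ (ChainComplex.single₀ (ModuleCat.{u} Q)).obj (ModuleCat.of Q M) :=
  (ChainComplex.toSingle₀Equiv _ _).symm ⟨ModuleCat.ofHom (D.ε ∘ₗ (D.dg.deg 0).subtype),
    ModuleCat.hom_ext (LinearMap.ext fun u =>
      (congrArg D.ε (D.coe_dDeg rfl u)).trans (D.ε_d _))⟩

lemma augQ_f_zero (u : D.dg.deg 0) : (D.augQ.f 0).hom u = D.ε u := by
  have : D.augQ.f 0 = ModuleCat.ofHom (D.ε ∘ₗ (D.dg.deg 0).subtype) :=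
    ChainComplex.toSingle₀Equiv_symm_apply_f_zero _ _
  rw [this]
  rfl

/-- Surjectivity of `ε` is given on all of $U$; since `ε` factors through the projection to $V_0$,
degree zero suffices. -/
lemma exists_mem_deg_zero (m : M) : ∃ u ∈ D.dg.deg 0, D.ε u = m := by
  obtain ⟨u, rfl⟩ := D.ε_surjective m
  exact ⟨D.incl 0 (D.proj 0 u), D.incl_mem rfl _, EisenbudLift.ε_eq D u⟩

lemma quasiIso_augQ : QuasiIso D.augQ := by
  refine quasiIso_of_exact _ ?_ ?_ ?_
  · intro m
    obtain ⟨u, hu, h⟩ := D.exists_mem_deg_zero m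
    exact ⟨⟨u, hu⟩, (D.augQ_f_zero _).trans h⟩
  · intro x hx
    obtain ⟨w, hw, h⟩ := D.exact_zero x.2 ((D.augQ_f_zero x).symm.trans hx)
    exact ⟨⟨w, hw⟩, Subtype.ext ((D.coe_dDeg rfl _).trans h)⟩
  · intro n x hx
    obtain ⟨w, hw, h⟩ := D.exact_succ x.2
      ((D.coe_dDeg rfl x).symm.trans (congrArg Subtype.val hx))
    exact ⟨⟨w, hw⟩, Subtype.ext ((D.coe_dDeg rfl _).trans h)⟩

/-- `U` as a projective resolution of `M` over `Q`. -/
def resolutionQ : ProjectiveResolution (ModuleCat.of Q M) where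
  complex := D.complexQ
  projective n := (IsProjective.iff_projective (R := Q) (D.dg.deg n)).1 inferInstance
  π := D.augQ
  quasiIso := D.quasiIso_augQ

/-! ### `V ⊗ R` is a resolution of `M` -/

-- The annihilator conditions of the exact pair, applied to each coordinate of a free module.
include hfg in
lemma exists_smul_eq_of_smul_eq_zero {j : ℤ} {v : D.V j} {m : ℕ}
    (h : (if Even m then f else g) • v = 0) : ∃ w : D.V j, (if Even m then g else f) • w = v := by
  have h' : ∀ δ, ∃ q, (if Even m then g else f) * q = v δ := by
    intro δ
    have hδ : (if Even m then f else g) * v δ = 0 := DFunLike.congr_fun h δ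
    split_ifs at hδ ⊢
    · obtain ⟨q, hq⟩ := Ideal.mem_span_singleton'.1 ((hfg.ann_left _).1 (by rwa [mul_comm]))
      exact ⟨q, by rw [mul_comm, hq]⟩
    · obtain ⟨q, hq⟩ := Ideal.mem_span_singleton'.1 ((hfg.ann_right _).1 (by rwa [mul_comm]))
      exact ⟨q, by rw [mul_comm, hq]⟩
  choose w hw using h'
  classical
  -- The chosen quotients need not have finite support, so they are replaced by zero wherever `v`
  -- vanishes.
  refine ⟨Finsupp.onFinset v.support (fun δ => if v δ = 0 then 0 else w δ) ?_, ?_⟩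
  · intro δ hδ
    rw [Finsupp.mem_support_iff]
    exact fun h0 => hδ (if_pos h0)
  · ext δ
    rw [Finsupp.smul_apply, Finsupp.onFinset_apply, smul_eq_mul]
    by_cases hv : v δ = 0
    · rw [if_pos hv, hv, mul_zero]
    · rw [if_neg hv, hw]

/-- If the coefficients of `y_i` in `u` vanish for `i < m + 1`, the one of `y_m` in `∂u` is the
one of `y_{m+1}` in `u`, multiplied by `f` or `g`. -/
lemma coord_d_of_coord_eq_zero {n m : ℕ} {u : D.U} (hu : u ∈ D.dg.deg n) {j : ℤ}
    (hj : j = n - (m + 1 : ℕ)) (h : ∀ i < m + 1, D.coord i (n - i) u = 0) :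
    D.coord m j (D.dg.d u) = (if Even m then f else g) • D.coord (m + 1) j u := by
  subst hj
  conv_lhs => rw [D.eq_sum_y_smul_incl hu]
  rw [map_sum, map_sum]
  have key : ∀ i ∈ Finset.range (n + 1), D.coord m (n - (m + 1 : ℕ)) (D.dg.d
      ((y i : TateAlg Q) • D.incl (n - i) (D.coord i (n - i) u))) =
      if i = m + 1 then (if Even m then f else g) • D.coord (m + 1) (n - (m + 1 : ℕ)) u else 0 := by
    intro i _
    by_cases hi : i = m + 1
    · rw [if_pos hi]
      subst hi
      rw [d_y_smul, d_y_succ, smul_assoc, map_add, map_zsmul,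
        D.coord_y_smul_of_lt _ (Nat.lt_succ_self m), smul_zero, add_zero, map_smul,
        coord_y_smul_self, coord_zero_incl]
    · rw [if_neg hi]
      rcases lt_or_gt_of_ne hi with hi | hi
      · rw [h i hi, map_zero, smul_zero, map_zero, map_zero]
      · obtain ⟨i, rfl⟩ : ∃ l, i = l + 1 := ⟨i - 1, by omega⟩
        rw [d_y_smul, d_y_succ, smul_assoc, map_add, map_zsmul,
          D.coord_y_smul_of_lt _ (show m < i + 1 by omega), smul_zero, add_zero, map_smul,
          D.coord_y_smul_of_lt _ (show m < i by omega), smul_zero]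
  rw [Finset.sum_congr rfl key, Finset.sum_ite_eq']
  by_cases hm : m + 1 ∈ Finset.range (n + 1)
  · rw [if_pos hm]
  · rw [if_neg hm]
    rw [Finset.mem_range] at hm
    have := D.V_subsingleton (i := (n : ℤ) - (m + 1 : ℕ)) (by push_cast; omega)
    exact Subsingleton.elim _ _

/-- The kernel of `U → V ⊗ R` is acyclic. -/
lemma exists_d_eq_of_coord_zero {n : ℕ} {u : D.U} (hu : u ∈ D.dg.deg n) (hd : D.dg.d u = 0)
    {v : D.V n} (hv : D.coord 0 n u = f • v) :
    ∃ w ∈ D.dg.deg (n + 1), D.dg.d w = u ∧ D.coord 0 (n + 1 : ℕ) w = 0 := by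
  -- Induction on the number `l` of coefficients still to be removed, `m` being the lowest index at
  -- which the coefficient may be nonzero. Divisibility by `f` is a hypothesis only at `m = 0`;
  -- afterwards it follows from `hd`.
  suffices h : ∀ l m, m + l = n + 1 → ∀ u ∈ D.dg.deg n, D.dg.d u = 0 →
      (∀ i < m, D.coord i (n - i) u = 0) → (m = 0 → ∃ v, D.coord 0 n u = f • v) →
      ∃ w ∈ D.dg.deg (n + 1), D.dg.d w = u ∧ D.coord 0 (n + 1 : ℕ) w = 0 from
    h (n + 1) 0 (by omega) u hu hd (fun i hi => absurd hi (by omega)) fun _ => ⟨v, hv⟩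
  intro l
  induction l with
  | zero =>
    intro m hm u hu _ h _
    refine ⟨0, zero_mem _, ?_, map_zero _⟩
    rw [map_zero, D.eq_sum_y_smul_incl hu]
    refine (Finset.sum_eq_zero fun i hi => ?_).symm
    rw [h i (by simpa [← hm] using hi), map_zero, smul_zero]
  | succ l ih =>
    intro m hm u hu hd h h0
    obtain ⟨w, hw⟩ : ∃ w : D.V (n - m), (if Even m then f else g) • w = D.coord m (n - m) u := by
      rcases m with _ | m
      · obtain ⟨v, hv⟩ := h0 rfl
        have : ∀ j : ℤ, j = n → ∃ w : D.V j, f • w = D.coord 0 j u := by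
          rintro _ rfl
          exact ⟨v, hv.symm⟩
        obtain ⟨w, hw⟩ := this (n - (0 : ℕ)) (by simp)
        exact ⟨w, by rw [if_pos Even.zero]; exact hw⟩
      · have := D.coord_d_of_coord_eq_zero hu rfl h
        rw [hd, map_zero] at this
        obtain ⟨w, hw⟩ := D.exists_smul_eq_of_smul_eq_zero this.symm
        refine ⟨w, ?_⟩
        rw [← hw]
        congr 1
        simp only [Nat.even_add_one]
        split_ifs <;> rfl
    have hmem : (y (m + 1) : TateAlg Q) • D.incl (n - m) w ∈ D.dg.deg (n + 1) :=
      D.y_smul_incl_mem (by push_cast; omega) _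
    have hdw : D.dg.d ((y (m + 1) : TateAlg Q) • D.incl (n - m) w) =
        (if Even m then f else g) • (y m : TateAlg Q) • D.incl (n - m) w +
          (-1 : ℤ) ^ (m + 1) • (y (m + 1) : TateAlg Q) • D.dg.d (D.incl (n - m) w) := by
      rw [d_y_smul, d_y_succ, smul_assoc]
    -- Subtracting $\partial(y_{m+1} w)$ cancels the coefficient of $y_m$ and leaves the lower ones
    -- zero. As $m + 1 > 0$, the primitive has no $y_0$ part.
    obtain ⟨w', hw', hdw', hc⟩ := ih (m + 1) (by omega)
      (u - D.dg.d ((y (m + 1) : TateAlg Q) • D.incl (n - m) w))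
      (sub_mem hu (D.dg.d_mem hmem)) (by rw [map_sub, hd, D.dg.d_d, sub_zero])
      (fun i hi => by
        rw [hdw, map_sub, map_add, map_zsmul, D.coord_y_smul_of_lt _ hi, smul_zero, add_zero,
          map_smul]
        rcases Nat.lt_succ_iff_lt_or_eq.1 hi with hi | rfl
        · rw [D.coord_y_smul_of_lt _ hi, smul_zero, sub_zero, h i hi]
        · rw [coord_y_smul_incl, hw, sub_self])
      (fun h => absurd h (by omega))
    refine ⟨w' + (y (m + 1) : TateAlg Q) • D.incl (n - m) w, add_mem hw' hmem, ?_, ?_⟩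
    · rw [map_add, hdw', sub_add_cancel]
    · rw [map_add, hc, D.coord_y_smul_of_lt _ (Nat.succ_pos m), add_zero]

lemma one_tmul_surjective {V : Type*} [AddCommGroup V] [Module Q V] :
    Function.Surjective fun v : V => (1 : RingR f) ⊗ₜ[Q] v := by
  intro x
  induction x with
  | zero => exact ⟨0, TensorProduct.tmul_zero _ _⟩
  | add x y hx hy =>
    obtain ⟨v, rfl⟩ := hx
    obtain ⟨w, rfl⟩ := hy
    exact ⟨v + w, TensorProduct.tmul_add _ _ _⟩
  | tmul r v =>
    obtain ⟨q, rfl⟩ := Ideal.Quotient.mk_surjective r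
    refine ⟨q • v, ?_⟩
    simp only [← TensorProduct.smul_tmul, Algebra.smul_def, mul_one, Ideal.Quotient.algebraMap_eq]

lemma one_tmul_eq_zero {V : Type*} [AddCommGroup V] [Module Q V] {v : V}
    (h : (1 : RingR f) ⊗ₜ[Q] v = 0) : ∃ w, v = f • w := by
  have h1 := congrArg (TensorProduct.quotTensorEquivQuotSMul V (Ideal.span {f})) h
  rw [map_zero] at h1
  have h2 : (Submodule.Quotient.mk v : V ⧸ (Ideal.span {f} • (⊤ : Submodule Q V))) = 0 := by
    rw [← h1]
    have := TensorProduct.quotTensorEquivQuotSMul_mk_tmul (Ideal.span {f}) (1 : Q) v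
    rw [one_smul] at this
    exact this.symm
  rw [Submodule.Quotient.mk_eq_zero, Submodule.ideal_span_singleton_smul,
    Submodule.mem_smul_pointwise_iff_exists] at h2
  obtain ⟨w, _, hw⟩ := h2
  exact ⟨w, hw.symm⟩

namespace EisenbudLift

variable {D} [Module (RingR f) M] [IsScalarTower Q (RingR f) M] (T : D.EisenbudLift)

lemma augR_f_zero (x : RingR f ⊗[Q] D.V 0) : (T.augR.f 0).hom x = T.augR₀ x := by
  have : T.augR.f 0 = ModuleCat.ofHom T.augR₀ :=
    ChainComplex.toSingle₀Equiv_symm_apply_f_zero _ _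
  rw [this]
  rfl

lemma augR₀_one_tmul (v : D.V 0) : T.augR₀ (1 ⊗ₜ v) = D.ε (D.incl 0 v) := by
  rw [augR₀, LinearMap.liftBaseChange_tmul, one_smul, LinearMap.comp_apply]

omit [Module (RingR f) M] [IsScalarTower Q (RingR f) M] in
lemma complexR_d (n : ℕ) (v : D.V (n + 1 : ℕ)) : (T.complexR.d (n + 1) n).hom
    ((1 : RingR f) ⊗ₜ[Q] v) = (1 : RingR f) ⊗ₜ[Q] D.dV (n + 1 : ℕ) n v := by
  have : T.complexR.d (n + 1) n = ModuleCat.ofHom ((D.dV (n + 1 : ℕ) n).baseChange (RingR f)) :=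
    congrArg ModuleCat.ofHom (if_pos (by push_cast; rfl))
  rw [this]
  rfl

-- The projection $U \to V \otimes R$ is a chain map: the correction term in `coord_zero_d` is a
-- multiple of $f$.
omit [Module (RingR f) M] [IsScalarTower Q (RingR f) M] in
lemma complexR_d_coord (hQ : ∀ n : ℕ, IsUnit ((n + 1 : ℕ) : Q)) {n : ℕ} {w : D.U}
    (hw : w ∈ D.dg.deg (n + 1)) :
    (T.complexR.d (n + 1) n).hom ((1 : RingR f) ⊗ₜ[Q] D.coord 0 (n + 1 : ℕ) w) =
      (1 : RingR f) ⊗ₜ[Q] D.coord 0 n (D.dg.d w) := by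
  rw [complexR_d, D.coord_zero_d hQ hw n (by push_cast; ring), TensorProduct.tmul_add,
    ← TensorProduct.smul_tmul, Algebra.smul_def, Ideal.Quotient.algebraMap_eq,
    Ideal.Quotient.eq_zero_iff_mem.2 (Ideal.mem_span_singleton_self f), zero_mul,
    TensorProduct.zero_tmul, add_zero]

/-- `V ⊗ R` is a resolution of `M` over `R`. -/
lemma quasiIso_augR (hQ : ∀ n : ℕ, IsUnit ((n + 1 : ℕ) : Q)) : QuasiIso T.augR := by
  refine quasiIso_of_exact _ ?_ ?_ ?_
  · intro m
    obtain ⟨u, hu⟩ := D.ε_surjective m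
    refine ⟨(1 : RingR f) ⊗ₜ[Q] D.proj 0 u, (T.augR_f_zero _).trans ?_⟩
    rw [augR₀_one_tmul, ε_eq, hu]
  · intro x hx
    obtain ⟨v, rfl⟩ := one_tmul_surjective (Q := Q) (f := f) (V := D.V 0) x
    have hv : D.ε (D.incl 0 v) = 0 := by
      rw [← T.augR₀_one_tmul, ← T.augR_f_zero]; exact hx
    obtain ⟨w, hw, h⟩ := D.exact_zero (D.incl_mem rfl v) hv
    refine ⟨(1 : RingR f) ⊗ₜ[Q] (D.coord 0 (1 : ℕ) w : D.V (1 : ℕ)),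
      (T.complexR_d_coord hQ hw).trans ?_⟩
    rw [h]
    exact congrArg (fun v => (1 : RingR f) ⊗ₜ[Q] v) (D.coord_zero_incl 0 v)
  · intro n x hx
    obtain ⟨v, rfl⟩ := one_tmul_surjective (Q := Q) (f := f) (V := D.V (n + 1 : ℕ)) x
    obtain ⟨v', hv'⟩ := one_tmul_eq_zero ((T.complexR_d n v).symm.trans hx)
    have hmem := D.incl_mem (n := n + 1) rfl v
    -- A cycle of $V \otimes R$ lifts to $v$ with $\partial v$ in the acyclic kernel. So $\partial v
    -- = \partial k$ with $k$ having no $y_0$ part, and $v - k$ is a cycle of $U$ with the same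
    -- image, hence a boundary.
    obtain ⟨k, hk, hdk, hk0⟩ := D.exists_d_eq_of_coord_zero (D.dg.d_mem hmem) (D.dg.d_d _) hv'
    obtain ⟨w, hw, h⟩ := D.exact_succ (sub_mem hmem hk) (by rw [map_sub, hdk, sub_self])
    refine ⟨(1 : RingR f) ⊗ₜ[Q] (D.coord 0 (n + 1 + 1 : ℕ) w : D.V (n + 1 + 1 : ℕ)),
      (T.complexR_d_coord hQ hw).trans ?_⟩
    rw [h, map_sub, hk0, coord_zero_incl, sub_zero]

end EisenbudLift

end DGResolution

/-! ### Existence of dg resolutions -/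

namespace TateAlg

variable {Q : Type*} [CommRing Q]

/-- The `Q`-linear map with `y_i ↦ (-1)^i y_i`. -/
def sign : TateAlg Q →ₗ[Q] TateAlg Q := basis.constr Q fun i => (-1 : ℤ) ^ i • y i

lemma sign_y (i : ℕ) : sign (y i : TateAlg Q) = (-1 : ℤ) ^ i • y i := by
  rw [sign, ← basis_apply, Module.Basis.constr_basis, basis_apply]

lemma coeff_zero_y_succ_mul (i : ℕ) (a : TateAlg Q) : coeff 0 (y (i + 1) * a) = 0 := by
  induction a using induction with
  | hy j => rw [y_mul_y, map_smul, coeff_y, if_neg (by omega), smul_zero]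
  | add a b ha hb => rw [mul_add, map_add, ha, hb, add_zero]
  | smul q a ha => rw [mul_smul_comm, map_smul, ha, smul_zero]

end TateAlg

open TateAlg

/-! ### Semifree differentials over the Tate algebra -/

section Semifree

variable {Q Δ : Type*} [CommRing Q] (f g : Q) (b : Δ → Δ →₀ TateAlg Q)

/-- The differential on the free `Q⟨y, t⟩`-module on `Δ` with given values on the basis. -/
def freeD : (Δ →₀ TateAlg Q) →ₗ[Q] (Δ →₀ TateAlg Q) :=
  -- The Leibniz rule on $a e_\delta$, with `sign` supplying $(-1)^{\deg a}$; because of this sign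
  -- the map is only $Q$-linear.
  Finsupp.lsum Q fun δ => Finsupp.lsingle δ ∘ₗ TateAlg.d f g +
    (LinearMap.toSpanSingleton (TateAlg Q) (Δ →₀ TateAlg Q) (b δ)).restrictScalars Q ∘ₗ sign

lemma freeD_single (δ : Δ) (a : TateAlg Q) :
    freeD f g b (Finsupp.single δ a) = Finsupp.single δ (TateAlg.d f g a) + sign a • b δ := by
  rw [freeD, Finsupp.lsum_single]
  rfl

lemma free_induction {p : (Δ →₀ TateAlg Q) → Prop} (u : Δ →₀ TateAlg Q)
    (zero : p 0) (single : ∀ i δ, p (Finsupp.single δ (y i)))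
    (add : ∀ u v, p u → p v → p (u + v)) (smul : ∀ (q : Q) u, p u → p (q • u)) : p u := by
  induction u using Finsupp.induction_linear with
  | zero => exact zero
  | add u v hu hv => exact add _ _ hu hv
  | single δ a =>
    induction a using TateAlg.induction with
    | hy i => exact single i δ
    | add a b ha hb => rw [Finsupp.single_add]; exact add _ _ ha hb
    | smul q a ha => rw [← Finsupp.smul_single]; exact smul _ _ ha

lemma freeD_leibniz (i : ℕ) (u : Δ →₀ TateAlg Q) :
    freeD f g b ((y i : TateAlg Q) • u) =
      TateAlg.d f g (y i) • u + (-1 : ℤ) ^ i • ((y i : TateAlg Q) • freeD f g b u) := by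
  induction u using free_induction with
  | zero => simp
  | single l δ =>
    have hs : sign (y i * y l : TateAlg Q) = (-1 : ℤ) ^ i • (y i * sign (y l)) := by
      rw [y_mul_y, map_smul, sign_y, sign_y, mul_smul_comm, y_mul_y, smul_smul, ← pow_add,
        smul_comm]
    rw [Finsupp.smul_single, smul_eq_mul, freeD_single, freeD_single, leibniz_y, hs,
      Finsupp.single_add, smul_add, smul_add, Finsupp.smul_single, Finsupp.smul_single,
      ← add_assoc, smul_eq_mul, smul_eq_mul, smul_assoc, mul_smul, Finsupp.smul_single]
    congr 3
    simp [zsmul_eq_mul]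
  | add u v hu hv => simp only [smul_add, map_add, hu, hv]; abel
  | smul q u hu =>
    rw [smul_comm, map_smul, hu, map_smul, smul_add, smul_comm q (TateAlg.d f g (y i)) u,
      smul_comm q ((-1 : ℤ) ^ i), smul_comm q (y i : TateAlg Q)]

variable {f g b}

/-- It suffices to test $y_i e_\delta$: by the Leibniz rule the two mixed terms cancel by sign, and
the others vanish by $\partial^2 = 0$ on $A$ and by `hb`. -/
lemma freeD_freeD (hfg : f * g = 0) (hb : ∀ δ, freeD f g b (b δ) = 0) (u : Δ →₀ TateAlg Q) :
    freeD f g b (freeD f g b u) = 0 := by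
  induction u using free_induction with
  | zero => simp
  | single i δ =>
    rw [freeD_single, map_add, sign_y, smul_assoc, map_zsmul, freeD_leibniz, hb, smul_zero,
      smul_zero, add_zero]
    rcases i with _ | i
    · simp [d_y_zero]
    · have h := TateAlg.d_d hfg (y (i + 1))
      rw [d_y_succ, map_smul] at h
      rw [d_y_succ, ← Finsupp.smul_single, map_smul, freeD_single, smul_add, Finsupp.smul_single,
        h, Finsupp.single_zero, zero_add, sign_y, smul_assoc, smul_assoc, pow_succ, smul_comm,
        mul_neg_one,
        neg_smul, add_neg_cancel]
  | add u v hu hv => rw [map_add, map_add, hu, hv, add_zero]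
  | smul q u hu => rw [map_smul, map_smul, hu, smul_zero]

end Semifree

/-! ### Killing all cycles at once -/

/-- The basis of the dg resolution obtained by killing all cycles: elements `m` of `M`, in degree
zero, and formal combinations `∑ c_j y_{i_j} t_j`, to be killed by a basis element of degree
`n + 1` if they are cycles of degree `n`. -/
inductive KillingTree (Q M : Type u) : Type u
  | leaf (m : M)
  | node (n k : ℕ) (c : Fin k → Q) (i : Fin k → ℕ) (t : Fin k → KillingTree Q M)

namespace KillingTree

variable {Q M : Type u} [CommRing Q] [AddCommGroup M] [Module Q M]

def deg : KillingTree Q M → ℕ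
  | leaf _ => 0
  | node n _ _ _ _ => n + 1

/-- The augmentation of a tree. -/
def value : KillingTree Q M → M
  | leaf m => m
  | node _ _ _ _ _ => 0

variable (M) in
/-- The augmentation. -/
def aug : (KillingTree Q M →₀ TateAlg Q) →ₗ[Q] M :=
  Finsupp.lsum Q fun t => (coeff 0).smulRight (value t)

lemma aug_single (t : KillingTree Q M) (a : TateAlg Q) :
    aug M (Finsupp.single t a) = coeff 0 a • value t := by
  rw [aug, Finsupp.lsum_single]
  rfl

lemma aug_y_succ_smul (i : ℕ) (u : KillingTree Q M →₀ TateAlg Q) :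
    aug M ((y (i + 1) : TateAlg Q) • u) = 0 := by
  induction u using Finsupp.induction_linear with
  | zero => simp
  | add u v hu hv => rw [smul_add, map_add, hu, hv, add_zero]
  | single t a =>
    rw [Finsupp.smul_single, aug_single, smul_eq_mul, coeff_zero_y_succ_mul, zero_smul]

variable (f g : Q)

open Classical in
/-- The differential on basis elements. -/
def bdry : KillingTree Q M → (KillingTree Q M →₀ TateAlg Q)
  | leaf _ => 0
  | node n _ c i t =>
    -- The second condition is `freeD` of the combination, written out so that the recursion only
    -- calls subtrees. Combinations that fail a condition receive boundary zero; the superfluous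
    -- generators do no harm, since the cycles they create are killed as well.
    if (∀ j, i j + deg (t j) = n) ∧
      (∑ j, c j • (Finsupp.single (t j) (TateAlg.d f g (y (i j))) +
        sign (y (i j) : TateAlg Q) • bdry (t j)) = 0) ∧
      (n = 0 → aug M (∑ j, c j • Finsupp.single (t j) (y (i j) : TateAlg Q)) = 0)
    then ∑ j, c j • Finsupp.single (t j) (y (i j)) else 0

lemma bdry_node {n k : ℕ} {c : Fin k → Q} {i : Fin k → ℕ} {t : Fin k → KillingTree Q M}
    (hdeg : ∀ j, i j + deg (t j) = n)
    (hd : freeD f g (bdry f g) (∑ j, c j • Finsupp.single (t j) (y (i j) : TateAlg Q)) = 0)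
    (haug : n = 0 → aug M (∑ j, c j • Finsupp.single (t j) (y (i j) : TateAlg Q)) = 0) :
    bdry f g (node n k c i t) = ∑ j, c j • Finsupp.single (t j) (y (i j)) := by
  rw [bdry, if_pos]
  refine ⟨hdeg, ?_, haug⟩
  simpa only [map_sum, map_smul, freeD_single] using hd

lemma bdry_cases (t : KillingTree Q M) : bdry f g t = 0 ∨
    ∃ n k, ∃ (c : Fin k → Q) (i : Fin k → ℕ) (s : Fin k → KillingTree Q M),
      t.deg = n + 1 ∧ bdry f g t = ∑ j, c j • Finsupp.single (s j) (y (i j)) ∧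
      (∀ j, i j + deg (s j) = n) ∧ freeD f g (bdry f g) (bdry f g t) = 0 ∧
      (n = 0 → aug M (bdry f g t) = 0) := by
  cases t with
  | leaf m => exact Or.inl (by rw [bdry])
  | node n k c i s =>
    by_cases h : (∀ j, i j + deg (s j) = n) ∧
      (∑ j, c j • (Finsupp.single (s j) (TateAlg.d f g (y (i j))) +
        sign (y (i j) : TateAlg Q) • bdry f g (s j)) = 0) ∧
      (n = 0 → aug M (∑ j, c j • Finsupp.single (s j) (y (i j) : TateAlg Q)) = 0)
    · have hb : bdry f g (node n k c i s) = ∑ j, c j • Finsupp.single (s j) (y (i j)) := by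
        rw [bdry, if_pos h]
      refine Or.inr ⟨n, k, c, i, s, rfl, hb, h.1, ?_, ?_⟩
      · rw [hb]
        simpa only [map_sum, map_smul, freeD_single] using h.2.1
      · rw [hb]
        exact h.2.2
    · exact Or.inl (by rw [bdry, if_neg h])

lemma freeD_bdry (t : KillingTree Q M) : freeD f g (bdry f g) (bdry f g t) = 0 := by
  rcases bdry_cases f g t with h | ⟨n, k, c, i, s, _, _, _, h, _⟩
  · rw [h, map_zero]
  · exact h

variable (Q M) in
/-- The `Q`-basis `y_i e_t`. -/
def qBasis : Module.Basis (ℕ × KillingTree Q M) Q (KillingTree Q M →₀ TateAlg Q) :=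
  TateAlg.basis.smulTower Finsupp.basisSingleOne

omit [AddCommGroup M] [Module Q M] in
lemma qBasis_apply (p : ℕ × KillingTree Q M) : qBasis Q M p = Finsupp.single p.2 (y p.1) := by
  rw [qBasis, Module.Basis.smulTower_apply, Finsupp.coe_basisSingleOne, Finsupp.smul_single,
    smul_eq_mul, mul_one, basis_apply]

variable (Q M) in
/-- The component of degree `n`. -/
def degSubmodule (n : ℕ) : Submodule Q (KillingTree Q M →₀ TateAlg Q) :=
  Submodule.span Q (qBasis Q M '' {p | p.1 + p.2.deg = n})

omit [AddCommGroup M] [Module Q M] in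
lemma single_mem {i n : ℕ} {t : KillingTree Q M} (h : i + t.deg = n) :
    Finsupp.single t (y i) ∈ degSubmodule Q M n :=
  Submodule.subset_span ⟨(i, t), h, qBasis_apply _⟩

omit [AddCommGroup M] [Module Q M] in
lemma degSubmodule_le {n : ℕ} {S : Submodule Q (KillingTree Q M →₀ TateAlg Q)}
    (h : ∀ i t, i + t.deg = n → Finsupp.single t (y i) ∈ S) : degSubmodule Q M n ≤ S := by
  rw [degSubmodule, Submodule.span_le]
  rintro _ ⟨⟨i, t⟩, hp, rfl⟩
  rw [qBasis_apply]
  exact h i t hp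

omit [AddCommGroup M] [Module Q M] in
lemma smul_mem {i j : ℕ} {a : TateAlg Q} {u : KillingTree Q M →₀ TateAlg Q}
    (ha : a ∈ TateAlg.deg i) (hu : u ∈ degSubmodule Q M j) : a • u ∈ degSubmodule Q M (i + j) := by
  obtain ⟨q, rfl⟩ := TateAlg.mem_deg.1 ha
  refine degSubmodule_le (S := (degSubmodule Q M (i + j)).comap
    (Algebra.lsmul Q Q (KillingTree Q M →₀ TateAlg Q) (q • y i))) (fun l t h => ?_) hu
  change (q • y i : TateAlg Q) • Finsupp.single t (y l : TateAlg Q) ∈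
    degSubmodule Q M (i + j)
  rw [Finsupp.smul_single, smul_eq_mul, smul_mul_assoc, y_mul_y]
  rw [← Finsupp.smul_single, ← Finsupp.smul_single]
  exact Submodule.smul_mem _ _ (Submodule.smul_mem _ _ (single_mem (by rw [add_assoc, h])))

lemma bdry_mem {n : ℕ} {t : KillingTree Q M} (ht : t.deg = n + 1) :
    bdry f g t ∈ degSubmodule Q M n := by
  rcases bdry_cases f g t with h | ⟨n', k, c, i, s, hn, h, hs, _⟩
  · rw [h]; exact zero_mem _
  · rw [h]
    exact sum_mem fun j _ => Submodule.smul_mem _ _ (single_mem (by have := hs j; omega))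

lemma bdry_of_deg_zero {t : KillingTree Q M} (ht : t.deg = 0) : bdry f g t = 0 := by
  rcases bdry_cases f g t with h | ⟨n', k, c, i, s, hn, _⟩
  · exact h
  · omega

lemma freeD_zero {u : KillingTree Q M →₀ TateAlg Q} (hu : u ∈ degSubmodule Q M 0) :
    freeD f g (bdry f g) u = 0 := by
  refine degSubmodule_le (S := LinearMap.ker (freeD f g (bdry f g))) (fun i t h => ?_) hu
  obtain rfl : i = 0 := by omega
  rw [LinearMap.mem_ker, freeD_single, d_y_zero, bdry_of_deg_zero f g (by omega)]
  simp

lemma freeD_mem {n : ℕ} {u : KillingTree Q M →₀ TateAlg Q} (hu : u ∈ degSubmodule Q M (n + 1)) :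
    freeD f g (bdry f g) u ∈ degSubmodule Q M n := by
  refine degSubmodule_le (S := (degSubmodule Q M n).comap (freeD f g (bdry f g)))
    (fun i t h => ?_) hu
  rw [Submodule.mem_comap, freeD_single]
  refine add_mem ?_ ?_
  · rcases i with _ | i
    · rw [d_y_zero, Finsupp.single_zero]; exact zero_mem _
    · rw [d_y_succ, ← Finsupp.smul_single]
      exact Submodule.smul_mem _ _ (single_mem (by omega))
  · rw [sign_y, smul_assoc]
    refine zsmul_mem ?_ _
    rcases ht : t.deg with _ | m
    · rw [bdry_of_deg_zero f g ht, smul_zero]; exact zero_mem _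
    · obtain rfl : n = i + m := by omega
      exact smul_mem (y_mem_deg i) (bdry_mem f g ht)

lemma aug_of_mem {n : ℕ} {u : KillingTree Q M →₀ TateAlg Q} (hu : u ∈ degSubmodule Q M (n + 1)) :
    aug M u = 0 := by
  refine degSubmodule_le (S := LinearMap.ker (aug M)) (fun i t h => ?_) hu
  rw [LinearMap.mem_ker, aug_single, coeff_y]
  cases t with
  | leaf m => rw [if_neg (by simp only [deg] at h; omega), zero_smul]
  | node => rw [value, smul_zero]

lemma aug_freeD (hM : ∀ m : M, f • m = 0) (u : KillingTree Q M →₀ TateAlg Q) :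
    aug M (freeD f g (bdry f g) u) = 0 := by
  induction u using free_induction with
  | zero => simp
  | single i t =>
    rw [freeD_single, map_add, sign_y, smul_assoc, map_zsmul, aug_single]
    match i with
    | 0 =>
      rw [d_y_zero, map_zero, zero_smul, zero_add, ← one_def, one_smul, pow_zero, one_smul]
      rcases bdry_cases f g t with h | ⟨n, k, c, i, s, hn, _, _, _, h⟩
      · rw [h, map_zero]
      · rcases n with _ | n
        · exact h rfl
        · exact aug_of_mem (bdry_mem f g hn)
    -- The only place where $fM = 0$ is needed: $\partial y_1 = f y_0$ must be killed by the
    -- augmentation.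
    | 1 =>
      rw [aug_y_succ_smul, d_y_succ, if_pos (by simp), map_smul, coeff_y, if_pos rfl]
      simp [hM]
    | i + 2 =>
      rw [aug_y_succ_smul, d_y_succ, map_smul, coeff_y, if_neg (Nat.succ_ne_zero i)]
      simp
  | add u v hu hv => rw [map_add, map_add, hu, hv, add_zero]
  | smul q u hu => rw [map_smul, map_smul, hu, smul_zero]

/-- Any element of degree `n` is a finite combination of generators; if it is a cycle, the `node`
recording this combination is a basis element whose boundary it is. -/
lemma exists_freeD_eq {n : ℕ} {u : KillingTree Q M →₀ TateAlg Q} (hu : u ∈ degSubmodule Q M n)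
    (hd : freeD f g (bdry f g) u = 0) (haug : n = 0 → aug M u = 0) :
    ∃ w ∈ degSubmodule Q M (n + 1), freeD f g (bdry f g) w = u := by
  obtain ⟨k, c, b, hb⟩ := Submodule.mem_span_set'.1 hu
  choose p hp hpb using fun j => (b j).2
  have hsum : ∑ j, c j • Finsupp.single (p j).2 (y (p j).1) = u := by
    rw [← hb]
    exact Finset.sum_congr rfl fun j _ => by rw [← hpb, qBasis_apply]
  refine ⟨Finsupp.single (node n k c (fun j => (p j).1) (fun j => (p j).2)) (y 0),
    single_mem (by rw [deg, zero_add]), ?_⟩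
  rw [freeD_single, d_y_zero, bdry_node f g hp (by rwa [hsum]) (by rwa [hsum]), hsum, sign_y,
    pow_zero, one_smul, ← one_def, one_smul, Finsupp.single_zero, zero_add]

end KillingTree

open KillingTree in
/-- Every module annihilated by `f` has a dg resolution over the Tate resolution. -/
lemma nonempty_dgResolution {Q : Type u} [CommRing Q] {f g : Q} (hfg : IsExactPair f g)
    (M : Type u) [AddCommGroup M] [Module Q M] (hM : ∀ m : M, f • m = 0) :
    Nonempty (DGResolution hfg M) :=
  ⟨{U := KillingTree Q M →₀ TateAlg Q
    dg :=
    { deg := degSubmodule Q M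
      isInternal := isInternal_span_image (qBasis Q M) fun p => p.1 + p.2.deg
      smul_mem := KillingTree.smul_mem
      d := freeD f g (bdry f g)
      d_zero := freeD_zero f g
      d_mem := freeD_mem f g
      d_d := freeD_freeD hfg.mul_eq_zero (freeD_bdry f g)
      leibniz := by
        intro i a u ha
        obtain ⟨q, rfl⟩ := TateAlg.mem_deg.1 ha
        change _ = TateAlg.d f g (q • y i) • u + _
        rw [smul_assoc, map_smul, freeD_leibniz, map_smul, smul_assoc, smul_assoc, smul_add,
          smul_comm q ((-1 : ℤ) ^ i)] }
    Δ := KillingTree Q M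
    e := Finsupp.basisSingleOne
    deg := KillingTree.deg
    e_mem := fun t => by
      rw [Finsupp.coe_basisSingleOne]
      exact single_mem (zero_add _)
    ε := aug M
    ε_pos := aug_of_mem
    ε_d := aug_freeD f g hM
    ε_surjective := fun m => ⟨Finsupp.single (leaf m) (y 0), by
      rw [aug_single, coeff_y, if_pos rfl, one_smul, value]⟩
    exact_zero := fun hu h => exists_freeD_eq f g hu (freeD_zero f g hu) fun _ => h
    exact_succ := fun hu h => exists_freeD_eq f g hu h fun h0 => absurd h0 (by omega) }⟩

/-! ### Split sequences under additive functors -/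

/-- A degreewise split short exact sequence `0 → X[k] → Y → Z → 0` of complexes, with its
splittings. -/
structure ShiftedSplitting {C : Type*} [Category* C] [Preadditive C] (k : ℕ)
    (X Y Z : ChainComplex C ℕ) where
  i : ∀ n, X.X n ⟶ Y.X (n + k)
  r : ∀ n, Y.X (n + k) ⟶ X.X n
  p : Y ⟶ Z
  s : ∀ n, Z.X n ⟶ Y.X n
  θ : ∀ n, Z.X (n + 1 + k) ⟶ X.X n
  σ : ℤˣ
  i_r : ∀ n, i n ≫ r n = 𝟙 _
  i_p : ∀ n, i n ≫ p.f (n + k) = 0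
  decomp : ∀ n, r n ≫ i n + p.f (n + k) ≫ s (n + k) = 𝟙 _
  s_p : ∀ n, s n ≫ p.f n = 𝟙 _
  p_s : ∀ n < k, p.f n ≫ s n = 𝟙 _
  d_i : ∀ n, X.d (n + 1) n ≫ i n = (σ : ℤ) • (i (n + 1) ≫ Y.d (n + 1 + k) (n + k))
  s_d : ∀ n, s (n + 1 + k) ≫ Y.d (n + 1 + k) (n + k) =
    Z.d (n + 1 + k) (n + k) ≫ s (n + k) + θ n ≫ i n

namespace ShiftedSplitting

/-- The image of a split sequence under an additive functor. -/
def map {C C' : Type*} [Category* C] [Preadditive C] [Category* C'] [Preadditive C'] {k : ℕ}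
    {X Y Z : ChainComplex C ℕ} (E : ShiftedSplitting k X Y Z) (F : C ⥤ C') [F.Additive] :
    ShiftedSplitting k ((F.mapHomologicalComplex _).obj X) ((F.mapHomologicalComplex _).obj Y)
      ((F.mapHomologicalComplex _).obj Z) where
  i n := F.map (E.i n)
  r n := F.map (E.r n)
  p := (F.mapHomologicalComplex _).map E.p
  s n := F.map (E.s n)
  θ n := F.map (E.θ n)
  σ := E.σ
  i_r n := (F.map_comp _ _).symm.trans ((congrArg F.map (E.i_r n)).trans (F.map_id _))
  i_p n := (F.map_comp _ _).symm.trans ((congrArg F.map (E.i_p n)).trans (F.map_zero _ _))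
  decomp n := (congrArg₂ (· + ·) (F.map_comp _ _).symm (F.map_comp _ _).symm).trans
    (F.map_add.symm.trans ((congrArg F.map (E.decomp n)).trans (F.map_id _)))
  s_p n := (F.map_comp _ _).symm.trans ((congrArg F.map (E.s_p n)).trans (F.map_id _))
  p_s n hn := (F.map_comp _ _).symm.trans ((congrArg F.map (E.p_s n hn)).trans (F.map_id _))
  d_i n := (F.map_comp _ _).symm.trans ((congrArg F.map (E.d_i n)).trans
    (F.map_zsmul.trans (congrArg _ (F.map_comp _ _))))
  s_d n := (F.map_comp _ _).symm.trans ((congrArg F.map (E.s_d n)).trans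
    (F.map_add.trans (congrArg₂ (· + ·) (F.map_comp _ _) (F.map_comp _ _))))

/-- The shifted extension given by a split sequence. -/
def toShiftedExtension {A : Type u} [CommRing A] {k : ℕ}
    {X Y Z : ChainComplex (ModuleCat.{u} A) ℕ} (E : ShiftedSplitting k X Y Z) :
    ShiftedExtension k X Y Z where
  i n := (E.i n).hom
  p := E.p
  s n := (E.s n).hom
  θ n := (E.θ n).hom
  σ := E.σ
  i_injective n := Function.LeftInverse.injective (g := (E.r n).hom) fun x =>
    congrArg (fun φ => ModuleCat.Hom.hom φ x) (E.i_r n)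
  exact n y := by
    constructor
    · intro h
      refine ⟨(E.r n).hom y, ?_⟩
      have h' : (E.i n).hom ((E.r n).hom y) + (E.s (n + k)).hom ((E.p.f (n + k)).hom y) = y :=
        congrArg (fun φ => ModuleCat.Hom.hom φ y) (E.decomp n)
      rwa [h, map_zero, add_zero] at h'
    · rintro ⟨x, rfl⟩
      exact congrArg (fun φ => ModuleCat.Hom.hom φ x) (E.i_p n)
  p_injective n hn := Function.LeftInverse.injective (g := (E.s n).hom) fun x =>
    congrArg (fun φ => ModuleCat.Hom.hom φ x) (E.p_s n hn)
  p_s n z := congrArg (fun φ => ModuleCat.Hom.hom φ z) (E.s_p n)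
  i_d n x := congrArg (fun φ => ModuleCat.Hom.hom φ x) (E.d_i n)
  d_s n z := congrArg (fun φ => ModuleCat.Hom.hom φ z) (E.s_d n)

end ShiftedSplitting

/-! ### The mapping cone as an extension of `V ⊗ S` by its shift -/

namespace DGResolution

variable {Q : Type u} [CommRing Q] {f g : Q} {hfg : IsExactPair f g}
  {M : Type u} [AddCommGroup M] [Module Q M] {D : DGResolution hfg M}

variable (D) in
/-- The identification of `V_i` and `V_j` for `i = j`. -/
def castV {i j : ℤ} (h : i = j) : D.V i ≃ₗ[Q] D.V j := h ▸ LinearEquiv.refl Q (D.V i)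

namespace EisenbudLift

variable (T : D.EisenbudLift)

/-- The inclusion of the first summand of `W`. -/
def inlW (n : ℕ) : T.complexS.X n ⟶ T.W.X (n + 1) :=
  ModuleCat.ofHom (LinearMap.inl (RingS f g) _ _ ∘ₗ
    (D.castV (i := n) (j := (n + 1 : ℕ) - 1) (by simp)).toLinearMap.baseChange (RingS f g))

/-- The projection to the first summand of `W`. -/
def fstW (n : ℕ) : T.W.X (n + 1) ⟶ T.complexS.X n :=
  ModuleCat.ofHom ((D.castV (i := n) (j := (n + 1 : ℕ) - 1)
    (by simp)).symm.toLinearMap.baseChange (RingS f g) ∘ₗ LinearMap.fst (RingS f g) _ _)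

/-- The inclusion of the second summand of `W`. -/
def inrW (n : ℕ) : T.complexS.X n ⟶ T.W.X n := ModuleCat.ofHom (LinearMap.inr (RingS f g) _ _)

lemma W_d {i j : ℕ} (h : j + 1 = i) : T.W.d i j = ModuleCat.ofHom (T.dW i j) :=
  congrArg ModuleCat.ofHom (if_pos h)

lemma complexS_d {i j : ℕ} (h : j + 1 = i) : T.complexS.d i j = ModuleCat.ofHom (T.dS i j) :=
  congrArg ModuleCat.ofHom (if_pos h)

/-- The projection to the second summand, as a chain map. -/
def sndW : T.W ⟶ T.complexS where
  f n := ModuleCat.ofHom (LinearMap.snd (RingS f g) _ _)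
  comm' i j hij := by
    rw [T.W_d hij, T.complexS_d hij]
    rfl

lemma inlW_fstW (n : ℕ) : T.inlW n ≫ T.fstW n = 𝟙 _ := by
  have key : (D.castV (i := n) (j := (n + 1 : ℕ) - 1) (by simp)).symm.toLinearMap.baseChange
      (RingS f g) ∘ₗ (D.castV (by simp)).toLinearMap.baseChange (RingS f g) = LinearMap.id := by
    rw [← LinearMap.baseChange_comp]
    simp
  exact ModuleCat.hom_ext (LinearMap.ext fun x => LinearMap.congr_fun key x)

lemma fstW_inlW (n : ℕ) : T.fstW n ≫ T.inlW n + T.sndW.f (n + 1) ≫ T.inrW (n + 1) = 𝟙 _ := by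
  have key : (D.castV (i := n) (j := (n + 1 : ℕ) - 1) (by simp)).toLinearMap.baseChange
      (RingS f g) ∘ₗ (D.castV (by simp)).symm.toLinearMap.baseChange (RingS f g) =
        LinearMap.id := by
    rw [← LinearMap.baseChange_comp]
    simp
  refine ModuleCat.hom_ext (LinearMap.ext fun ⟨x, a⟩ => Prod.ext ?_ ?_)
  · exact (add_zero _).trans (LinearMap.congr_fun key x)
  · exact zero_add _

/-- In degree zero the first summand of the cone is built on $V_{-1} = 0$. -/
lemma sndW_inrW_zero : T.sndW.f 0 ≫ T.inrW 0 = 𝟙 _ := by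
  refine ModuleCat.hom_ext (LinearMap.ext fun ⟨x, a⟩ => Prod.ext ?_ rfl)
  have := D.V_subsingleton (i := ((0 : ℕ) : ℤ) - 1) (by simp)
  have h : Subsingleton (RingS f g ⊗[Q] D.V (((0 : ℕ) : ℤ) - 1)) := inferInstance
  exact h.elim _ _

lemma castV_dV {i i' j j' : ℤ} (hi : i = i') (hj : j = j') (v : D.V i) :
    D.dV i' j' (D.castV hi v) = D.castV hj (D.dV i j v) := by
  subst hi hj
  rfl

lemma castV_τ {i j j' : ℤ} (hj : j = j') (v : D.V i) :
    T.τ i j' v = D.castV hj (T.τ i j v) := by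
  subst hj
  rfl

lemma d_inlW (n : ℕ) : T.complexS.d (n + 1) n ≫ T.inlW n =
    -(T.inlW (n + 1) ≫ T.W.d (n + 1 + 1) (n + 1)) := by
  rw [T.W_d rfl, T.complexS_d rfl]
  refine ModuleCat.hom_ext (LinearMap.ext fun x => ?_)
  have key : (D.castV (i := n) (j := (n + 1 : ℕ) - 1) (by simp)).toLinearMap.baseChange
        (RingS f g) ∘ₗ T.dS (n + 1 : ℕ) n =
      T.dS ((n + 1 + 1 : ℕ) - 1) ((n + 1 : ℕ) - 1) ∘ₗ (D.castV (i := (n + 1 : ℕ))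
        (j := (n + 1 + 1 : ℕ) - 1) (by simp)).toLinearMap.baseChange (RingS f g) := by
    rw [← LinearMap.baseChange_comp, ← LinearMap.baseChange_comp]
    congr 1
    exact LinearMap.ext fun v => (castV_dV _ _ v).symm
  refine Prod.ext ?_ ?_
  · refine (LinearMap.congr_fun key x).trans ?_
    change _ = -(-(_) - T.τS (n + 1 + 1 : ℕ) ((n + 1 : ℕ) - 1) 0)
    rw [map_zero, sub_zero, neg_neg]
    rfl
  · change 0 = -(T.dS (n + 1 + 1 : ℕ) (n + 1 : ℕ) 0)
    rw [map_zero, neg_zero]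

lemma inrW_d (n : ℕ) : T.inrW (n + 1 + 1) ≫ T.W.d (n + 1 + 1) (n + 1) =
    T.complexS.d (n + 1 + 1) (n + 1) ≫ T.inrW (n + 1) - T.τHom (n + 1 + 1) n ≫ T.inlW n := by
  rw [T.W_d rfl, T.complexS_d rfl, τHom, if_pos rfl]
  refine ModuleCat.hom_ext (LinearMap.ext fun x => ?_)
  have key : (D.castV (i := n) (j := (n + 1 : ℕ) - 1) (by simp)).toLinearMap.baseChange
        (RingS f g) ∘ₗ T.τS (n + 1 + 1 : ℕ) n = T.τS (n + 1 + 1 : ℕ) ((n + 1 : ℕ) - 1) := by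
    rw [← LinearMap.baseChange_comp]
    congr 1
    exact LinearMap.ext fun v => (T.castV_τ _ v).symm
  refine Prod.ext ?_ ?_
  · change -(T.dS ((n + 1 + 1 : ℕ) - 1) ((n + 1 : ℕ) - 1) 0) -
      T.τS (n + 1 + 1 : ℕ) ((n + 1 : ℕ) - 1) x = 0 - _
    rw [map_zero, neg_zero]
    exact congrArg (0 - ·) (LinearMap.congr_fun key x).symm
  · exact (sub_zero _).symm

/-- The split sequence `0 → (V ⊗ S)[1] → W → V ⊗ S → 0`. -/
def splittingW : ShiftedSplitting 1 T.complexS T.W T.complexS where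
  -- The cone differential contains $-\tau$; negating the inclusion makes the connecting map $\tau$
  -- itself, while `σ = -1` records the sign in $-\partial x$.
  i n := -T.inlW n
  r n := -T.fstW n
  p := T.sndW
  s n := T.inrW n
  θ n := T.τHom _ _
  σ := -1
  i_r n := by rw [Preadditive.neg_comp_neg, inlW_fstW]
  i_p n := by
    rw [Preadditive.neg_comp, neg_eq_zero]
    rfl
  decomp n := by rw [Preadditive.neg_comp_neg, fstW_inlW]
  s_p n := rfl
  p_s n hn := by
    obtain rfl : n = 0 := by omega
    exact T.sndW_inrW_zero
  d_i n := by
    rw [Preadditive.comp_neg, d_inlW, Preadditive.neg_comp]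
    simp
  s_d n := by
    rw [inrW_d, Preadditive.comp_neg, sub_eq_add_neg]

variable (N : Type u) [AddCommGroup N] [Module (RingS f g) N]

/-- The extension `0 → (V ⊗ N)[1] → W ⊗ N → V ⊗ N → 0`. -/
def extensionW : ShiftedExtension 1 (tensorComplex T.complexS N) (tensorComplex T.W N)
    (tensorComplex T.complexS N) :=
  (T.splittingW.map (tensorWith (RingS f g) N)).toShiftedExtension

lemma tauHomology_homologyClass (n : ℕ) (z : cycles (tensorComplex T.complexS N) (n + 2)) :
    T.tauHomology N n (homologyClass _ _ z) = homologyClass _ n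
      ⟨((tensorWith (RingS f g) N).map (T.τHom (n + 2) n)).hom z.1,
        (T.extensionW N).θ_mem_cycles z.2⟩ :=
  homologyMap_shortComplexClass (T.tauShortComplex N n) z _

/-- Both maps apply `τ ⊗ N` to a representing cycle. This identifies the connecting map with the
prescribed $\delta$. -/
lemma θH_extensionW (n : ℕ) : (T.extensionW N).θH n = T.tauHomology N n := by
  refine ModuleCat.hom_ext (LinearMap.ext fun c => ?_)
  obtain ⟨z, rfl⟩ := homologyClass_surjective _ _ c
  exact ((T.extensionW N).θH_homologyClass n z).trans (T.tauHomology_homologyClass N n z).symm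

end EisenbudLift

end DGResolution

/-! ### Multiplication by `t` and the sequence for Tor over `Q` -/

/-- A degreewise split sequence, with `θ` computed from the splitting. -/
def ShiftedSplitting.mk' {C : Type*} [Category* C] [Preadditive C] {k : ℕ}
    {X Y Z : ChainComplex C ℕ} (i : ∀ n, X.X n ⟶ Y.X (n + k)) (r : ∀ n, Y.X (n + k) ⟶ X.X n)
    (p : Y ⟶ Z) (s : ∀ n, Z.X n ⟶ Y.X n) (i_r : ∀ n, i n ≫ r n = 𝟙 _)
    (i_p : ∀ n, i n ≫ p.f (n + k) = 0)
    (decomp : ∀ n, r n ≫ i n + p.f (n + k) ≫ s (n + k) = 𝟙 _)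
    (s_p : ∀ n, s n ≫ p.f n = 𝟙 _) (p_s : ∀ n < k, p.f n ≫ s n = 𝟙 _)
    (d_i : ∀ n, X.d (n + 1) n ≫ i n = i (n + 1) ≫ Y.d (n + 1 + k) (n + k)) :
    ShiftedSplitting k X Y Z where
  i := i
  r := r
  p := p
  s := s
  θ n := s (n + 1 + k) ≫ Y.d (n + 1 + k) (n + k) ≫ r n
  σ := 1
  i_r := i_r
  i_p := i_p
  decomp := decomp
  s_p := s_p
  p_s := p_s
  d_i n := by rw [d_i]; simp
  s_d n := by
    have h1 : Y.d (n + 1 + k) (n + k) ≫ r n ≫ i n = Y.d (n + 1 + k) (n + k) -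
        p.f (n + 1 + k) ≫ Z.d (n + 1 + k) (n + k) ≫ s (n + k) := by
      have h := congrArg (Y.d (n + 1 + k) (n + k) ≫ ·) (decomp n)
      simp only [Preadditive.comp_add, Category.comp_id] at h
      rw [p.comm_assoc]
      exact eq_sub_of_add_eq h
    rw [Category.assoc, Category.assoc, h1, Preadditive.comp_sub, ← Category.assoc (s _), s_p,
      Category.id_comp, add_sub_cancel]

/-- Elements $gy \otimes n = y \otimes gn$ vanish. Only an elementwise difference in $gY$ is needed,
with no linear choice of $y$. -/
lemma tensorWith_map_congr {Q : Type u} [CommRing Q] {g : Q} (N : Type u) [AddCommGroup N]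
    [Module Q N] (hN : ∀ x : N, g • x = 0) {X Y : ModuleCat.{u} Q} {φ ψ : X ⟶ Y}
    (h : ∀ x, ∃ y : Y, φ.hom x = ψ.hom x + g • y) :
    (tensorWith Q N).map φ = (tensorWith Q N).map ψ := by
  refine ModuleCat.hom_ext (TensorProduct.ext' fun x n => ?_)
  obtain ⟨y, hy⟩ := h x
  change φ.hom x ⊗ₜ[Q] n = ψ.hom x ⊗ₜ[Q] n
  rw [hy, TensorProduct.add_tmul, TensorProduct.smul_tmul, hN, TensorProduct.tmul_zero, add_zero]

namespace DGResolution

variable {Q : Type u} [CommRing Q] {f g : Q} {hfg : IsExactPair f g}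
  {M : Type u} [AddCommGroup M] [Module Q M] (D : DGResolution hfg M)

open TateAlg

/-- Multiplication by `t` on `U`. -/
def tHom (n : ℕ) : D.complexQ.X n ⟶ D.complexQ.X (n + 2) :=
  ModuleCat.ofHom ((D.ySmul 2).restrict (p := D.dg.deg n) (q := D.dg.deg (n + 2)) fun _ hu =>
    add_comm 2 n ▸ D.dg.smul_mem (y_mem_deg 2) hu)

/-- The left inverse of multiplication by `t` on `U`. -/
def divTHom (n : ℕ) : D.complexQ.X (n + 2) ⟶ D.complexQ.X n :=
  ModuleCat.ofHom (D.divT.restrict (p := D.dg.deg (n + 2)) (q := D.dg.deg n) fun _ hu =>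
    D.divT_mem hu)

/-- The coefficients of `y_1` and `y_0`. -/
def coordHom (n : ℕ) : D.complexQ.X n ⟶ ModuleCat.of Q (D.V ((n : ℤ) - 1) × D.V n) :=
  ModuleCat.ofHom (((D.coord 1 (n - 1)).prod (D.coord 0 n)) ∘ₗ (D.dg.deg n).subtype)

/-- The map `(x, a) ↦ y x + a`. -/
def inclHom (n : ℕ) : ModuleCat.of Q (D.V ((n : ℤ) - 1) × D.V n) ⟶ D.complexQ.X n :=
  ModuleCat.ofHom (((D.ySmul 1 ∘ₗ D.incl (n - 1)).coprod (D.incl n)).codRestrict (D.dg.deg n)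
    fun p => add_mem (D.y_smul_incl_mem (by simp) _) (D.incl_mem rfl _))

lemma inclHom_coordHom (n : ℕ) : D.inclHom n ≫ D.coordHom n = 𝟙 _ := by
  refine ModuleCat.hom_ext (LinearMap.ext fun ⟨x, a⟩ => Prod.ext ?_ ?_)
  · change D.coord 1 (n - 1) ((y 1 : TateAlg Q) • D.incl (n - 1) x + D.incl n a) = x
    rw [map_add, coord_y_smul_incl, D.coord_succ_incl 0, add_zero]
  · change D.coord 0 n ((y 1 : TateAlg Q) • D.incl (n - 1) x + D.incl n a) = a
    rw [map_add, D.coord_y_smul_of_lt _ one_pos, coord_zero_incl, zero_add]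

lemma tHom_coordHom (n : ℕ) : D.tHom n ≫ D.coordHom (n + 2) = 0 := by
  refine ModuleCat.hom_ext (LinearMap.ext fun u => Prod.ext ?_ ?_)
  · exact D.coord_y_smul_of_lt _ (by omega) _
  · exact D.coord_y_smul_of_lt _ (by omega) _

section Invertible

variable (hQ : ∀ n : ℕ, IsUnit ((n + 1 : ℕ) : Q))
include hQ

lemma tHom_divTHom (n : ℕ) : D.tHom n ≫ D.divTHom n = 𝟙 _ :=
  ModuleCat.hom_ext (LinearMap.ext fun _ => Subtype.ext (D.divT_y_two_smul hQ _))

lemma divTHom_tHom (n : ℕ) :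
    D.divTHom n ≫ D.tHom n + D.coordHom (n + 2) ≫ D.inclHom (n + 2) = 𝟙 _ := by
  refine ModuleCat.hom_ext (LinearMap.ext fun u => Subtype.ext ?_)
  refine Eq.trans ?_ (D.decomposition hQ u.2).symm
  exact (add_comm _ _).trans (congrArg (· + _) (add_comm _ _))

/-- Below degree two nothing is divisible by $t$, so the $t$-part of `decomposition` is zero. -/
lemma coordHom_inclHom {n : ℕ} (hn : n < 2) : D.coordHom n ≫ D.inclHom n = 𝟙 _ := by
  refine ModuleCat.hom_ext (LinearMap.ext fun u => Subtype.ext ?_)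
  refine Eq.trans ?_ (D.decomposition hQ u.2).symm
  have h : D.divT u.1 = 0 := by
    refine map_mem_of_deg (S := ⊥) (fun i δ h => ?_) u.2
    rw [divT_smul_e]
    rcases i with _ | _ | i
    · rw [divT_y_zero, zero_smul]; exact zero_mem _
    · rw [divT_y_one, zero_smul]; exact zero_mem _
    · omega
  rw [h, smul_zero, add_zero]
  exact add_comm _ _

end Invertible

/-- The defect $\partial(tu) - t\,\partial u = g\,yu$ vanishes after tensoring with $N$. -/
lemma d_tHom (N : Type u) [AddCommGroup N] [Module Q N] (hN : ∀ x : N, g • x = 0) (n : ℕ) :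
    (tensorWith Q N).map (D.complexQ.d (n + 1) n ≫ D.tHom n) =
      (tensorWith Q N).map (D.tHom (n + 1) ≫ D.complexQ.d (n + 1 + 2) (n + 2)) := by
  refine (tensorWith_map_congr N hN fun u => ?_).symm
  refine ⟨⟨(y 1 : TateAlg Q) • u.1, ?_⟩, Subtype.ext ?_⟩
  · have := D.dg.smul_mem (y_mem_deg 1) u.2
    rwa [show 1 + (n + 1) = n + 2 by omega] at this
  · refine (D.coe_dDeg (by omega) _).trans ?_
    refine (D.d_y_two_smul _).trans ((add_comm _ _).trans ?_)
    exact congrArg (fun z => (y 2 : TateAlg Q) • z + _) (D.coe_dDeg rfl u).symm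

namespace EisenbudLift

variable {D} (T : D.EisenbudLift)

/-- All lifts of the Eisenbud operator agree after base change to `S`. -/
lemma τS_eq (hQ : ∀ n : ℕ, IsUnit ((n + 1 : ℕ) : Q)) (i k : ℤ) (h : k + 2 = i) :
    T.τS i k = (D.tau i k).baseChange (RingS f g) := by
  rw [← sub_eq_zero, ← LinearMap.baseChange_sub]
  apply baseChange_S_eq_zero_of_smul (hfg := hfg)
  refine LinearMap.ext fun v => ?_
  rw [LinearMap.smul_apply, LinearMap.sub_apply, smul_sub, ← LinearMap.smul_apply,
    ← LinearMap.smul_apply, ← T.dV_dV i (k + 1) k (by omega) rfl,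
    ← D.dV_dV hQ i (k + 1) k (by omega) rfl, sub_self]
  rfl

lemma one_tmul_add_smul {V : Type*} [AddCommGroup V] [Module Q V] {q : Q}
    (hq : q ∈ Ideal.span {f, g}) (v w : V) :
    (1 : RingS f g) ⊗ₜ[Q] (v + q • w) = 1 ⊗ₜ[Q] v := by
  rw [TensorProduct.tmul_add, ← TensorProduct.smul_tmul, Algebra.smul_def,
    Ideal.Quotient.algebraMap_eq, Ideal.Quotient.eq_zero_iff_mem.2 hq, zero_mul,
    TensorProduct.zero_tmul, add_zero]

/-- The `Q`-linear map `v ↦ 1 ⊗ v` to the terms of `W`. -/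
def toW (n : ℕ) : ModuleCat.of Q (D.V ((n : ℤ) - 1) × D.V n) ⟶ (res Q (RingS f g)).obj (T.W.X n) :=
  ModuleCat.ofHom (Y := (res Q (RingS f g)).obj (T.W.X n))
    { toFun := fun v => ((1 : RingS f g) ⊗ₜ[Q] v.1, (1 : RingS f g) ⊗ₜ[Q] v.2)
      map_add' := fun v w => Prod.ext (TensorProduct.tmul_add _ _ _) (TensorProduct.tmul_add _ _ _)
      map_smul' := fun q v => by
        refine Prod.ext ?_ ?_
        · refine (TensorProduct.tmul_smul _ _ _).trans (algebraMap_smul (RingS f g) q _).symm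
        · refine (TensorProduct.tmul_smul _ _ _).trans (algebraMap_smul (RingS f g) q _).symm }

/-- The projection `U → W`, as a `Q`-linear chain map. -/
def chainMapW (hQ : ∀ n : ℕ, IsUnit ((n + 1 : ℕ) : Q)) : D.complexQ ⟶
    ((res Q (RingS f g)).mapHomologicalComplex (ComplexShape.down ℕ)).obj T.W where
  f n := D.coordHom n ≫ T.toW n
  comm' i j hij := by
    have hij' : j + 1 = i := hij
    have hW : (((res Q (RingS f g)).mapHomologicalComplex (ComplexShape.down ℕ)).obj T.W).d i j =
        (res Q (RingS f g)).map (ModuleCat.ofHom (T.dW i j)) :=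
      congrArg (res Q (RingS f g)).map (T.W_d hij')
    rw [hW]
    refine ModuleCat.hom_ext (LinearMap.ext fun u => ?_)
    have hd : (D.complexQ.d i j).hom u = (⟨D.dg.d u.1, D.dg.d_mem (hij' ▸ u.2)⟩ : D.dg.deg j) :=
      Subtype.ext (D.coe_dDeg hij' u)
    have h0 := D.coord_zero_d hQ u.2 j (by omega)
    have h1 := D.coord_one_d hQ u.2 (i - 1) (j - 1) (by omega)
    refine Eq.trans ?_ (congrArg (fun z => (T.toW j).hom ((D.coordHom j).hom z)) hd).symm
    refine Prod.ext ?_ ?_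
    · refine Eq.trans ?_ (congrArg (fun z => (1 : RingS f g) ⊗ₜ[Q] z) h1).symm
      rw [one_tmul_add_smul (Ideal.subset_span (by simp))]
      change -(T.dS (i - 1) (j - 1) (1 ⊗ₜ D.coord 1 (i - 1) u.1)) -
        T.τS i (j - 1) (1 ⊗ₜ D.coord 0 i u.1) = _
      rw [T.τS_eq hQ _ _ (by omega), LinearMap.baseChange_tmul, LinearMap.baseChange_tmul,
        TensorProduct.tmul_sub, TensorProduct.tmul_neg]
      abel
    · refine Eq.trans ?_ (congrArg (fun z => (1 : RingS f g) ⊗ₜ[Q] z) h0).symm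
      rw [one_tmul_add_smul (Ideal.subset_span (by simp))]
      exact LinearMap.baseChange_tmul _ _ _

variable (N : Type u) [AddCommGroup N] [Module Q N] [Module (RingS f g) N]
  [IsScalarTower Q (RingS f g) N]

/-- The isomorphism `(V_{n-1} ⊕ V_n) ⊗_Q N ≅ W_n ⊗_S N`. -/
def isoW (n : ℕ) : (tensorWith Q N).obj (ModuleCat.of Q (D.V ((n : ℤ) - 1) × D.V n)) ≅
    (res Q (RingS f g)).obj ((tensorWith (RingS f g) N).obj (T.W.X n)) :=
  (TensorProduct.comm Q (D.V ((n : ℤ) - 1) × D.V n) N).toModuleIso ≪≫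
    (cancelIso (RingS f g) (D.V ((n : ℤ) - 1) × D.V n) N).symm ≪≫
    (res Q (RingS f g)).mapIso ((tensorWith (RingS f g) N).mapIso
      (TensorProduct.prodRight Q (RingS f g) (RingS f g) (D.V ((n : ℤ) - 1))
        (D.V n)).toModuleIso)

lemma isoW_hom (n : ℕ) : (T.isoW N n).hom = tensorHom (T.toW n) N :=
  ModuleCat.hom_ext (TensorProduct.ext' fun v x => by
    rfl)

/-- The sequence `0 → (U ⊗ N)[2] → U ⊗ N → W ⊗ N → 0`, where the first map is multiplication
by `t`. -/
def splittingU (hQ : ∀ n : ℕ, IsUnit ((n + 1 : ℕ) : Q)) (hN : ∀ x : N, g • x = 0) :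
    ShiftedSplitting 2 (tensorComplex D.complexQ N) (tensorComplex D.complexQ N)
      (((res Q (RingS f g)).mapHomologicalComplex (ComplexShape.down ℕ)).obj
        (tensorComplex T.W N)) :=
  -- In each degree the projection is the coordinate map tensored with $N$, followed by an
  -- isomorphism; the splitting identities are thus inherited from those of `coordHom`, `inclHom`,
  -- `tHom` and `divTHom` over `Q`.
  have hp (n : ℕ) : (tensorChainMap (T.chainMapW hQ) N).f n =
      (tensorWith Q N).map (D.coordHom n) ≫ (T.isoW N n).hom := by
    rw [isoW_hom]
    exact ModuleCat.hom_ext (TensorProduct.ext' fun v x => rfl)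
  let F := tensorWith Q N
  .mk' (fun n => F.map (D.tHom n)) (fun n => F.map (D.divTHom n))
    (tensorChainMap (T.chainMapW hQ) N) (fun n => (T.isoW N n).inv ≫ F.map (D.inclHom n))
    (fun n => (F.map_comp _ _).symm.trans
      ((congrArg F.map (D.tHom_divTHom hQ n)).trans (F.map_id _)))
    (fun n => by
      rw [hp]
      have h : F.map (D.tHom n) ≫ F.map (D.coordHom (n + 2)) = 0 :=
        (F.map_comp _ _).symm.trans ((congrArg F.map (D.tHom_coordHom n)).trans (F.map_zero _ _))
      exact (Category.assoc _ _ _).symm.trans ((congrArg (· ≫ _) h).trans Limits.zero_comp))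
    (fun n => by
      rw [hp]
      have h : F.map (D.divTHom n) ≫ F.map (D.tHom n) +
          F.map (D.coordHom (n + 2)) ≫ F.map (D.inclHom (n + 2)) = 𝟙 _ :=
        (congrArg₂ (· + ·) (F.map_comp _ _).symm (F.map_comp _ _).symm).trans
          (F.map_add.symm.trans ((congrArg F.map (D.divTHom_tHom hQ n)).trans (F.map_id _)))
      refine Eq.trans (congrArg (_ + ·) ?_) h
      exact (Category.assoc _ _ _).trans (congrArg (_ ≫ ·) (Iso.hom_inv_id_assoc _ _)))
    (fun n => by
      rw [hp]
      have h : F.map (D.inclHom n) ≫ F.map (D.coordHom n) = 𝟙 _ :=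
        (F.map_comp _ _).symm.trans ((congrArg F.map (D.inclHom_coordHom n)).trans (F.map_id _))
      refine (Category.assoc _ _ _).trans ?_
      refine (congrArg (_ ≫ ·) ((Category.assoc _ _ _).symm.trans (congrArg (· ≫ _) h))).trans ?_
      exact (congrArg (_ ≫ ·) (Category.id_comp _)).trans (Iso.inv_hom_id _))
    (fun n hn => by
      rw [hp]
      have h : F.map (D.coordHom n) ≫ F.map (D.inclHom n) = 𝟙 _ :=
        (F.map_comp _ _).symm.trans
          ((congrArg F.map (D.coordHom_inclHom hQ hn)).trans (F.map_id _))
      exact (Category.assoc _ _ _).trans ((congrArg (_ ≫ ·) (Iso.hom_inv_id_assoc _ _)).trans h))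
    (fun n => (F.map_comp _ _).symm.trans ((D.d_tHom N hN n).trans (F.map_comp _ _)))

end EisenbudLift

end DGResolution

/-! ### Comparison of resolutions over two rings -/

/-- A chain map from a complex of projectives to a complex which is exact in positive degrees is
null homotopic if it factors through the differential in degree zero. -/
lemma nonempty_homotopy_zero {C : Type*} [Category* C] [Abelian C] {P Y : ChainComplex C ℕ}
    [∀ n, Projective (P.X n)] (k : P ⟶ Y)
    (hY : ∀ n, (ShortComplex.mk (Y.d (n + 2) (n + 1)) (Y.d (n + 1) n) (Y.d_comp_d _ _ _)).Exact)
    (s : P.X 0 ⟶ Y.X 1) (hs : k.f 0 = s ≫ Y.d 1 0) : Nonempty (Homotopy k 0) := by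
  -- The difference of `k` and the part of the homotopy already built is a map into cycles, so
  -- exactness and projectivity give the next component.
  have step (n : ℕ) (a : P.X n ⟶ Y.X (n + 1))
      (ha : P.d (n + 1) n ≫ a ≫ Y.d (n + 1) n = P.d (n + 1) n ≫ k.f n) :
      ∃ b : P.X (n + 1) ⟶ Y.X (n + 2),
        k.f (n + 1) = P.d (n + 1) n ≫ a + b ≫ Y.d (n + 2) (n + 1) := by
    have h0 : (k.f (n + 1) - P.d (n + 1) n ≫ a) ≫ Y.d (n + 1) n = 0 := by
      rw [Preadditive.sub_comp, k.comm, Category.assoc, ha, sub_self]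
    exact ⟨(hY n).liftFromProjective _ h0, by
      rw [(hY n).liftFromProjective_comp]; exact (add_sub_cancel _ _).symm⟩
  choose b hb using step
  have h1 := hb 0 s (by rw [← hs])
  exact ⟨Homotopy.mkInductive k s hs (b 0 s (by rw [← hs])) h1 fun n ⟨a, a', h⟩ =>
    ⟨b (n + 1) a' (by rw [h]; simp), hb _ _ _⟩⟩

section ChangeOfRings

variable {Q A : Type u} [CommRing Q] [CommRing A] [Algebra Q A]
  (N : Type u) [AddCommGroup N] [Module Q N] [Module A N] [IsScalarTower Q A N]

lemma tensorHom_comp_map {X : ModuleCat.{u} Q} {Y Y' : ModuleCat.{u} A}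
    (h : X ⟶ (res Q A).obj Y) (φ : Y ⟶ Y') :
    tensorHom (h ≫ (res Q A).map φ) N =
      tensorHom h N ≫ (res Q A).map ((tensorWith A N).map φ) :=
  ModuleCat.hom_ext (TensorProduct.ext' fun _ _ => rfl)

lemma map_comp_tensorHom {X X' : ModuleCat.{u} Q} {Y : ModuleCat.{u} A} (φ : X ⟶ X')
    (h : X' ⟶ (res Q A).obj Y) :
    tensorHom (φ ≫ h) N = (tensorWith Q N).map φ ≫ tensorHom h N :=
  ModuleCat.hom_ext (TensorProduct.ext' fun _ _ => rfl)

lemma tensorHom_add {X : ModuleCat.{u} Q} {Y : ModuleCat.{u} A} (h h' : X ⟶ (res Q A).obj Y) :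
    tensorHom (h + h') N = tensorHom h N + tensorHom h' N :=
  ModuleCat.hom_ext (TensorProduct.ext' fun x n =>
    TensorProduct.add_tmul (R := A) (show Y from h.hom x) (show Y from h'.hom x) n)

variable {P : ChainComplex (ModuleCat.{u} Q) ℕ} {Y : ChainComplex (ModuleCat.{u} A) ℕ}

lemma tensorChainMap_sub
    (h h' : P ⟶ ((res Q A).mapHomologicalComplex (ComplexShape.down ℕ)).obj Y) :
    tensorChainMap (h - h') N = tensorChainMap h N - tensorChainMap h' N := by
  refine HomologicalComplex.hom_ext _ _ fun n => eq_sub_of_add_eq ?_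
  refine (tensorHom_add N _ _).symm.trans ?_
  exact congrArg (tensorHom · N) (sub_add_cancel (h.f n) (h'.f n))

/-- The homotopy is only $Q$-linear, from a complex over $Q$ to one over $A$; applying `tensorHom`
to its components still exhibits the image of each cycle as a boundary. -/
lemma homologyMap_tensorChainMap_eq_zero
    {h : P ⟶ ((res Q A).mapHomologicalComplex (ComplexShape.down ℕ)).obj Y} (s : Homotopy h 0)
    (n : ℕ) : HomologicalComplex.homologyMap (tensorChainMap h N) n = 0 := by
  refine ModuleCat.hom_ext (LinearMap.ext fun c => ?_)
  obtain ⟨z, rfl⟩ := homologyClass_surjective _ _ c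
  refine (homologyMap_homologyClass _ n z).trans ((homologyClass_eq_zero_iff _ rfl _).2 ?_)
  let s' (m : ℕ) : P.X m ⟶ (res Q A).obj (Y.X (m + 1)) := s.hom m (m + 1)
  refine ⟨(tensorHom (s' n) N).hom z.1, ?_⟩
  have h1 : tensorHom (s' n ≫ (res Q A).map (Y.d (n + 1) n)) N =
      tensorHom (s' n) N ≫ (res Q A).map ((tensorWith A N).map (Y.d (n + 1) n)) :=
    tensorHom_comp_map N _ _
  refine (congrArg (fun φ => ModuleCat.Hom.hom φ z.1) h1).symm.trans ?_
  rcases n with _ | n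
  · have h2 : (show P.X 0 ⟶ (res Q A).obj (Y.X 0) from h.f 0) = s' 0 ≫ (res Q A).map (Y.d 1 0) := by
      have := s.comm 0
      rw [Homotopy.dNext_zero_chainComplex, Homotopy.prevD_chainComplex] at this
      exact this.trans ((add_zero _).trans (zero_add _))
    exact congrArg (fun φ => (tensorHom φ N).hom z.1) h2.symm
  · have h2 : (show P.X (n + 1) ⟶ (res Q A).obj (Y.X (n + 1)) from h.f (n + 1)) =
        P.d (n + 1) n ≫ s' n +
        s' (n + 1) ≫ (res Q A).map (Y.d (n + 2) (n + 1)) := by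
      have := s.comm (n + 1)
      rw [Homotopy.dNext_succ_chainComplex, Homotopy.prevD_chainComplex] at this
      exact this.trans (add_zero _)
    have h3 := congrArg (fun φ => (tensorHom φ N).hom z.1) h2
    refine Eq.trans ?_ h3.symm
    have h4 : (tensorHom (P.d (n + 1) n ≫ s' n) N).hom z.1 = 0 := by
      rw [map_comp_tensorHom]
      exact (congrArg (tensorHom (s' n) N).hom (mem_cycles.1 z.2 n)).trans (map_zero _)
    have h5 := congrArg (fun φ => ModuleCat.Hom.hom φ z.1) (tensorHom_add N
      (P.d (n + 1) n ≫ s' n)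
      (s' (n + 1) ≫ (res Q A).map (Y.d (n + 2) (n + 1))))
    refine Eq.trans ?_ h5.symm
    exact ((congrArg (· + _) h4).trans (zero_add _)).symm

variable {M : Type u} [AddCommGroup M] [Module A M]

/-- Restriction of scalars keeps the resolution over $A$ exact, so a $Q$-linear chain map from
projectives that lifts zero is null homotopic. -/
lemma homologyMap_tensorChainMap_of_resolution [∀ n, Projective (P.X n)]
    (P' : ProjectiveResolution (ModuleCat.of A M))
    (h : P ⟶ ((res Q A).mapHomologicalComplex (ComplexShape.down ℕ)).obj P'.complex)
    (h0 : ∀ x : P.X 0, ((P'.π.f 0).hom (show P'.complex.X 0 from (h.f 0).hom x) : M) = 0)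
    (n : ℕ) : HomologicalComplex.homologyMap (tensorChainMap h N) n = 0 := by
  have e0 := P'.exact₀.map (res Q A)
  have h0' : h.f 0 ≫ (res Q A).map (P'.π.f 0) = 0 := ModuleCat.hom_ext (LinearMap.ext h0)
  obtain ⟨s⟩ := nonempty_homotopy_zero h (fun n => (P'.exact_succ n).map (res Q A))
    (e0.liftFromProjective (h.f 0) h0') (e0.liftFromProjective_comp (h.f 0) h0').symm
  exact homologyMap_tensorChainMap_eq_zero N s n

omit [Module A M] in
lemma torIso_hom_eq [Module Q M] (P P' : ProjectiveResolution (ModuleCat.of Q M)) (n : ℕ) :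
    (torIso P' N n).hom = (torIso P N n).hom ≫ HomologicalComplex.homologyMap
      (((tensorWith Q N).mapHomologicalComplex _).map
        (ProjectiveResolution.lift (𝟙 _) P P')) n := by
  have := ProjectiveResolution.isoLeftDerivedObj_hom_naturality (𝟙 _) P P'
    (ProjectiveResolution.lift (𝟙 _) P P') (ProjectiveResolution.lift_commutes_zero _ _ _)
    (tensorWith Q N) n
  rw [CategoryTheory.Functor.map_id, Category.id_comp] at this
  exact this

lemma resHomologyIso_hom_naturality {C C' : ChainComplex (ModuleCat.{u} A) ℕ} (φ : C ⟶ C')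
    (n : ℕ) :
    HomologicalComplex.homologyMap
        (((res Q A).mapHomologicalComplex (ComplexShape.down ℕ)).map φ) n ≫
      (resHomologyIso Q C' n).hom =
    (resHomologyIso Q C n).hom ≫ (res Q A).map (HomologicalComplex.homologyMap φ n) :=
  ShortComplex.mapHomologyIso_hom_naturality
    ((HomologicalComplex.shortComplexFunctor _ _ n).map φ) (res Q A)

/-- The change of rings map can be computed from any pair of resolutions. -/
lemma isChangeOfRings_of_resolutions [Module Q M] [IsScalarTower Q A M]
    (P₀ : ProjectiveResolution (ModuleCat.of Q M)) (P₀' : ProjectiveResolution (ModuleCat.of A M))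
    (h₀ : P₀.complex ⟶
      ((res Q A).mapHomologicalComplex (ComplexShape.down ℕ)).obj P₀'.complex)
    (hh₀ : ∀ x : P₀.complex.X 0,
      ((P₀'.π.f 0).hom (show P₀'.complex.X 0 from (h₀.f 0).hom x) : M) = ((P₀.π.f 0).hom x : M))
    (n : ℕ) :
    IsChangeOfRings (A := A) M N n ((torIso P₀ N n).hom ≫
      HomologicalComplex.homologyMap (tensorChainMap h₀ N) n ≫
      (resHomologyIso Q (tensorComplex P₀'.complex N) n).hom ≫
      (res Q A).map (torIso P₀' N n).inv) := by
  intro P P' h hh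
  let α := ProjectiveResolution.lift (𝟙 _) P P₀
  let β := ProjectiveResolution.lift (𝟙 _) P' P₀'
  have hα (x : P.complex.X 0) : (P₀.π.f 0).hom ((α.f 0).hom x) = (P.π.f 0).hom x :=
    congrArg (fun φ => ModuleCat.Hom.hom φ x)
      (ProjectiveResolution.lift_commutes_zero (𝟙 (ModuleCat.of Q M)) P P₀)
  have hβ (x : P'.complex.X 0) : (P₀'.π.f 0).hom ((β.f 0).hom x) = (P'.π.f 0).hom x :=
    congrArg (fun φ => ModuleCat.Hom.hom φ x)
      (ProjectiveResolution.lift_commutes_zero (𝟙 (ModuleCat.of A M)) P' P₀')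
  have hinv : (torIso P' N n).inv = HomologicalComplex.homologyMap
      (((tensorWith A N).mapHomologicalComplex _).map β) n ≫ (torIso P₀' N n).inv := by
    rw [Iso.eq_comp_inv, torIso_hom_eq N P' P₀', Iso.inv_hom_id_assoc]
  have key : HomologicalComplex.homologyMap
        (((tensorWith Q N).mapHomologicalComplex _).map α) n ≫
        HomologicalComplex.homologyMap (tensorChainMap h₀ N) n =
      HomologicalComplex.homologyMap (tensorChainMap h N) n ≫ HomologicalComplex.homologyMap
        (((res Q A).mapHomologicalComplex (ComplexShape.down ℕ)).map
          (((tensorWith A N).mapHomologicalComplex _).map β)) n := by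
    rw [← HomologicalComplex.homologyMap_comp, ← HomologicalComplex.homologyMap_comp]
    have e1 : ((tensorWith Q N).mapHomologicalComplex _).map α ≫ tensorChainMap h₀ N =
        tensorChainMap (α ≫ h₀) N :=
      HomologicalComplex.hom_ext _ _ fun m => (map_comp_tensorHom N _ _).symm
    have e2 : tensorChainMap h N ≫ ((res Q A).mapHomologicalComplex (ComplexShape.down ℕ)).map
          (((tensorWith A N).mapHomologicalComplex _).map β) =
        tensorChainMap (h ≫ ((res Q A).mapHomologicalComplex (ComplexShape.down ℕ)).map β) N :=
      HomologicalComplex.hom_ext _ _ fun m => (tensorHom_comp_map N _ _).symm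
    -- Both routes from `P` to `P₀'` lift the identity of `M`, so their difference lifts zero.
    rw [e1, e2, ← sub_eq_zero, ← HomologicalComplex.homologyMap_sub, ← tensorChainMap_sub]
    refine homologyMap_tensorChainMap_of_resolution N P₀' _ (fun x => ?_) n
    refine (map_sub (P₀'.π.f 0).hom (show P₀'.complex.X 0 from (h₀.f 0).hom ((α.f 0).hom x))
      ((β.f 0).hom (show P'.complex.X 0 from (h.f 0).hom x))).trans (sub_eq_zero.2 ?_)
    exact (hh₀ _).trans ((hα x).trans ((hh x).symm.trans (hβ _).symm))
  have nat := resHomologyIso_hom_naturality (Q := Q)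
    (((tensorWith A N).mapHomologicalComplex (ComplexShape.down ℕ)).map β) n
  rw [hinv, torIso_hom_eq N P P₀, Category.assoc, (res Q A).map_comp, reassoc_of% key]
  refine congrArg (fun φ => _ ≫ _ ≫ φ) ?_
  exact (reassoc_of% nat) _

end ChangeOfRings

/-! ### Transport of exactness along isomorphisms -/

section Conjugation

variable {Q : Type u} [CommRing Q] {X Y Z X' Y' Z' : ModuleCat.{u} Q}

lemma exact_of_iso (a : X ≅ X') (b : Y ≅ Y') (c : Z ≅ Z') {u : X' ⟶ Y'} {v : Y' ⟶ Z'}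
    (h : Function.Exact u v) :
    Function.Exact (a.hom ≫ u ≫ b.inv) (b.hom ≫ v ≫ c.inv) := by
  have h1 : Function.Injective c.inv := (ModuleCat.mono_iff_injective c.inv).1 inferInstance
  have h2 : Function.Surjective a.hom := (ModuleCat.epi_iff_surjective a.hom).1 inferInstance
  intro y
  have e1 : (b.hom ≫ v ≫ c.inv) y = c.inv (v (b.hom y)) := rfl
  rw [e1, ← map_zero c.inv.hom, h1.eq_iff, h]
  constructor
  · rintro ⟨x, hx⟩
    obtain ⟨x, rfl⟩ := h2 x
    refine ⟨x, ?_⟩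
    change b.inv (u (a.hom x)) = y
    rw [hx]
    exact b.hom_inv_id_apply y
  · rintro ⟨x, rfl⟩
    exact ⟨a.hom x, (b.inv_hom_id_apply _).symm⟩

lemma surjective_of_iso (a : X ≅ X') (b : Y ≅ Y') {u : X' ⟶ Y'} (h : Function.Surjective u) :
    Function.Surjective (a.hom ≫ u ≫ b.inv) := by
  have := (ModuleCat.epi_iff_surjective u).2 h
  exact (ModuleCat.epi_iff_surjective _).1 inferInstance

lemma bijective_of_iso (a : X ≅ X') (b : Y ≅ Y') {u : X' ⟶ Y'} (h : Function.Bijective u) :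
    Function.Bijective (a.hom ≫ u ≫ b.inv) := by
  have := (ModuleCat.mono_iff_injective u).2 h.1
  exact ⟨(ModuleCat.mono_iff_injective _).1 inferInstance, surjective_of_iso a b h.2⟩

end Conjugation

/-- The formal diagram chase behind `isChangeOfRings_comp`, stated in an arbitrary category so that
the concrete homology objects need not be unfolded. -/
lemma comp_trans_inv {C : Type*} [Category* C] {X A A' B B' E E' G : C} {p : X ⟶ A} {w : X ⟶ B}
    {e : B ⟶ E} {e' : B' ⟶ E'} (t : G ≅ A') (rA : A ≅ A') (k : A ≅ E) (rE : E ≅ E') (rB : B ≅ B')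
    (h : e ≫ rE.hom = rB.hom ≫ e') (h' : w ≫ e = p ≫ k.hom) :
    p ≫ rA.hom ≫ t.inv = w ≫ rB.hom ≫ e' ≫ (t ≪≫ rA.symm ≪≫ k ≪≫ rE).inv := by
  rw [← reassoc_of% h, reassoc_of% h']
  simp

/-! ### The change-of-rings map as a composite -/

namespace DGResolution.EisenbudLift

variable {Q : Type u} [CommRing Q] {f g : Q} {hfg : IsExactPair f g}
  {M : Type u} [AddCommGroup M] [Module Q M] {D : DGResolution hfg M} (T : D.EisenbudLift)

/-- The projection `U → V ⊗ R`, as a `Q`-linear chain map. -/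
def chainMapR (hQ : ∀ n : ℕ, IsUnit ((n + 1 : ℕ) : Q)) : D.complexQ ⟶
    ((res Q (RingR f)).mapHomologicalComplex (ComplexShape.down ℕ)).obj T.complexR where
  f n := ModuleCat.ofHom (Y := (res Q (RingR f)).obj (T.complexR.X n))
    { toFun := fun u => (1 : RingR f) ⊗ₜ[Q] D.coord 0 n u.1
      map_add' := fun u v => by
        refine (congrArg _ (map_add (D.coord 0 n) u.1 v.1)).trans (TensorProduct.tmul_add _ _ _)
      map_smul' := fun q u => by
        refine (congrArg _ (map_smul (D.coord 0 n) q u.1)).trans ?_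
        exact (TensorProduct.tmul_smul _ _ _).trans (algebraMap_smul (RingR f) q _).symm }
  comm' i j hij := by
    obtain rfl : j + 1 = i := hij
    refine ModuleCat.hom_ext (LinearMap.ext fun u => ?_)
    refine (T.complexR_d_coord hQ u.2).trans ?_
    exact congrArg (fun w => (1 : RingR f) ⊗ₜ[Q] D.coord 0 j w) (D.coe_dDeg rfl u).symm

lemma augR_chainMapR [Module (RingR f) M] [IsScalarTower Q (RingR f) M]
    (hQ : ∀ n : ℕ, IsUnit ((n + 1 : ℕ) : Q)) (u : D.dg.deg 0) :
    (T.augR.f 0).hom (((T.chainMapR hQ).f 0).hom u) = (D.augQ.f 0).hom u := by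
  refine (T.augR_f_zero _).trans ((T.augR₀_one_tmul _).trans ?_)
  exact (ε_eq D u.1).trans (D.augQ_f_zero u).symm

variable (N : Type u) [AddCommGroup N] [Module Q N] [Module (RingR f) N]
  [IsScalarTower Q (RingR f) N] [Module (RingS f g) N] [IsScalarTower Q (RingS f g) N]

/-- Both composites send $u \otimes x$ to the coefficient of $y_0$ in $u$, tensored with $x$; this
is visible after identifying the targets with $N \otimes_Q V_n$. -/
lemma tensorChainMap_chainMapW_comp_sndW (hQ : ∀ n : ℕ, IsUnit ((n + 1 : ℕ) : Q)) :
    tensorChainMap (T.chainMapW hQ) N ≫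
      ((res Q (RingS f g)).mapHomologicalComplex (ComplexShape.down ℕ)).map
        (T.extensionW N).p =
      tensorChainMap (T.chainMapR hQ) N ≫ (T.complexIso N).hom := by
  refine HomologicalComplex.hom_ext _ _ fun n => ?_
  have key : (tensorHom ((T.chainMapW hQ).f n) N ≫
      (res Q (RingS f g)).map ((T.extensionW N).p.f n)) ≫
      (cancelIso (RingS f g) (D.V n) N).hom = tensorHom ((T.chainMapR hQ).f n) N ≫
      (cancelIso (RingR f) (D.V n) N).hom := by
    refine ModuleCat.hom_ext (TensorProduct.ext' fun u x => ?_)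
    change ((1 : RingS f g) • x) ⊗ₜ[Q] D.coord 0 n u.1 = ((1 : RingR f) • x) ⊗ₜ[Q] D.coord 0 n u.1
    rw [one_smul, one_smul]
  have h := (Iso.eq_comp_inv _).2 key
  exact h.trans (Category.assoc _ _ _)

variable [Module (RingR f) M] [IsScalarTower Q (RingR f) M]

/-- The composition of the maps `Tor^Q_n(M, N) → H_n(W ⊗ N) → Tor^R_n(M, N)` is the change of
rings map. -/
lemma isChangeOfRings_comp (hQ : ∀ n : ℕ, IsUnit ((n + 1 : ℕ) : Q)) (hq : QuasiIso T.augR) (n : ℕ) :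
    IsChangeOfRings (A := RingR f) M N n (((torIso D.resolutionQ N n).hom ≫
      HomologicalComplex.homologyMap (tensorChainMap (T.chainMapW hQ) N) n ≫
      (resHomologyIso Q (tensorComplex T.W N) n).hom) ≫
      (res Q (RingS f g)).map ((T.extensionW N).pH n) ≫ (T.torRIso N hq n).inv) := by
  have h := isChangeOfRings_of_resolutions N D.resolutionQ (T.resolutionR hq) (T.chainMapR hQ)
    (T.augR_chainMapR hQ) n
  refine (congrArg (IsChangeOfRings M N n) ?_).mp h
  have nat := resHomologyIso_hom_naturality (Q := Q) (T.extensionW N).p n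
  have hc := congrArg (HomologicalComplex.homologyMap · n)
    (T.tensorChainMap_chainMapW_comp_sndW N hQ)
  simp only [HomologicalComplex.homologyMap_comp] at hc
  refine congrArg (fun φ => (torIso D.resolutionQ N n).hom ≫ φ) ?_ |>.trans
    (Category.assoc _ _ _).symm
  refine Eq.trans ?_ (Category.assoc _ _ _).symm
  exact comp_trans_inv ((res Q (RingR f)).mapIso (torIso (T.resolutionR hq) N n))
    (resHomologyIso Q (tensorComplex T.complexR N) n)
    (HomologicalComplex.homologyMapIso (T.complexIso N) n)
    (resHomologyIso Q (tensorComplex T.complexS N) n)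
    (resHomologyIso Q (tensorComplex T.W N) n) nat hc

end DGResolution.EisenbudLift

/-- A positive integer is nonzero in the residue field, hence outside the maximal ideal. This is
where residue characteristic zero enters. -/
lemma isUnit_natCast_succ {Q : Type*} [CommRing Q] [IsLocalRing Q]
    [CharZero (IsLocalRing.ResidueField Q)] (n : ℕ) : IsUnit ((n + 1 : ℕ) : Q) := by
  rw [← IsLocalRing.residue_ne_zero_iff_isUnit, map_natCast]
  exact Nat.cast_ne_zero.2 n.succ_ne_zero

lemma smul_eq_zero_of_isScalarTower {Q : Type*} [CommRing Q] (f : Q) {M : Type*} [AddCommGroup M]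
    [Module Q M] [Module (RingR f) M] [IsScalarTower Q (RingR f) M] (m : M) : f • m = 0 := by
  rw [← algebraMap_smul (RingR f) f m, Ideal.Quotient.algebraMap_eq,
    Ideal.Quotient.eq_zero_iff_mem.2 (Ideal.mem_span_singleton_self f), zero_smul]

end ExactZeroDivisor

end

theorem mainTheorem1 {Q : Type u} [CommRing Q] [IsLocalRing Q] [IsNoetherianRing Q]
    [CharZero (IsLocalRing.ResidueField Q)] {f g : Q} (hfg : IsExactPair f g)
    (M : Type u) [AddCommGroup M] [Module Q M] [Module (RingR f) M]
    [IsScalarTower Q (RingR f) M] :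
    Nonempty (DGResolution hfg M) ∧
    ∀ D : DGResolution hfg M, Nonempty D.EisenbudLift ∧
    ∀ T : D.EisenbudLift, ∃ hq : QuasiIso T.augR,
    ∀ (N : Type u) [AddCommGroup N] [Module Q N] [Module (RingR f) N]
      [IsScalarTower Q (RingR f) N] (hN : ∀ x : N, g • x = 0),
      letI : Module (RingS f g) N := moduleS f g N hN
      haveI : IsScalarTower Q (RingS f g) N := (isTorsionBySet f g N hN).isScalarTower
      let TorR (n : ℕ) : ModuleCat.{u} Q := (res Q (RingR f)).obj (tor (RingR f) M N n)
      let TorQ (n : ℕ) : ModuleCat.{u} Q := tor Q M N n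
      let HW (n : ℕ) : ModuleCat.{u} Q :=
        (res Q (RingS f g)).obj ((tensorComplex T.W N).homology n)
      let δ (n : ℕ) : TorR (n + 2) ⟶ TorR n := T.δ N hq n
      ∃ (χ : ∀ n, TorR n ⟶ HW (n + 1)) (ψ : ∀ n, HW n ⟶ TorR n)
        (κ : ∀ n, TorQ n ⟶ TorQ (n + 2)) (φ : ∀ n, TorQ n ⟶ HW n)
        (μ : ∀ n, HW (n + 3) ⟶ TorQ n),
        ((∀ n, Function.Exact (χ n) (ψ (n + 1))) ∧
          (∀ n, Function.Exact (ψ (n + 2)) (δ n)) ∧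
          (∀ n, Function.Exact (δ n) (χ n)) ∧
          Function.Bijective (ψ 0) ∧ Function.Surjective (ψ 1)) ∧
        ((∀ n, Function.Exact (μ n) (κ n)) ∧
          (∀ n, Function.Exact (κ n) (φ (n + 2))) ∧
          (∀ n, Function.Exact (φ (n + 3)) (μ n)) ∧
          Function.Bijective (φ 0) ∧ Function.Bijective (φ 1) ∧ Function.Surjective (φ 2)) ∧
        ∀ n, IsChangeOfRings M N n (φ n ≫ ψ n) := by
  have hQ : ∀ n : ℕ, IsUnit ((n + 1 : ℕ) : Q) := isUnit_natCast_succ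
  refine ⟨nonempty_dgResolution hfg M (smul_eq_zero_of_isScalarTower f),
    fun D => ⟨⟨D.eisenbudLift hQ⟩, fun T => ⟨T.quasiIso_augR hQ, ?_⟩⟩⟩
  intro N _ _ _ _ hN
  let _ : Module (RingS f g) N := moduleS f g N hN
  have : IsScalarTower Q (RingS f g) N := (isTorsionBySet f g N hN).isScalarTower
  intro TorR TorQ HW δ
  let E₁ := T.extensionW N
  let E₂ := (T.splittingU N hQ hN).toShiftedExtension
  -- The isomorphisms `a`, `b`, `c` carry the sequences of `E₁` and `E₂`, which concern homology of
  -- explicit complexes, to the Tor modules and to restricted scalars.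
  let a (n : ℕ) := T.torRIso N (T.quasiIso_augR hQ) n
  let b (n : ℕ) := torIso D.resolutionQ N n
  let c (n : ℕ) := (resHomologyIso Q (tensorComplex T.W N) n).symm
  let F := res Q (RingS f g)
  -- The prescribed $\delta$ is the connecting map of `E₁`, so its exactness is that of the
  -- extension.
  have hδ (n : ℕ) : δ n = (a (n + 2)).hom ≫ F.map (E₁.θH n) ≫ (a n).inv := by
    rw [T.θH_extensionW]; rfl
  refine ⟨fun n => (a n).hom ≫ F.map (E₁.iH n) ≫ (Iso.refl (HW (n + 1))).inv,
    fun n => (Iso.refl (HW n)).hom ≫ F.map (E₁.pH n) ≫ (a n).inv,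
    fun n => (b n).hom ≫ E₂.iH n ≫ (b (n + 2)).inv,
    fun n => (b n).hom ≫ E₂.pH n ≫ (c n).inv,
    fun n => (c (n + 3)).hom ≫ E₂.θH n ≫ (b n).inv,
    ⟨fun n => exact_of_iso (u := F.map (E₁.iH n)) (v := F.map (E₁.pH (n + 1))) _ _ _
        (E₁.exact_iH_pH n),
      fun n => ?_, fun n => ?_,
      bijective_of_iso (u := F.map (E₁.pH 0)) _ _ (E₁.bijective_pH one_pos),
      surjective_of_iso (u := F.map (E₁.pH 1)) _ _ (E₁.surjective_pH le_rfl)⟩,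
    ⟨fun n => exact_of_iso _ _ _ (E₂.exact_θH_iH n), fun n => exact_of_iso _ _ _ (E₂.exact_iH_pH n),
      fun n => exact_of_iso _ _ _ (E₂.exact_pH_θH n),
      bijective_of_iso _ _ (E₂.bijective_pH two_pos),
      bijective_of_iso _ _ (E₂.bijective_pH one_lt_two),
      surjective_of_iso _ _ (E₂.surjective_pH le_rfl)⟩, fun n => ?_⟩
  · rw [hδ]
    exact exact_of_iso (u := F.map (E₁.pH (n + 2))) (v := F.map (E₁.θH n)) _ _ _ (E₁.exact_pH_θH n)
  · rw [hδ]
    exact exact_of_iso (u := F.map (E₁.θH n)) (v := F.map (E₁.iH n)) _ _ _ (E₁.exact_θH_iH n)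
  · exact T.isChangeOfRings_comp N hQ _ n
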